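/- Let $n\ge 0$. There is a finite list of non-zero polynomials with integer coefficients ("resonances"), depending only on $n$, each in at most $2n+2$ vector variables $y_1,y_2,\dots$ with $y_a\in\mathbb C^n$, such that the following holds for every $m$ and every list $S=(v_1,\dots,v_m)$ of vectors of $\mathbb Z^n$ which is generic, i.e. such that no resonance vanishes at any choice of entries of the list with distinct indices. Notation. $S^c=\mathbb Z^n\setminus S$ and $\pi(\mu)=\sum_i\mu_iv_i$ for $\mu\in\mathbb Z^m$; $e_1,\dots,e_m$ is the standard basis of $\mathbb Z^m$. The geometric graph $\Gamma_S$ has vertex set $\mathbb R^n$. For $i\neq j$ there is a black edge from $a$ to $b$ marked $v_j-v_i$ if $b-a=v_j-v_i$ and $|b|^2-|a|^2=|v_j|^2-|v_i|^2$, and a red edge between $a$ and $b$ marked $v_i+v_j$ if $a+b=v_i+v_j$ and $|a|^2+|b|^2=|v_i|^2+|v_j|^2$ (we speak of an edge of type $(i,j)$). The combinatorial graph $\Lambda_S$ has vertex set $\mathbb Z^m\times\{\pm\}$. Write $k=-\pi(\mu)$ and $h=-\pi(\nu)$. For $i\ne j$ there is a black edge from $(\mu,\sigma)$ to $(\nu,\sigma)$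 marked $(i,j)$ if $\nu=\mu+e_i-e_j$ and $|h|^2-|k|^2=|v_j|^2-|v_i|^2$, and a red edge between $(\mu,\sigma)$ and $(\nu,-\sigma)$ marked $(i,j)$ if $\mu+\nu+e_i+e_j=0$ and $|h|^2+|k|^2=|v_i|^2+|v_j|^2$. For $\xi\in\mathbb R_{>0}^m$ let $N=\sum_i\omega_iy_i+\sum_{k\in S^c}\Omega_k|z_k|^2+Q$, where $\omega_i=|v_i|^2-2\xi_i+4\sum_j\xi_j$, $\Omega_k=|k|^2+4\sum_j\xi_j$ and $$Q=4\sum_{i\ne j}\sqrt{\xi_i\xi_j}\,e^{\mathrm i(x_i-x_j)}z_h\bar z_k+2\sum_{i<j}\sqrt{\xi_i\xi_j}\,e^{-\mathrm i(x_i+x_j)}z_hz_k+2\sum_{i<j}\sqrt{\xi_i\xi_j}\,e^{\mathrm i(x_i+x_j)}\bar z_h\bar z_k ;$$ here $h,k$ run over $S^c$, in the first sum with $h+v_i=k+v_j$, $|h|^2+|v_i|^2=|k|^2+|v_j|^2$, in the other two with $h+k=v_i+v_j$, $|h|^2+|k|^2=|v_i|^2+|v_j|^2$. Put $ad(F)=\{F,\cdot\}$,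 where $$\{F,G\}=\sum_j\big(\partial_{y_j}F\,\partial_{x_j}G-\partial_{y_j}G\,\partial_{x_j}F\big)+\mathrm i\sum_{k\in S^c}\big(\partial_{\bar z_k}F\,\partial_{z_k}G-\partial_{z_k}F\,\partial_{\bar z_k}G\big).$$ To each vertex $(\mu,\sigma)$ of $\Lambda_S$ with $k=-\pi(\mu)\in S^c$ we associate the element of the frequency basis $e_{(\mu,+)}=e^{\mathrm i\mu\cdot x}z_k$, $e_{(\mu,-)}=e^{-\mathrm i\mu\cdot x}\bar z_k$. Conclusions. (0) For vertices $p\neq q$ of $\Lambda_S$ with $-\pi(p),-\pi(q)\in S^c$ and every $\xi$, the coefficient of $e_q$ in $ad(N)e_p$ is non-zero if and only if $p,q$ are joined by an edge of $\Lambda_S$. For every $i$, the connected component of $v_i$ in $\Gamma_S$ has vertex set $\{v_1,\dots,v_m\}$ (the special component). Let $p=(\mu,\sigma)$ be any vertex of $\Lambda_S$ with $k=-\pi(\mu)\in S^c$, let $\mathcal A$ be its connected component in $\Lambda_S$ and $A$ the connected component of $k$ in $\Gamma_S$. (1) The map $(\nu,\tau)\mapsto-\pi(\nu)$ is a graph isomorphism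 from $\mathcal A$ onto $A$, compatible with colours and markings: for $q,q'\in\mathcal A$ and $i\ne j$ there is a black (red) edge marked $(i,j)$ from $q$ to $q'$ if and only if there is a black (red) edge of type $(i,j)$ from $-\pi(q)$ to $-\pi(q')$. (2) Let $W$ be the complex vector space spanned by all the transforms of $e_p$ obtained by repeatedly applying the operators $ad(N)$, with parameters $\xi\in\mathbb R_{>0}^m$. Then $W$ has a basis $(b_x)_{x\in A}$ indexed by the vertices of $A$, where $b_x=e_q$ for a vertex $q\in\mathcal A$ with $-\pi(q)=x$. The same space is obtained with $ad(Q)$ in place of $ad(N)$. For every fixed $\xi\in\mathbb R_{>0}^m$, $W$ is $ad(N)$-invariant, and it is contained in every $ad(N)$-invariant subspace that contains $e_p$ and is spanned by elements of the frequency basis. -/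

import Mathlib

namespace NLSGraph

open scoped Matrix

/-! ## Tangential sites and genericity -/

/-- A list `v` of `m` tangential sites in `ℤⁿ` is generic with respect to a finite list `R` of
resonance polynomials if no polynomial of the list vanishes at any choice of entries, with distinct indices, of
the list of sites. A resonance is a pair `⟨k, P⟩`, where `P` is an integer polynomial in the
`k * n` coordinates of `k` vector variables. -/
def IsGeneric {n m : ℕ} (R : Finset (Σ k : ℕ, MvPolynomial (Fin k × Fin n) ℤ))
    (v : Fin m → Fin n → ℤ) : Prop :=
  ∀ r ∈ R, ∀ f : Fin r.1 ↪ Fin m,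
    MvPolynomial.eval (fun a : Fin r.1 × Fin n => v (f a.1) a.2) r.2 ≠ 0

/-- The normal sites: the lattice points which are not tangential. -/
abbrev NormalSite {n m : ℕ} (v : Fin m → Fin n → ℤ) : Type :=
  {k : Fin n → ℤ // k ∉ Set.range v}

/-- The inclusion of `ℤⁿ` in Euclidean space. -/
noncomputable def toEuclid {n : ℕ} (k : Fin n → ℤ) : EuclideanSpace ℝ (Fin n) :=
  WithLp.toLp 2 (fun l => (k l : ℝ))

/-! ## The geometric graph -/

/-- Points `a`, `b` are joined by a black edge, oriented from `a` to `b`, with marking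
`v j - v i`. -/
def GeoBlack {n m : ℕ} (v : Fin m → Fin n → ℤ) (i j : Fin m)
    (a b : EuclideanSpace ℝ (Fin n)) : Prop :=
  b - a = toEuclid (v j) - toEuclid (v i) ∧
    ‖b‖ ^ 2 - ‖a‖ ^ 2 = ‖toEuclid (v j)‖ ^ 2 - ‖toEuclid (v i)‖ ^ 2

/-- Points `a`, `b` are joined by a red edge with marking `v i + v j`. -/
def GeoRed {n m : ℕ} (v : Fin m → Fin n → ℤ) (i j : Fin m)
    (a b : EuclideanSpace ℝ (Fin n)) : Prop :=
  a + b = toEuclid (v i) + toEuclid (v j) ∧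
    ‖a‖ ^ 2 + ‖b‖ ^ 2 = ‖toEuclid (v i)‖ ^ 2 + ‖toEuclid (v j)‖ ^ 2

/-- The geometric graph `Γ_S`, whose vertices are all the points of `ℝⁿ`. -/
def geometricGraph {n m : ℕ} (v : Fin m → Fin n → ℤ) :
    SimpleGraph (EuclideanSpace ℝ (Fin n)) :=
  SimpleGraph.fromRel fun a b => ∃ i j : Fin m, i ≠ j ∧ (GeoBlack v i j a b ∨ GeoRed v i j a b)

/-! ## The combinatorial graph -/

/-- A frequency with a sign: `(μ, 1)` stands for `e^{iμ·x} z_k` and `(μ, -1)` for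
`e^{-iμ·x} z̄_k`, with `k = -π(μ)`. -/
abbrev Frequency (m : ℕ) : Type := (Fin m → ℤ) × ℤˣ

/-- The map `π : ℤᵐ → ℤⁿ`, `π(μ) = ∑ μᵢ vᵢ`. -/
def momentum {n m : ℕ} (v : Fin m → Fin n → ℤ) (μ : Fin m → ℤ) : Fin n → ℤ :=
  ∑ i, μ i • v i

/-- The site `-π(μ)` of the frequency `(μ, σ)`. -/
def site {n m : ℕ} (v : Fin m → Fin n → ℤ) (p : Frequency m) : Fin n → ℤ :=
  -momentum v p.1

/-- The basis vector `e_i` of `ℤᵐ`. -/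
def unitVec {m : ℕ} (i : Fin m) : Fin m → ℤ := Pi.single i 1

/-- Black edge of the combinatorial graph, oriented from `p` to `q`, with marking `(i, j)`. -/
def CombBlack {n m : ℕ} (v : Fin m → Fin n → ℤ) (i j : Fin m) (p q : Frequency m) : Prop :=
  p.2 = q.2 ∧ q.1 = p.1 + unitVec i - unitVec j ∧
    site v q ⬝ᵥ site v q - site v p ⬝ᵥ site v p = v j ⬝ᵥ v j - v i ⬝ᵥ v i

/-- Red edge of the combinatorial graph, with marking `(i, j)`. -/
def CombRed {n m : ℕ} (v : Fin m → Fin n → ℤ) (i j : Fin m) (p q : Frequency m) : Prop :=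
  p.2 = -q.2 ∧ p.1 + q.1 + unitVec i + unitVec j = 0 ∧
    site v p ⬝ᵥ site v p + site v q ⬝ᵥ site v q = v i ⬝ᵥ v i + v j ⬝ᵥ v j

/-- The combinatorial graph `Λ_S`, with vertices `ℤᵐ × ℤ/(2)`. -/
def combinatorialGraph {n m : ℕ} (v : Fin m → Fin n → ℤ) : SimpleGraph (Frequency m) :=
  SimpleGraph.fromRel fun p q => ∃ i j : Fin m, i ≠ j ∧ (CombBlack v i j p q ∨ CombRed v i j p q)

/-! ## The Poisson algebra of finite sums of monomials `e^{iν·x} y^c z^α z̄^β` -/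

/-- Exponents `(ν, c, γ)` of the monomial `e^{iν·x} y^c ∏ z_k^{γ(k, 1)} z̄_k^{γ(k, -1)}`. -/
abbrev Exponent {n m : ℕ} (v : Fin m → Fin n → ℤ) : Type :=
  (Fin m → ℤ) × (Fin m →₀ ℕ) × (NormalSite v × ℤˣ →₀ ℕ)

/-- Finite complex combinations of monomials, with the product of functions. -/
abbrev PoissonAlg {n m : ℕ} (v : Fin m → Fin n → ℤ) : Type := AddMonoidAlgebra ℂ (Exponent v)

/-- The function `c e^{iν·x}`. -/
noncomputable def expX {n m : ℕ} (v : Fin m → Fin n → ℤ) (c : ℂ) (ν : Fin m → ℤ) :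
    PoissonAlg v :=
  AddMonoidAlgebra.single (ν, 0, 0) c

/-- The coordinate `y_j`. -/
noncomputable def varY {n m : ℕ} (v : Fin m → Fin n → ℤ) (j : Fin m) : PoissonAlg v :=
  AddMonoidAlgebra.single (0, Finsupp.single j 1, 0) 1

/-- The coordinate `z_k` (for `σ = 1`) or `z̄_k` (for `σ = -1`). -/
noncomputable def varW {n m : ℕ} {v : Fin m → Fin n → ℤ} (k : NormalSite v) (σ : ℤˣ) :
    PoissonAlg v :=
  AddMonoidAlgebra.single (0, 0, Finsupp.single (k, σ) 1) 1

/-- The derivative `∂/∂x_j`. -/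
noncomputable def derivX {n m : ℕ} {v : Fin m → Fin n → ℤ} (j : Fin m) (F : PoissonAlg v) :
    PoissonAlg v :=
  F.coeff.sum fun a c => AddMonoidAlgebra.single a (Complex.I * (a.1 j : ℂ) * c)

/-- The derivative `∂/∂y_j`. -/
noncomputable def derivY {n m : ℕ} {v : Fin m → Fin n → ℤ} (j : Fin m) (F : PoissonAlg v) :
    PoissonAlg v :=
  F.coeff.sum fun a c =>
    AddMonoidAlgebra.single (a.1, a.2.1 - Finsupp.single j 1, a.2.2) ((a.2.1 j : ℂ) * c)

/-- The derivative `∂/∂z_k` (for `σ = 1`) or `∂/∂z̄_k` (for `σ = -1`). -/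
noncomputable def derivW {n m : ℕ} {v : Fin m → Fin n → ℤ} (k : NormalSite v) (σ : ℤˣ)
    (F : PoissonAlg v) : PoissonAlg v :=
  F.coeff.sum fun a c =>
    AddMonoidAlgebra.single (a.1, a.2.1, a.2.2 - Finsupp.single (k, σ) 1) ((a.2.2 (k, σ) : ℂ) * c)

/-- The Poisson bracket of the symplectic form `dy ∧ dx + i dz ∧ dz̄`. The sum over the sites has
finite support, since only finitely many sites occur in `F`. -/
noncomputable def poisson {n m : ℕ} {v : Fin m → Fin n → ℤ} (F G : PoissonAlg v) :
    PoissonAlg v :=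
  (∑ j, (derivY j F * derivX j G - derivY j G * derivX j F)) +
    Complex.I • ∑ᶠ k : NormalSite v,
      (derivW k (-1) F * derivW k 1 G - derivW k 1 F * derivW k (-1) G)

/-! ## The quadratic normal form -/

/-- The frequency `ω_i(ξ) = |v_i|² - 2 ξ_i + 4 ∑ ξ_j`. -/
noncomputable def omega {n m : ℕ} (v : Fin m → Fin n → ℤ) (ξ : Fin m → ℝ) (i : Fin m) : ℝ :=
  ((v i ⬝ᵥ v i : ℤ) : ℝ) - 2 * ξ i + 4 * ∑ j, ξ j

/-- The normal frequency `Ω_k(ξ) = |k|² + 4 ∑ ξ_j`. -/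
noncomputable def Omega {n m : ℕ} {v : Fin m → Fin n → ℤ} (ξ : Fin m → ℝ) (k : NormalSite v) : ℝ :=
  ((k.1 ⬝ᵥ k.1 : ℤ) : ℝ) + 4 * ∑ j, ξ j

/-- Index set of the terms `z_h z̄_k`: quadruples `(i, j, h, k)` with `i ≠ j`,
`h + v_i = k + v_j` and `|h|² + |v_i|² = |k|² + |v_j|²`. -/
def BlackTerm {n m : ℕ} (v : Fin m → Fin n → ℤ) : Type :=
  {t : Fin m × Fin m × NormalSite v × NormalSite v //
    t.1 ≠ t.2.1 ∧ t.2.2.1.1 + v t.1 = t.2.2.2.1 + v t.2.1 ∧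
      t.2.2.1.1 ⬝ᵥ t.2.2.1.1 + v t.1 ⬝ᵥ v t.1 = t.2.2.2.1 ⬝ᵥ t.2.2.2.1 + v t.2.1 ⬝ᵥ v t.2.1}

/-- Index set of the terms `z_h z_k` and `z̄_h z̄_k`: quadruples `(i, j, h, k)` with `i < j`,
`h + k = v_i + v_j` and `|h|² + |k|² = |v_i|² + |v_j|²`. -/
def RedTerm {n m : ℕ} (v : Fin m → Fin n → ℤ) : Type :=
  {t : Fin m × Fin m × NormalSite v × NormalSite v //
    t.1 < t.2.1 ∧ t.2.2.1.1 + t.2.2.2.1 = v t.1 + v t.2.1 ∧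
      t.2.2.1.1 ⬝ᵥ t.2.2.1.1 + t.2.2.2.1 ⬝ᵥ t.2.2.2.1 = v t.1 ⬝ᵥ v t.1 + v t.2.1 ⬝ᵥ v t.2.1}

/-- The operator `ad(Q) : f ↦ {Q, f}` of the quadratic form
`Q = 4 ∑ √(ξᵢξⱼ) e^{i(xᵢ-xⱼ)} z_h z̄_k + 2 ∑ √(ξᵢξⱼ) e^{-i(xᵢ+xⱼ)} z_h z_k
  + 2 ∑ √(ξᵢξⱼ) e^{i(xᵢ+xⱼ)} z̄_h z̄_k`.
`Q` is a formal infinite sum, so the bracket is taken term by term. It is used only on elements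
which do not depend on `y`; for these only finitely many of the terms are non-zero. -/
noncomputable def adQ {n m : ℕ} (v : Fin m → Fin n → ℤ) (ξ : Fin m → ℝ) (f : PoissonAlg v) :
    PoissonAlg v :=
  (∑ᶠ t : BlackTerm v,
    poisson (expX v ((4 * √(ξ t.1.1 * ξ t.1.2.1) : ℝ) : ℂ) (unitVec t.1.1 - unitVec t.1.2.1) *
      varW t.1.2.2.1 1 * varW t.1.2.2.2 (-1)) f) +
  (∑ᶠ t : RedTerm v,
    poisson (expX v ((2 * √(ξ t.1.1 * ξ t.1.2.1) : ℝ) : ℂ) (-(unitVec t.1.1 + unitVec t.1.2.1)) *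
      varW t.1.2.2.1 1 * varW t.1.2.2.2 1) f) +
  (∑ᶠ t : RedTerm v,
    poisson (expX v ((2 * √(ξ t.1.1 * ξ t.1.2.1) : ℝ) : ℂ) (unitVec t.1.1 + unitVec t.1.2.1) *
      varW t.1.2.2.1 (-1) * varW t.1.2.2.2 (-1)) f)

/-- The operator `ad(N) : f ↦ {N, f}` of the normal form `N = (ω, y) + ∑ Ω_k |z_k|² + Q`, taken
term by term as for `ad(Q)`. -/
noncomputable def adN {n m : ℕ} (v : Fin m → Fin n → ℤ) (ξ : Fin m → ℝ) (f : PoissonAlg v) :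
    PoissonAlg v :=
  (∑ i, poisson ((omega v ξ i : ℂ) • varY v i) f) +
    (∑ᶠ k : NormalSite v, poisson ((Omega ξ k : ℂ) • (varW k 1 * varW k (-1))) f) + adQ v ξ f

/-! ## The frequency basis and its blocks -/

/-- The frequencies whose site is normal. -/
abbrev NormalFrequency {n m : ℕ} (v : Fin m → Fin n → ℤ) : Type :=
  {p : Frequency m // site v p ∉ Set.range v}

/-- The exponent of the basis element of a frequency. -/
noncomputable def freqExponent {n m : ℕ} {v : Fin m → Fin n → ℤ} (p : NormalFrequency v) :
    Exponent v :=
  ((p.1.2 : ℤ) • p.1.1, 0, Finsupp.single (⟨site v p.1, p.2⟩, p.1.2) 1)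

/-- The element of the frequency basis: `e^{iμ·x} z_k` for `(μ, 1)` and `e^{-iμ·x} z̄_k` for
`(μ, -1)`, where `k = -π(μ)`. -/
noncomputable def freqElem {n m : ℕ} {v : Fin m → Fin n → ℤ} (p : NormalFrequency v) :
    PoissonAlg v :=
  AddMonoidAlgebra.single (freqExponent p) 1

/-- The transforms of `f` under an operator `T ξ` which depends on the positive parameters `ξ`. -/
inductive IsTransform {n m : ℕ} {v : Fin m → Fin n → ℤ}
    (T : (Fin m → ℝ) → PoissonAlg v → PoissonAlg v) (f : PoissonAlg v) : PoissonAlg v → Prop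
  | base : IsTransform T f f
  | step (ξ : Fin m → ℝ) (g : PoissonAlg v) (hξ : ∀ i, 0 < ξ i) (hg : IsTransform T f g) :
      IsTransform T f (T ξ g)

/-- The space spanned by all the transforms of `f` under the operators `T ξ`. -/
noncomputable def block {n m : ℕ} {v : Fin m → Fin n → ℤ}
    (T : (Fin m → ℝ) → PoissonAlg v → PoissonAlg v) (f : PoissonAlg v) :
    Submodule ℂ (PoissonAlg v) :=
  Submodule.span ℂ {g | IsTransform T f g}

end NLSGraph

/-! The map `-π` is always locally faithful: an edge of `Γ_S` of type `(i, j)` at the site of `q`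
has exactly one lift starting at `q`. Statement (1) is therefore the injectivity of the site map on
a component of `Λ_S` with normal sites, and this is where genericity enters.

Follow a path from `p`, with `k = site v p`, and record the displacements `a = relative p q` of its
vertices. Mass and energy are conserved: `∑ aᵢ` is `0` (same sign, "black") or `2` (opposite sign,
"red"), and `k` satisfies the linear equation `2 k·π(a) = ∑ aᵢ|vᵢ|² - |π(a)|²`, or the sphere
equation `2|k|² - 2 k·π(a) = ∑ aᵢ|vᵢ|² - |π(a)|²`. If `n + 1` displacements were independent, `k`
would be overdetermined, and solvability would be a polynomial condition on the sites involved. By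
genericity a condition satisfied by the actual sites must be an identity
(`AvoidsResonances.eq_zero`). Such an identity forces the solution to be a fixed linear form `κ`
applied to each coordinate of the sites (`exists_common_dual_of_cramer`,
`exists_common_dual_of_det`), and `κ` must then be the evaluation at one index
(`exists_eq_apply_of_red`, `exists_eq_apply_of_black`). So `k` would be one of the `vᵢ`, contrary to
normality. Hence the rank is at most `n`.

A linear relation between displacements of one colour gives, through energy conservation, a
quadratic relation between the `|π(a)|²`; again it must be an identity, and only trivial relations
survive (`AvoidsResonances.eq_of_relation`). So at most `n` vertices of each colour follow the first
one, paths have length at most `2n`, and all supports and coefficients are bounded in terms of `n`;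
this is why finitely many resonances suffice. Finally, two vertices over one site would give `π(a) =
0` or `π(a) = 2k`, which two more families of resonances exclude.

On the frequency basis `ad(N)` is a diagonal operator plus a weighted adjacency operator of `Λ_S`,
with weights `4iσ√(ξᵢξⱼ)`. At a given vertex they share a factor times positive numbers, so nothing
cancels, which settles (0) and minimality at fixed `ξ`. For varying `ξ`, a vertex has at most one
neighbour for each unordered pair `{i, j}`, so a second difference in `√ξᵢ`, `√ξⱼ` isolates each
neighbour, and the block is spanned by the whole component. -/

namespace NLSGraph

open scoped Matrix

/-! ### Quadratic forms divisible by independent linear forms -/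

section LinearForms

variable {V σ : Type*} [AddCommGroup V] [Module ℚ V]

/-- The joint evaluation map is surjective because its transpose is injective, which is exactly
independence of the forms. This provides the test columns used below. -/
theorem exists_forall_dual_apply_eq [Fintype σ] {d : σ → Module.Dual ℚ V}
    (hd : LinearIndependent ℚ d) (f : σ → ℚ) : ∃ u, ∀ s, d s u = f s := by
  classical
  have hsurj : Function.Surjective (LinearMap.pi d) := by
    rw [← LinearMap.dualMap_injective_iff]
    rw [injective_iff_map_eq_zero]
    intro φ hφ
    have h0 : ∑ s, φ (Pi.single s 1) • d s = 0 := by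
      ext u
      have h1 := LinearMap.congr_fun hφ u
      rw [LinearMap.dualMap_apply, LinearMap.pi_apply_eq_sum_univ φ] at h1
      simp only [LinearMap.pi_apply, smul_eq_mul, LinearMap.zero_apply] at h1
      rw [LinearMap.sum_apply, LinearMap.zero_apply, ← h1]
      refine Finset.sum_congr rfl fun s _ => ?_
      rw [LinearMap.smul_apply, smul_eq_mul, mul_comm]
      congr 2
      ext t
      simp [Pi.single_apply, eq_comm]
    have h2 := Fintype.linearIndependent_iff.1 hd _ h0
    ext s
    simpa using h2 s
  obtain ⟨u, hu⟩ := hsurj f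
  exact ⟨u, fun s => congrFun hu s⟩

/-- A quadratic form which vanishes on the kernel of a linear form is divisible by it. -/
theorem exists_dual_of_forall_ker {d : Module.Dual ℚ V} (hd : d ≠ 0) (r : QuadraticForm ℚ V)
    (h : ∀ u, d u = 0 → r u = 0) : ∃ κ : Module.Dual ℚ V, ∀ u, r u = 2 * d u * κ u := by
  obtain ⟨u₁, hu₁⟩ : ∃ u, d u ≠ 0 := by
    by_contra hcon
    push Not at hcon
    exact hd (LinearMap.ext hcon)
  obtain ⟨u₀, hu₀⟩ : ∃ u, d u = 1 := ⟨(d u₁)⁻¹ • u₁, by simp [hu₁]⟩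
  -- Expanding `r` at `u = (u - d u • u₀) + d u • u₀`, whose first summand lies in the kernel of
  -- `d`, gives `r u = d u * polar r u u₀ - (d u)² * r u₀`.
  refine ⟨(2⁻¹ : ℚ) • (QuadraticMap.polarBilin r u₀ - r u₀ • d), fun u => ?_⟩
  have h1 : r (u - d u • u₀) = 0 := h _ (by simp [hu₀])
  have h2 : r ((u - d u • u₀) + d u • u₀) = _ := QuadraticMap.map_add r _ _
  rw [sub_add_cancel, h1, QuadraticMap.map_smul, QuadraticMap.polar_smul_right,
    QuadraticMap.polar_sub_left, QuadraticMap.polar_smul_left, QuadraticMap.polar_self,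
    QuadraticMap.polar_comm] at h2
  rw [h2]
  simp only [smul_eq_mul, LinearMap.smul_apply, LinearMap.sub_apply,
    QuadraticMap.polarBilin_apply_apply]
  ring

/-- Each `r s` has its own cofactor `κ s`; proportionality gives `d s * d t * (κ s - κ t) = 0` at
every point. Where `d s₀` vanishes the factor is removed by moving along a line. -/
theorem exists_common_dual [Nonempty σ] {d : σ → Module.Dual ℚ V} (hd : ∀ s, d s ≠ 0)
    (r : σ → QuadraticForm ℚ V) (h₁ : ∀ s u, d s u = 0 → r s u = 0)
    (h₂ : ∀ s t u, d t u * r s u = d s u * r t u) :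
    ∃ κ : Module.Dual ℚ V, ∀ s u, r s u = 2 * d s u * κ u := by
  choose κ hκ using fun s => exists_dual_of_forall_ker (hd s) (r s) (h₁ s)
  obtain ⟨s₀⟩ := ‹Nonempty σ›
  refine ⟨κ s₀, fun s u => ?_⟩
  rw [hκ]
  have hall : ∀ u, (d s u * d s₀ u) * (κ s u - κ s₀ u) = 0 := fun u => by
    have := h₂ s s₀ u
    rw [hκ, hκ] at this
    linear_combination this / 2
  by_cases hu : d s u = 0
  · simp [hu]
  -- a point where both forms are nonzero, approached along a line
  obtain ⟨a, ha⟩ : ∃ a, d s₀ a ≠ 0 := by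
    by_contra hcon
    push Not at hcon
    exact hd s₀ (LinearMap.ext hcon)
  by_cases hu0 : d s₀ u = 0
  · have hpoly : ∀ t : ℚ, t ≠ 0 → (d s u + t * d s a) *
        ((κ s u - κ s₀ u) + t * (κ s a - κ s₀ a)) = 0 := fun t ht => by
      have := hall (u + t • a)
      simp only [map_add, map_smul, smul_eq_mul, hu0, zero_add] at this
      have h3 : t * d s₀ a ≠ 0 := mul_ne_zero ht ha
      have h4 : (t * d s₀ a) * ((d s u + t * d s a) *
        ((κ s u - κ s₀ u) + t * (κ s a - κ s₀ a))) = 0 := by linear_combination this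
      exact (mul_eq_zero.1 h4).resolve_left h3
    -- The expression has degree at most two in `t`, so its value at `0` is a combination of its
    -- values at `1`, `-1` and `2`.
    have e1 := hpoly 1 (by norm_num)
    have e2 := hpoly (-1) (by norm_num)
    have e3 := hpoly 2 (by norm_num)
    have : d s u * (κ s u - κ s₀ u) = 0 := by linear_combination e1 + e2 / 3 - e3 / 3
    linear_combination 2 * this
  · have := (mul_eq_zero.1 (hall u)).resolve_left (mul_ne_zero hu hu0)
    linear_combination 2 * d s u * this

/-- By Cramer's rule `x = K / (2 det M)` solves `2 M x = (∑ⱼ r s (w j))ₛ`; the hypothesis is the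
sphere equation `2|x|² - 2 x·α - ∑ q = 0` multiplied by `2 (det M)²`. It says that the linear system
and the sphere are compatible for all columns `w`, including those for which `M` is singular, and
the singular ones give the divisibility. -/
theorem exists_common_dual_of_cramer [Nonempty σ] [Fintype σ] [DecidableEq σ]
    {d : σ → Module.Dual ℚ V} (hd : LinearIndependent ℚ d) (r : σ → QuadraticForm ℚ V)
    (α : Module.Dual ℚ V) (q : QuadraticForm ℚ V)
    (h : ∀ w : σ → V, ∀ M : Matrix σ σ ℚ, (∀ s j, M s j = d s (w j)) → ∀ K : σ → ℚ,
      K = M.cramer (fun s => ∑ j, r s (w j)) →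
        K ⬝ᵥ K - 2 * M.det * (K ⬝ᵥ fun j => α (w j)) - 2 * M.det ^ 2 * ∑ j, q (w j) = 0) :
    ∃ κ : Module.Dual ℚ V, (∀ s u, r s u = 2 * d s u * κ u) ∧
      ∀ u, 2 * κ u * κ u - 2 * κ u * α u - q u = 0 := by
  -- At a singular `M` the hypothesis reduces to `K ⬝ᵥ K = 0`, so `K = 0` over `ℚ`: a linear
  -- relation between the rows of `M` must also hold for the right-hand sides.
  have key : ∀ (c : σ → ℚ) (u : V), ∑ s, c s * d s u = 0 → ∑ s, c s * r s u = 0 := by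
    intro c u hcu
    by_contra hne
    obtain ⟨s₀, hs₀⟩ : ∃ s, c s ≠ 0 := by
      by_contra hcon
      push Not at hcon
      exact hne (by simp [hcon])
    -- These columns are killed by `c` on the left, and every left null vector of all of them is a
    -- multiple of `c`. The remaining column is `t • u`.
    choose z hz using fun j : σ => exists_forall_dual_apply_eq hd
      (fun s => if s = s₀ then -(c j / c s₀) else if s = j then 1 else 0)
    let w : ℚ → σ → V := fun t j => if j = s₀ then t • u else z j
    have hw0 : ∀ t, w t s₀ = t • u := fun t => by simp [w]
    have hw1 : ∀ t j, j ≠ s₀ → w t j = z j := fun t j hj => by simp [w, hj]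
    have hsum : ∀ (t : ℚ) (y : σ → ℚ), ∀ j, j ≠ s₀ →
        ∑ s, y s * d s (w t j) = y j - c j / c s₀ * y s₀ := by
      intro t y j hj
      rw [hw1 t j hj]
      rw [← Finset.add_sum_erase _ _ (Finset.mem_univ s₀), hz, if_pos rfl,
        Finset.sum_eq_single j]
      · rw [hz, if_neg hj, if_pos rfl]; ring
      · intro b hb hbj
        rw [hz, if_neg (Finset.ne_of_mem_erase hb), if_neg hbj, mul_zero]
      · intro hj'
        exact absurd (Finset.mem_erase.2 ⟨hj, Finset.mem_univ _⟩) hj'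
    have hR : ∀ t s, ∑ j, r s (w t j) =
        t ^ 2 * r s u + ∑ j ∈ Finset.univ.erase s₀, r s (z j) := by
      intro t s
      rw [← Finset.add_sum_erase _ _ (Finset.mem_univ s₀), hw0, QuadraticMap.map_smul, sq,
        smul_eq_mul]
      congr 1
      exact Finset.sum_congr rfl fun j hj => by rw [hw1 t j (Finset.ne_of_mem_erase hj)]
    -- The sum is `t² ∑ c s * r s u` plus a constant, with nonzero leading coefficient, so it cannot
    -- vanish at both `0` and `1`.
    obtain ⟨t, ht⟩ : ∃ t, ∑ s, c s * ∑ j, r s (w t j) ≠ 0 := by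
      by_contra hcon
      push Not at hcon
      have e0 := hcon 0
      have e1 := hcon 1
      simp only [hR, mul_add, Finset.sum_add_distrib] at e0 e1
      apply hne
      simp only [one_pow, one_mul, ne_eq, OfNat.ofNat_ne_zero, not_false_eq_true, zero_pow,
        zero_mul, mul_zero, Finset.sum_const_zero] at e0 e1
      linarith
    set M : Matrix σ σ ℚ := Matrix.of fun s j => d s (w t j) with hM
    have hdet : M.det = 0 := by
      rw [← Matrix.exists_vecMul_eq_zero_iff]
      refine ⟨c, fun hc => hs₀ (by rw [hc]; rfl), ?_⟩
      ext j
      simp only [Matrix.vecMul, dotProduct, hM, Matrix.of_apply, Pi.zero_apply]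
      by_cases hj : j = s₀
      · subst hj
        simp only [hw0, map_smul, smul_eq_mul]
        rw [← mul_zero t, ← hcu, Finset.mul_sum]
        exact Finset.sum_congr rfl fun s _ => by ring
      · rw [hsum t c j hj]
        field_simp
        ring
    have hP := h (w t) M (fun s j => rfl) _ rfl
    rw [hdet] at hP
    simp only [mul_zero, zero_mul, sub_zero, ne_eq, OfNat.ofNat_ne_zero, not_false_eq_true,
      zero_pow] at hP
    -- The entry `s₀` of `K` is the determinant of `M` with the column `t • u` replaced by the
    -- right-hand side. Its left null vector is a multiple of `c`, so `c` would annihilate the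
    -- right-hand side, against the choice of `t`.
    have hK := congrFun (dotProduct_self_eq_zero.1 hP) s₀
    rw [Matrix.cramer_apply, Pi.zero_apply, ← Matrix.exists_vecMul_eq_zero_iff] at hK
    obtain ⟨y, hy0, hy⟩ := hK
    have hyj : ∀ j, y j = c j / c s₀ * y s₀ := by
      intro j
      by_cases hj : j = s₀
      · subst hj; field_simp
      · have := congrFun hy j
        simp only [Matrix.vecMul, dotProduct, Matrix.updateCol_apply, if_neg hj, hM,
          Matrix.of_apply, Pi.zero_apply] at this
        rw [hsum t y j hj] at this
        linarith
    have hyR := congrFun hy s₀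
    simp only [Matrix.vecMul, dotProduct, Matrix.updateCol_apply, if_true, Pi.zero_apply] at hyR
    have h5 : y s₀ / c s₀ * ∑ s, c s * ∑ j, r s (w t j) = 0 := by
      rw [← hyR, Finset.mul_sum]
      refine Finset.sum_congr rfl fun s _ => ?_
      rw [hyj s]
      ring
    have h6 := (mul_eq_zero.1 h5).resolve_right ht
    have h7 : y s₀ = 0 := by
      rcases div_eq_zero_iff.1 h6 with h | h
      · exact h
      · exact absurd h hs₀
    exact hy0 (funext fun j => by rw [hyj, h7, mul_zero]; rfl)
  have hd0 : ∀ s, d s ≠ 0 := fun s => hd.ne_zero s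
  obtain ⟨κ, hκ⟩ := exists_common_dual hd0 r
    (fun s u hu => by
      have := key (Pi.single s 1) u (by simp [Pi.single_apply, hu])
      simpa [Pi.single_apply] using this)
    (fun s t u => by
      have := key (Pi.single s (d t u) - Pi.single t (d s u)) u (by
        simp only [Pi.sub_apply, sub_mul, Finset.sum_sub_distrib, Pi.single_apply, ite_mul,
          zero_mul, Finset.sum_ite_eq', Finset.mem_univ, if_true]
        ring)
      simp only [Pi.sub_apply, sub_mul, Finset.sum_sub_distrib, Pi.single_apply, ite_mul,
        zero_mul, Finset.sum_ite_eq', Finset.mem_univ, if_true] at this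
      linarith)
  refine ⟨κ, hκ, fun u => ?_⟩
  -- With columns `u + t • z j`, the matrix is `t + A`, where all the columns of `A` are `(d s u)ₛ`.
  -- Its determinant is a monic polynomial in `t` and can be cancelled; the constant term of the
  -- remaining factor is `card σ * G u`.
  choose z hz using fun j : σ => exists_forall_dual_apply_eq hd (Pi.single j 1)
  set G : QuadraticForm ℚ V := 2 • QuadraticMap.sq.comp κ - 2 • QuadraticMap.linMulLin κ α - q
    with hG
  have hGu : ∀ u, G u = 2 * κ u * κ u - 2 * κ u * α u - q u := fun u => by
    simp [hG]; ring
  rw [← hGu]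
  let B : ℚ := ∑ j, QuadraticMap.polar G u (z j)
  let C : ℚ := ∑ j, G (z j)
  let A : Matrix σ σ ℚ := Matrix.of fun s _ => d s u
  have hall : ∀ t : ℚ, ((-A).charpoly.eval t) ^ 2 *
      ((Fintype.card σ : ℚ) * G u + B * t + C * t ^ 2) = 0 := by
    intro t
    set M : Matrix σ σ ℚ := Matrix.of fun s j => d s (u + t • z j) with hM
    have hMd : (-A).charpoly.eval t = M.det := by
      rw [Matrix.eval_charpoly]
      congr 1
      ext s j
      simp only [hM, A, Matrix.sub_apply, Matrix.scalar_apply, Matrix.neg_apply, Matrix.of_apply,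
        map_add, map_smul, hz, smul_eq_mul, Matrix.diagonal_apply, Pi.single_apply]
      split_ifs <;> ring
    have hK : M.cramer (fun s => ∑ j, r s (u + t • z j)) =
        (2 * M.det) • fun j => κ (u + t • z j) := by
      have : (fun s => ∑ j, r s (u + t • z j)) = M *ᵥ ((2 : ℚ) • fun j => κ (u + t • z j)) := by
        ext s
        simp only [Matrix.mulVec, dotProduct, hM, Matrix.of_apply, hκ, Pi.smul_apply, smul_eq_mul]
        exact Finset.sum_congr rfl fun j _ => by ring
      rw [this, Matrix.cramer_eq_adjugate_mulVec, Matrix.mulVec_mulVec, Matrix.adjugate_mul,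
        Matrix.smul_mulVec, Matrix.one_mulVec, smul_smul, mul_comm]
    have hP := h (fun j => u + t • z j) M (fun s j => rfl) _ hK.symm
    have hsumG : ∑ j, G (u + t • z j) = (Fintype.card σ : ℚ) * G u + B * t + C * t ^ 2 := by
      simp only [QuadraticMap.map_add, QuadraticMap.map_smul, QuadraticMap.polar_smul_right,
        Finset.sum_add_distrib, B, C, Finset.sum_mul, smul_eq_mul]
      rw [Finset.sum_const, Finset.card_univ, nsmul_eq_mul, add_assoc, add_assoc]
      congr 1
      rw [add_comm]
      congr 1 <;> exact Finset.sum_congr rfl fun j _ => by ring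
    rw [hMd, ← hsumG]
    have : (2 * M.det) * (M.det * ∑ j, G (u + t • z j)) = 0 := by
      rw [← hP]
      simp only [hGu, Finset.sum_sub_distrib, dotProduct, Pi.smul_apply, smul_eq_mul,
        Finset.mul_sum, mul_sub]
      congr 1
      congr 1
      all_goals exact Finset.sum_congr rfl fun j _ => by ring
    linear_combination this / 2
  have hpoly : (-A).charpoly ^ 2 * (Polynomial.C ((Fintype.card σ : ℚ) * G u) +
      Polynomial.C B * Polynomial.X + Polynomial.C C * Polynomial.X ^ 2) = 0 := by
    apply Polynomial.funext
    intro t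
    simpa using hall t
  have h0 := (mul_eq_zero.1 hpoly).resolve_left (pow_ne_zero _ (Matrix.charpoly_monic _).ne_zero)
  have h1 := congrArg (Polynomial.eval 0) h0
  simp at h1
  exact h1

/-- Here there are `n + 1` linear equations for `n` unknowns, and their compatibility is the
vanishing of the extended determinant. Choosing all columns but one dual to the forms other than `d
s`, `d t` reduces it to a `2 × 2` determinant. The condition `n ≠ 0` ensures that there are two
different forms. -/
theorem exists_common_dual_of_det {n : ℕ} (hn : n ≠ 0)
    {d : Fin (n + 1) → Module.Dual ℚ V} (hd : LinearIndependent ℚ d)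
    (r : Fin (n + 1) → QuadraticForm ℚ V)
    (h : ∀ w : Fin n → V, (Matrix.of fun s => (Fin.snoc (fun j => d s (w j))
      (∑ j, r s (w j)) : Fin (n + 1) → ℚ)).det = 0) :
    ∃ κ : Module.Dual ℚ V, ∀ s u, r s u = 2 * d s u * κ u := by
  have h₂ : ∀ s t u, d t u * r s u = d s u * r t u := by
    intro s t u
    rcases eq_or_ne s t with rfl | hst
    · rfl
    obtain ⟨j₀, rfl⟩ := Fin.exists_succAbove_eq hst
    -- The columns `z j` with `j ≠ j₀` force a left null vector to be supported on `t` and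
    -- `t.succAbove j₀`.
    choose z hz using fun j : Fin n => exists_forall_dual_apply_eq hd
      (Pi.single (t.succAbove j) 1)
    have key : ∀ a : ℚ, a ≠ 0 → d t u * (a ^ 2 * r (t.succAbove j₀) u +
          ∑ j ∈ Finset.univ.erase j₀, r (t.succAbove j₀) (z j)) =
        d (t.succAbove j₀) u * (a ^ 2 * r t u + ∑ j ∈ Finset.univ.erase j₀, r t (z j)) := by
      intro a ha
      let w : Fin n → V := fun j => if j = j₀ then a • u else z j
      have hw0 : w j₀ = a • u := by simp [w]
      have hw1 : ∀ j, j ≠ j₀ → w j = z j := fun j hj => by simp [w, hj]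
      have hR : ∀ s, ∑ j, r s (w j) =
          a ^ 2 * r s u + ∑ j ∈ Finset.univ.erase j₀, r s (z j) := by
        intro s
        rw [← Finset.add_sum_erase _ _ (Finset.mem_univ j₀), hw0, QuadraticMap.map_smul, sq,
          smul_eq_mul]
        congr 1
        exact Finset.sum_congr rfl fun j hj => by rw [hw1 j (Finset.ne_of_mem_erase hj)]
      have hw := h w
      rw [← Matrix.exists_vecMul_eq_zero_iff] at hw
      obtain ⟨y, hy0, hy⟩ := hw
      have hy1 : ∀ j, j ≠ j₀ → y (t.succAbove j) = 0 := by
        intro j hj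
        have := congrFun hy j.castSucc
        simp only [Matrix.vecMul, dotProduct, Matrix.of_apply, Fin.snoc_castSucc, hw1 j hj, hz,
          Pi.single_apply, mul_ite, mul_one, mul_zero, Finset.sum_ite_eq', Finset.mem_univ,
          if_true, Pi.zero_apply] at this
        exact this
      have hsplit : ∀ f : Fin (n + 1) → ℚ, ∑ p, y p * f p =
          y t * f t + y (t.succAbove j₀) * f (t.succAbove j₀) := by
        intro f
        rw [Fin.sum_univ_succAbove _ t, Finset.sum_eq_single j₀]
        · intro j _ hj
          rw [hy1 j hj, zero_mul]
        · intro h; exact absurd (Finset.mem_univ _) h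
      have e1 := congrFun hy j₀.castSucc
      have e2 := congrFun hy (Fin.last n)
      simp only [Matrix.vecMul, dotProduct, Matrix.of_apply, Fin.snoc_castSucc, Fin.snoc_last,
        Pi.zero_apply, hw0, map_smul, smul_eq_mul, hR] at e1 e2
      rw [hsplit] at e1 e2
      have hyne : y t ≠ 0 ∨ y (t.succAbove j₀) ≠ 0 := by
        by_contra hcon
        push Not at hcon
        apply hy0
        ext p
        rcases Fin.eq_self_or_eq_succAbove t p with rfl | ⟨j, rfl⟩
        · exact hcon.1
        · by_cases hj : j = j₀
          · rw [hj]; exact hcon.2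
          · exact hy1 j hj
      have e1' : y t * d t u + y (t.succAbove j₀) * d (t.succAbove j₀) u = 0 := by
        have : a * (y t * d t u + y (t.succAbove j₀) * d (t.succAbove j₀) u) = 0 := by
          linear_combination e1
        exact (mul_eq_zero.1 this).resolve_left ha
      rcases hyne with hy | hy
      · apply mul_left_cancel₀ hy
        linear_combination (a ^ 2 * r (t.succAbove j₀) u +
          ∑ j ∈ Finset.univ.erase j₀, r (t.succAbove j₀) (z j)) * e1' -
          d (t.succAbove j₀) u * e2
      · apply mul_left_cancel₀ hy
        linear_combination d t u * e2 - (a ^ 2 * r t u +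
          ∑ j ∈ Finset.univ.erase j₀, r t (z j)) * e1'
    -- The difference of the two identities eliminates the terms that do not contain `a²`.
    have e1 := key 1 (by norm_num)
    have e2 := key 2 (by norm_num)
    linear_combination (e2 - e1) / 3
  refine exists_common_dual (fun s => hd.ne_zero s) r (fun s u hu => ?_) h₂
  obtain ⟨t, hst⟩ : ∃ t, t ≠ s := by
    have : Nontrivial (Fin (n + 1)) := Fin.nontrivial_iff_two_le.2 (by omega)
    exact exists_ne s
  obtain ⟨z, hz⟩ := exists_forall_dual_apply_eq hd (Pi.single t 1)
  -- If both forms vanish at `u`, move along a direction `z` on which `d t` is `1` and `d s` is `0`: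
  -- then `r s (u + a • z) = 0` for all `a ≠ 0`, and interpolation at `1`, `-1`, `2` reaches `a =
  -- 0`.
  by_cases ht : d t u = 0
  · have hline : ∀ a : ℚ, a ≠ 0 → r s u + a * QuadraticMap.polar (r s) u z + a ^ 2 * r s z = 0 := by
      intro a ha
      have := h₂ s t (u + a • z)
      rw [(d t).map_add, (d s).map_add, (d t).map_smul, (d s).map_smul, hz, hz, hu, ht,
        QuadraticMap.map_add (r s), QuadraticMap.map_smul, QuadraticMap.polar_smul_right] at this
      simp only [Pi.single_eq_same, Pi.single_eq_of_ne hst.symm, smul_eq_mul, mul_one, zero_add,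
        mul_zero, zero_mul] at this
      have h3 := (mul_eq_zero.1 this).resolve_left ha
      linear_combination h3
    linear_combination hline 1 (by norm_num) + (1 / 3) * hline (-1) (by norm_num) -
      (1 / 3) * hline 2 (by norm_num)
  · have := h₂ s t u
    rw [hu, zero_mul] at this
    exact (mul_eq_zero.1 this).resolve_left ht

end LinearForms

/-! ### Forms with integer coefficients and rigidity of the common factor -/

section Forms

variable {ι σ : Type} [Fintype ι] {A B : Type} [CommRing A] [CommRing B]

/-- The linear form with integer coefficients `g`. -/
def linForm (g : ι → ℤ) (u : ι → A) : A := ∑ i, (g i : A) * u i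

/-- The quadratic form `∑ gᵢ uᵢ² - (∑ gᵢ uᵢ)²`. -/
def quadForm (g : ι → ℤ) (u : ι → A) : A := ∑ i, (g i : A) * u i ^ 2 - linForm g u ^ 2

theorem map_linForm (φ : A →+* B) (g : ι → ℤ) (u : ι → A) :
    linForm g (fun i => φ (u i)) = φ (linForm g u) := by simp [linForm]

theorem map_quadForm (φ : A →+* B) (g : ι → ℤ) (u : ι → A) :
    quadForm g (fun i => φ (u i)) = φ (quadForm g u) := by
  simp [quadForm, map_linForm]

theorem linForm_sub (g h : ι → ℤ) (u : ι → A) :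
    linForm (g - h) u = linForm g u - linForm h u := by
  simp [linForm, sub_mul]

/-- `linForm g` as an element of the dual space. -/
def linDual (g : ι → ℤ) : Module.Dual ℚ (ι → ℚ) := ∑ i, (g i : ℚ) • LinearMap.proj i

theorem linDual_apply (g : ι → ℤ) (u : ι → ℚ) : linDual g u = linForm g u := by
  simp [linDual, linForm]

/-- `quadForm g` as a quadratic form. -/
def quadDual (g : ι → ℤ) : QuadraticForm ℚ (ι → ℚ) :=
  ∑ i, (g i : ℚ) • QuadraticMap.sq.comp (LinearMap.proj i) - QuadraticMap.sq.comp (linDual g)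

theorem quadDual_apply (g : ι → ℤ) (u : ι → ℚ) : quadDual g u = quadForm g u := by
  simp [quadDual, quadForm, linDual_apply, sq]

theorem dual_apply_eq_sum [DecidableEq ι] (κ : Module.Dual ℚ (ι → ℚ)) (u : ι → ℚ) :
    κ u = ∑ i, κ (Pi.single i 1) * u i := by
  rw [LinearMap.pi_apply_eq_sum_univ κ]
  refine Finset.sum_congr rfl fun i _ => ?_
  rw [smul_eq_mul, mul_comm]
  congr 2
  ext t
  simp [Pi.single_apply, eq_comm]

theorem linForm_single [DecidableEq ι] (g : ι → ℤ) (i : ι) (c : A) :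
    linForm g (Pi.single i c) = g i * c := by
  simp [linForm, Pi.single_apply]

theorem quadForm_single [DecidableEq ι] (g : ι → ℤ) (i : ι) :
    quadForm g (Pi.single i (1 : ℚ)) = g i - (g i : ℚ) ^ 2 := by
  simp [quadForm, linForm_single, Pi.single_apply]

theorem quadForm_single_add [DecidableEq ι] (g : ι → ℤ) {i j : ι} (hij : i ≠ j) :
    quadForm g (Pi.single i (1 : ℚ) + Pi.single j 1) = g i + g j - ((g i : ℚ) + g j) ^ 2 := by
  have h1 : linForm g (Pi.single i 1 + Pi.single j 1 : ι → ℚ) = (g i : ℚ) + g j := by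
    simp [linForm, Pi.single_apply, mul_add, Finset.sum_add_distrib]
  have h2 : ∀ l, (g l : ℚ) * ((Pi.single i (1 : ℚ) + Pi.single j 1 : ι → ℚ) l) ^ 2 =
      g l * (Pi.single i (1 : ℚ) : ι → ℚ) l + g l * (Pi.single j (1 : ℚ) : ι → ℚ) l := by
    intro l
    by_cases hi : l = i
    · subst hi; simp [hij]
    · by_cases hj : l = j
      · subst hj; simp [hij.symm]
      · simp [hi, hj]
  rw [quadForm, h1]
  simp only [h2, Finset.sum_add_distrib]
  simp [Pi.single_apply]

theorem eq_apply_of_single [DecidableEq ι] {κ : Module.Dual ℚ (ι → ℚ)} {x : ι}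
    (hx : κ (Pi.single x 1) = 1) (hl : ∀ l, l ≠ x → κ (Pi.single l 1) = 0) (u : ι → ℚ) :
    κ u = u x := by
  rw [dual_apply_eq_sum, Finset.sum_eq_single x]
  · rw [hx, one_mul]
  · intro l _ h
    rw [hl l h, zero_mul]
  · intro h; exact absurd (Finset.mem_univ _) h

/-- The identity says `κ² + (α - κ)² = ∑ aᵢ uᵢ²`, where `α` is the form with coefficients `a`.
Comparing coefficients gives `kᵢ² + (aᵢ - kᵢ)² = aᵢ`, so `aᵢ ∈ {0, 1, 2}`, and the vectors `(kᵢ, aᵢ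
- kᵢ)` are pairwise orthogonal. An entry with `kₓ = 1`, `aₓ ≠ 0` annihilates all other `kₗ`; without
one, `∑ aᵢ = 2` produces two equal vectors `(0, 1)`, which are not orthogonal. -/
theorem exists_eq_apply_of_red {a : ι → ℤ} (ha : ∑ i, a i = 2) {κ : Module.Dual ℚ (ι → ℚ)}
    (h : ∀ u, 2 * κ u * κ u - 2 * κ u * linDual a u - quadDual a u = 0) :
    ∃ x, ∀ u, κ u = u x := by
  classical
  set k : ι → ℚ := fun i => κ (Pi.single i 1) with hk
  have h1 : ∀ i, k i ^ 2 + (a i - k i) ^ 2 = a i := fun i => by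
    have := h (Pi.single i 1)
    rw [linDual_apply, quadDual_apply, linForm_single, quadForm_single] at this
    linear_combination this
  have h2 : ∀ i j, i ≠ j → k i * k j + (a i - k i) * (a j - k j) = 0 := fun i j hij => by
    have := h (Pi.single i 1 + Pi.single j 1)
    rw [linDual_apply, quadDual_apply, quadForm_single_add a hij, map_add] at this
    have h3 : linForm a (Pi.single i 1 + Pi.single j 1 : ι → ℚ) = (a i : ℚ) + a j := by
      simp [linForm, Pi.single_apply, mul_add, Finset.sum_add_distrib]
    rw [h3] at this
    linear_combination this / 2 - h1 i / 2 - h1 j / 2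
  have h3 : ∀ i, a i = 0 ∨ a i = 1 ∨ a i = 2 := fun i => by
    have e1 : (0 : ℚ) ≤ a i := by rw [← h1 i]; positivity
    have e2 : (a i : ℚ) ≤ 2 := by nlinarith [h1 i, sq_nonneg (2 * k i - a i)]
    have e3 : 0 ≤ a i := by exact_mod_cast e1
    have e4 : a i ≤ 2 := by exact_mod_cast e2
    omega
  by_cases hx : ∃ x, k x = 1 ∧ a x ≠ 0
  · obtain ⟨x, hx, hax⟩ := hx
    refine ⟨x, eq_apply_of_single hx fun l hl => ?_⟩
    have e := h2 x l hl.symm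
    rw [hx] at e
    have e1 := h1 l
    change k l = 0
    rcases h3 x with h | h | h
    · exact absurd h hax
    · rw [h] at e; push_cast at e; linear_combination e
    · rw [h] at e
      push_cast at e
      have : (a l : ℚ) = 0 := by linear_combination e
      rw [this] at e1
      nlinarith
  · push Not at hx
    exfalso
    have h4 : ∀ i, a i = 0 ∨ (a i = 1 ∧ k i = 0) := fun i => by
      rcases h3 i with h | h | h
      · exact Or.inl h
      · right
        have e := h1 i
        rw [h] at e
        push_cast at e
        have : k i * (k i - 1) = 0 := by linear_combination e / 2
        rcases mul_eq_zero.1 this with h0 | h0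
        · exact ⟨h, h0⟩
        · have := hx i (by linarith)
          omega
      · have e := h1 i
        rw [h] at e
        push_cast at e
        have : (k i - 1) ^ 2 = 0 := by linear_combination e / 2
        have := hx i (by have := pow_eq_zero_iff (two_ne_zero) |>.1 this; linarith)
        omega
    obtain ⟨i, hi⟩ : ∃ i, a i ≠ 0 := by
      by_contra hcon
      push Not at hcon
      simp [hcon] at ha
    have hi1 : a i = 1 := ((h4 i).resolve_left hi).1
    obtain ⟨j, hji, hj⟩ : ∃ j, j ≠ i ∧ a j ≠ 0 := by
      by_contra hcon
      push Not at hcon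
      rw [Finset.sum_eq_single i (fun j _ hj => hcon j hj) (by simp)] at ha
      omega
    have e := h2 i j hji.symm
    rw [((h4 i).resolve_left hi).2, ((h4 j).resolve_left hj).2, hi1,
      ((h4 j).resolve_left hj).1] at e
    norm_num at e

/-- Comparing coefficients gives `2kᵢ = 1 - bᵢ` on the support of `b` and `bᵢ + bⱼ = 0` for two
indices in it, so `b = c(e_x - e_y)`, `k` vanishes off `{x, y}`, and `k_x + k_y = 1`. One such `b`
does not determine `κ`; the second independent vector is needed to exclude that `k_x` and `k_y` are
both nonzero. -/
theorem exists_eq_apply_of_black {b b' : ι → ℤ} (hb : ∑ i, b i = 0) (hb' : ∑ i, b' i = 0)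
    (hind : ∀ c c' : ℚ, (∀ i, c * b i + c' * b' i = 0) → c = 0)
    (hind' : ∀ c c' : ℚ, (∀ i, c * b i + c' * b' i = 0) → c' = 0)
    {κ : Module.Dual ℚ (ι → ℚ)} (h : ∀ u, quadDual b u = 2 * linDual b u * κ u)
    (h' : ∀ u, quadDual b' u = 2 * linDual b' u * κ u) :
    ∃ x, ∀ u, κ u = u x := by
  classical
  set k : ι → ℚ := fun i => κ (Pi.single i 1) with hk
  have aux : ∀ b : ι → ℤ, (∀ u, quadDual b u = 2 * linDual b u * κ u) →
      (∀ i, b i ≠ 0 → 2 * k i = 1 - b i) ∧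
      ∀ i j, i ≠ j → (b i : ℚ) * b j + b i * k j + b j * k i = 0 := by
    intro b h
    have e1 : ∀ i, (b i : ℚ) - b i ^ 2 = 2 * b i * k i := fun i => by
      have := h (Pi.single i 1)
      rw [linDual_apply, quadDual_apply, linForm_single, quadForm_single] at this
      linear_combination this
    refine ⟨fun i hi => ?_, fun i j hij => ?_⟩
    · apply mul_left_cancel₀ (Int.cast_ne_zero.2 hi : (b i : ℚ) ≠ 0)
      linear_combination -e1 i
    · have := h (Pi.single i 1 + Pi.single j 1)
      rw [linDual_apply, quadDual_apply, quadForm_single_add b hij, map_add] at this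
      have h3 : linForm b (Pi.single i 1 + Pi.single j 1 : ι → ℚ) = (b i : ℚ) + b j := by
        simp [linForm, Pi.single_apply, mul_add, Finset.sum_add_distrib]
      rw [h3] at this
      linear_combination -this / 2 + e1 i / 2 + e1 j / 2
  -- the shape of a single vector
  have shape : ∀ b : ι → ℤ, ∑ i, b i = 0 → (∃ i, b i ≠ 0) →
      (∀ u, quadDual b u = 2 * linDual b u * κ u) →
      ∃ x y, x ≠ y ∧ b x ≠ 0 ∧ b y = -b x ∧ (∀ l, l ≠ x → l ≠ y → b l = 0 ∧ k l = 0) ∧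
        2 * k x = 1 - b x ∧ 2 * k y = 1 + b x := by
    intro b hb ⟨x, hx⟩ h
    obtain ⟨e1, e2⟩ := aux b h
    obtain ⟨y, hyx, hy⟩ : ∃ j, j ≠ x ∧ b j ≠ 0 := by
      by_contra hcon
      push Not at hcon
      rw [Finset.sum_eq_single x (fun j _ hj => hcon j hj) (by simp)] at hb
      exact hx hb
    have opp : ∀ i j, i ≠ j → b i ≠ 0 → b j ≠ 0 → b j = -b i := fun i j hij hi hj => by
      have h1 := e1 i hi
      have h2 := e1 j hj
      have h3 := e2 i j hij
      have : (b j : ℚ) = -b i := by linear_combination 2 * h3 - b i * h2 - b j * h1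
      exact_mod_cast this
    have hyb := opp x y hyx.symm hx hy
    refine ⟨x, y, hyx.symm, hx, hyb, fun l hlx hly => ?_, e1 x hx, ?_⟩
    · have hl : b l = 0 := by
        by_contra hl
        have h1 := opp x l hlx.symm hx hl
        have h2 := opp y l hly.symm hy hl
        omega
      refine ⟨hl, ?_⟩
      have := e2 x l hlx.symm
      rw [hl] at this
      simpa [hx] using this
    · rw [e1 y hy, hyb]; push_cast; ring
  have hne : ∃ i, b i ≠ 0 := by
    by_contra hcon
    push Not at hcon
    exact one_ne_zero (hind 1 0 fun i => by simp [hcon])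
  have hne' : ∃ i, b' i ≠ 0 := by
    by_contra hcon
    push Not at hcon
    exact one_ne_zero (hind' 0 1 fun i => by simp [hcon])
  obtain ⟨x, y, hxy, hbx, hby, hl, hkx, hky⟩ := shape b hb hne h
  obtain ⟨x', y', hxy', hbx', hby', hl', hkx', hky'⟩ := shape b' hb' hne' h'
  by_cases c1 : k x = 0
  · refine ⟨y, eq_apply_of_single (x := y) (show k y = 1 by linarith) fun l hly => ?_⟩
    by_cases hlx : l = x
    · rw [hlx]; exact c1
    · exact (hl l hlx hly).2
  by_cases c2 : k y = 0
  · refine ⟨x, eq_apply_of_single (x := x) (show k x = 1 by linarith) fun l hlx => ?_⟩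
    by_cases hly : l = y
    · rw [hly]; exact c2
    · exact (hl l hlx hly).2
  -- Since `k` vanishes off the support `{x', y'}` of `b'`, both `x` and `y` belong to it, so `b'`
  -- is a multiple of `b`.
  exfalso
  have hx : x = x' ∨ x = y' := by
    by_contra hcon
    push Not at hcon
    exact c1 (hl' x hcon.1 hcon.2).2
  have hy : y = x' ∨ y = y' := by
    by_contra hcon
    push Not at hcon
    exact c2 (hl' y hcon.1 hcon.2).2
  have hs : ∀ l, l ≠ x → l ≠ y → b' l = 0 := fun l h1 h2 => by
    apply (hl' l _ _).1
    · rcases hx with rfl | rfl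
      · exact h1
      · rcases hy with rfl | rfl
        · exact h2
        · exact absurd rfl hxy
    · rcases hx with rfl | rfl
      · rcases hy with rfl | rfl
        · exact absurd rfl hxy
        · exact h2
      · exact h1
  have hyx' : b' y = -b' x := by
    rcases hx with rfl | rfl <;> rcases hy with rfl | rfl
    · exact absurd rfl hxy
    · exact hby'
    · omega
    · exact absurd rfl hxy
  have := hind (b' x) (-b x) fun i => by
    by_cases hix : i = x
    · subst hix; ring
    · by_cases hiy : i = y
      · subst hiy; rw [hby, hyx']; push_cast; ring
      · rw [(hl i hix hiy).1, hs i hix hiy]; simp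
  have hbx0 : b' x = 0 := by exact_mod_cast this
  obtain ⟨i, hi⟩ := hne'
  apply hi
  by_cases hix : i = x
  · rw [hix, hbx0]
  · by_cases hiy : i = y
    · rw [hiy, hyx', hbx0, neg_zero]
    · exact hs i hix hiy

end Forms

/-! ### Polynomial functions of lists of vectors, and the resonances -/

section Resonances

/-- A function of lists of vectors over a ring, defined for all commutative rings. -/
abbrev RingFun (n : ℕ) (ι : Type) : Type 1 :=
  ∀ (A : Type) [CommRing A], (Fin n → ι → A) → A

/-- Compatibility with ring homomorphisms. -/
def RingFun.IsNatural {n : ℕ} {ι : Type} (F : RingFun n ι) : Prop :=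
  ∀ (A B : Type) [CommRing A] [CommRing B] (φ : A →+* B) (w : Fin n → ι → A),
    F B (fun j i => φ (w j i)) = φ (F A w)

/-- The value at the generic list of vectors. -/
noncomputable def RingFun.toPoly {n k : ℕ} (F : RingFun n (Fin k)) :
    MvPolynomial (Fin k × Fin n) ℤ :=
  F _ fun j i => MvPolynomial.X (i, j)

theorem RingFun.IsNatural.eval_toPoly {n k : ℕ} {F : RingFun n (Fin k)} (hF : F.IsNatural)
    (x : Fin k × Fin n → ℤ) : MvPolynomial.eval x F.toPoly = F ℤ fun j i => x (i, j) := by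
  rw [RingFun.toPoly, ← hF]
  simp

/-- The generic list specialises to every list over every commutative ring, so an integer polynomial
identity may be tested on convenient rational vectors. -/
theorem RingFun.IsNatural.eq_zero_of_toPoly {n k : ℕ} {F : RingFun n (Fin k)}
    (hF : F.IsNatural) (h : F.toPoly = 0) {A : Type} [CommRing A] (w : Fin n → Fin k → A) :
    F A w = 0 := by
  have := hF _ A (MvPolynomial.eval₂Hom (Int.castRingHom A) fun a : Fin k × Fin n => w a.2 a.1)
    (fun j i => MvPolynomial.X (i, j))
  rw [RingFun.toPoly] at h
  rw [h, map_zero] at this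
  simpa using this

variable {n : ℕ} {ι : Type} [Fintype ι]

/-- The squared length of `∑ gᵢ vᵢ`. -/
def normFun (g : ι → ℤ) : RingFun n ι := fun _ _ w => ∑ j, linForm g (w j) ^ 2

/-- The function `|∑ gᵢvᵢ|² - 2 ∑ gᵢ|vᵢ|²`, which vanishes when vertices of opposite signs lie over
the same site. -/
def doubleFun (g : ι → ℤ) : RingFun n ι := fun A _ w =>
  ∑ j, (linForm g (w j) ^ 2 - 2 * ∑ i, (g i : A) * w j i ^ 2)

/-- Vanishes when a linear relation between displacements extends to the squared lengths of their
momenta. -/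
def relFun {r : ℕ} (c : Fin (r + 1) → ℤ) (g : Fin (r + 1) → ι → ℤ) : RingFun n ι :=
  fun A _ w => ∑ s, (c s : A) * ∑ j, linForm (g s) (w j) ^ 2

/-- The scalar product of `v_y - v_x` and `v_z - v_x`. -/
def angleFun {τ : Type} (x y z : τ) : RingFun n τ := fun _ _ w =>
  ∑ j, (w j y - w j x) * (w j z - w j x)

/-- The matrix of the values of linear forms. -/
def formMatrix {A σ : Type} [CommRing A] (d : σ → ι → ℤ) (w : Fin n → ι → A) :
    Matrix σ (Fin n) A :=
  Matrix.of fun s j => linForm (d s) (w j)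

/-- The vectors `g_s`, reduced by `a` at the places marked by `red`. -/
def reduced {σ τ : Type} (a : τ → ℤ) (g : σ → τ → ℤ) (red : σ → Bool) (s : σ) : τ → ℤ :=
  if red s then g s - a else g s

/-- The right-hand sides of the linear equations attached to the vectors `reduced a g red s`. -/
def reducedRhs {A σ : Type} [CommRing A] (a : ι → ℤ) (g : σ → ι → ℤ) (red : σ → Bool)
    (w : Fin n → ι → A) (s : σ) : A :=
  ∑ j, if red s then quadForm a (w j) - quadForm (g s) (w j) else quadForm (g s) (w j)

/-- Nonvanishing makes the linear equations for the site uniquely solvable. -/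
def detFun (a : ι → ℤ) (g : Fin n → ι → ℤ) (red : Fin n → Bool) : RingFun n ι :=
  fun _ _ w => (formMatrix (reduced a g red) w).det

/-- The compatibility of `n` linear equations with the sphere equation of `a`: the solution is `K /
(2 det M)`, and denominators are cleared by `2 (det M)²`. -/
def sphereFun (a : ι → ℤ) (g : Fin n → ι → ℤ) (red : Fin n → Bool) : RingFun n ι :=
  fun _ _ w =>
    let M := formMatrix (reduced a g red) w
    let K := M.adjugate *ᵥ reducedRhs a g red w
    K ⬝ᵥ K - 2 * M.det * (K ⬝ᵥ fun j => linForm a (w j)) - 2 * M.det ^ 2 * ∑ j, quadForm a (w j)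

/-- The compatibility of `n + 1` linear equations for a point of `n`-space. -/
def extendedFun (g : Fin (n + 1) → ι → ℤ) : RingFun n ι := fun A _ w =>
  (Matrix.of fun s => (Fin.snoc (fun j => linForm (g s) (w j)) (∑ j, quadForm (g s) (w j)) :
    Fin (n + 1) → A)).det

theorem normFun_natural (g : ι → ℤ) : (normFun g : RingFun n ι).IsNatural := by
  intro A B _ _ φ w
  simp [normFun, map_linForm]

theorem doubleFun_natural (g : ι → ℤ) : (doubleFun g : RingFun n ι).IsNatural := by
  intro A B _ _ φ w
  simp [doubleFun, map_linForm, map_ofNat φ 2]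

theorem relFun_natural {r : ℕ} (c : Fin (r + 1) → ℤ) (g : Fin (r + 1) → ι → ℤ) :
    (relFun c g : RingFun n ι).IsNatural := by
  intro A B _ _ φ w
  simp [relFun, map_linForm]

theorem angleFun_natural {τ : Type} (x y z : τ) : (angleFun x y z : RingFun n τ).IsNatural := by
  intro A B _ _ φ w
  simp [angleFun]

theorem map_formMatrix {A B σ : Type} [CommRing A] [CommRing B] (φ : A →+* B) (d : σ → ι → ℤ)
    (w : Fin n → ι → A) :
    formMatrix d (fun j i => φ (w j i)) = (formMatrix d w).map φ := by
  ext s j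
  simp [formMatrix, map_linForm]

theorem map_reducedRhs {A B σ : Type} [CommRing A] [CommRing B] (φ : A →+* B) (a : ι → ℤ)
    (g : σ → ι → ℤ) (red : σ → Bool) (w : Fin n → ι → A) :
    reducedRhs a g red (fun j i => φ (w j i)) = φ ∘ reducedRhs a g red w := by
  ext s
  simp only [reducedRhs, map_quadForm, Function.comp_apply, map_sum]
  refine Finset.sum_congr rfl fun j _ => ?_
  split_ifs <;> simp

theorem detFun_natural (a : ι → ℤ) (g : Fin n → ι → ℤ) (red : Fin n → Bool) :
    (detFun a g red).IsNatural := by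
  intro A B _ _ φ w
  rw [detFun, map_formMatrix, detFun, RingHom.map_det]
  rfl

theorem sphereFun_natural (a : ι → ℤ) (g : Fin n → ι → ℤ) (red : Fin n → Bool) :
    (sphereFun a g red).IsNatural := by
  intro A B _ _ φ w
  have h1 : ((formMatrix (reduced a g red) w).map φ).det =
      φ (formMatrix (reduced a g red) w).det := (RingHom.map_det _ _).symm
  have h2 : ((formMatrix (reduced a g red) w).map φ).adjugate =
      (formMatrix (reduced a g red) w).adjugate.map φ := (RingHom.map_adjugate _ _).symm
  have h3 : ((formMatrix (reduced a g red) w).adjugate.map φ *ᵥ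
      (φ ∘ reducedRhs a g red w)) =
      φ ∘ ((formMatrix (reduced a g red) w).adjugate *ᵥ reducedRhs a g red w) :=
    funext fun i => (RingHom.map_mulVec φ _ _ i).symm
  simp only [sphereFun, map_formMatrix, map_reducedRhs, h1, h2, h3, map_linForm, map_quadForm]
  simp only [dotProduct, Function.comp_apply, map_sub, map_mul, map_pow, map_sum, map_ofNat φ 2]

theorem extendedFun_natural (g : Fin (n + 1) → ι → ℤ) : (extendedFun g).IsNatural := by
  intro A B _ _ φ w
  rw [extendedFun, extendedFun, RingHom.map_det]
  congr 1
  ext s j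
  refine Fin.lastCases ?_ (fun j => ?_) j
  · simp [map_quadForm]
  · simp [map_linForm]

/-- Indices outside the support are discarded here, so that a resonance involves few vector
variables whatever the length `m` of the list. -/
theorem linForm_comp {κ A : Type} [Fintype κ] [CommRing A] (f : κ ↪ ι) (g : ι → ℤ)
    (hg : ∀ i, g i ≠ 0 → i ∈ Set.range f) (u : ι → A) :
    linForm (fun i => g (f i)) (fun i => u (f i)) = linForm g u := by
  classical
  rw [linForm, linForm, ← Finset.sum_map Finset.univ f (fun i => (g i : A) * u i)]
  refine Finset.sum_subset (Finset.subset_univ _) fun i _ hi => ?_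
  have : g i = 0 := by
    by_contra h
    obtain ⟨l, hl⟩ := hg i h
    exact hi (Finset.mem_map.2 ⟨l, Finset.mem_univ _, hl⟩)
  simp [this]

theorem sum_sq_comp {κ A : Type} [Fintype κ] [CommRing A] (f : κ ↪ ι) (g : ι → ℤ)
    (hg : ∀ i, g i ≠ 0 → i ∈ Set.range f) (u : ι → A) :
    ∑ i, (g (f i) : A) * u (f i) ^ 2 = ∑ i, (g i : A) * u i ^ 2 :=
  linForm_comp f g hg fun i => u i ^ 2

theorem quadForm_comp {κ A : Type} [Fintype κ] [CommRing A] (f : κ ↪ ι) (g : ι → ℤ)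
    (hg : ∀ i, g i ≠ 0 → i ∈ Set.range f) (u : ι → A) :
    quadForm (fun i => g (f i)) (fun i => u (f i)) = quadForm g u := by
  rw [quadForm, quadForm, linForm_comp f g hg, sum_sq_comp f g hg]

theorem linearIndependent_linDual_comp {κ σ τ : Type} [Fintype κ] [Fintype σ] (f : κ ↪ τ)
    (g : σ → τ → ℤ) (hg : ∀ s i, g s i ≠ 0 → i ∈ Set.range f)
    (h : LinearIndependent ℚ fun s i => (g s i : ℚ)) :
    LinearIndependent ℚ fun s => linDual fun i => g s (f i) := by
  classical
  rw [Fintype.linearIndependent_iff] at h ⊢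
  intro c hc
  apply h c
  ext i
  simp only [Finset.sum_apply, Pi.smul_apply, smul_eq_mul, Pi.zero_apply]
  by_cases hi : i ∈ Set.range f
  · obtain ⟨l, rfl⟩ := hi
    have := LinearMap.congr_fun hc (Pi.single l 1)
    simpa [LinearMap.sum_apply, linDual_apply, linForm_single] using this
  · refine Finset.sum_eq_zero fun s _ => ?_
    have : g s i = 0 := by
      by_contra h0
      exact hi (hg s i h0)
    simp [this]

/-- Subtracting multiples of the first vector of an independent family from the others keeps those
others independent. -/
theorem linearIndependent_reduced {τ : Type} {a : τ → ℤ} {g : Fin n → τ → ℤ} (red : Fin n → Bool)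
    (h : LinearIndependent ℚ fun s i => ((Fin.cons a g : Fin (n + 1) → τ → ℤ) s i : ℚ)) :
    LinearIndependent ℚ fun s i => (reduced a g red s i : ℚ) := by
  rw [Fintype.linearIndependent_iff] at h ⊢
  intro c hc s
  have := h (Fin.cons (-∑ s, if red s then c s else 0) c) (by
    rw [Fin.sum_univ_succ]
    simp only [Fin.cons_zero, Fin.cons_succ]
    rw [← hc]
    ext i
    simp only [Pi.add_apply, Pi.smul_apply, smul_eq_mul, Finset.sum_apply, neg_mul,
      Finset.sum_mul]
    rw [← Finset.sum_neg_distrib, ← Finset.sum_add_distrib]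
    refine Finset.sum_congr rfl fun s _ => ?_
    unfold reduced
    split_ifs
    · simp; ring
    · simp) s.succ
  simpa using this

end Resonances

/-! ### The finite list of resonances and the first consequences of genericity -/

section Generic

/-- Families of integer vectors with coefficients of size at most `2n + 2`. -/
def bounded (n : ℕ) (σ ι : Type) : Set (σ → ι → ℤ) :=
  Set.Icc (fun _ _ => -(2 * n + 2 : ℤ)) fun _ _ => (2 * n + 2 : ℤ)

open Classical in
/-- A linear relation between the vectors `g_s` in which `g_0` occurs, if there is one. -/
noncomputable def relCoeff {r : ℕ} {ι : Type} (g : Fin (r + 1) → ι → ℤ) : Fin (r + 1) → ℤ :=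
  if h : ∃ c : Fin (r + 1) → ℤ, c 0 ≠ 0 ∧ ∑ s, c s • g s = 0 then h.choose else 0

/-- The polynomials, possibly zero, from which the resonances are taken. -/
def candidates (n k : ℕ) : Set (MvPolynomial (Fin k × Fin n) ℤ) :=
  ((fun g => (normFun (g ()) : RingFun n (Fin k)).toPoly) '' bounded n Unit (Fin k)) ∪
  ((fun g => (doubleFun (g ()) : RingFun n (Fin k)).toPoly) '' bounded n Unit (Fin k)) ∪
  (⋃ r : Fin (n + 1), (fun g => (relFun (relCoeff g) g : RingFun n (Fin k)).toPoly) ''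
    bounded n (Fin (r + 1)) (Fin k)) ∪
  (Set.range fun t : Fin k × Fin k × Fin k =>
    (angleFun t.1 t.2.1 t.2.2 : RingFun n (Fin k)).toPoly) ∪
  ((fun t : ((Fin (n + 1) → Fin k → ℤ) × (Fin n → Bool)) =>
    (detFun (t.1 0) (fun s => t.1 s.succ) t.2).toPoly) ''
      (bounded n (Fin (n + 1)) (Fin k) ×ˢ Set.univ)) ∪
  ((fun t : ((Fin (n + 1) → Fin k → ℤ) × (Fin n → Bool)) =>
    (sphereFun (t.1 0) (fun s => t.1 s.succ) t.2).toPoly) ''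
      (bounded n (Fin (n + 1)) (Fin k) ×ˢ Set.univ)) ∪
  ((fun g => (extendedFun g).toPoly) '' bounded n (Fin (n + 1)) (Fin k))

theorem candidates_finite (n k : ℕ) : (candidates n k).Finite := by
  have hb : ∀ r : ℕ, (bounded n (Fin r) (Fin k)).Finite := fun r => Set.finite_Icc _ _
  have hu : (bounded n Unit (Fin k)).Finite := Set.finite_Icc _ _
  refine Set.Finite.union (Set.Finite.union (Set.Finite.union (Set.Finite.union (Set.Finite.union
    (Set.Finite.union (hu.image _) (hu.image _)) ?_) (Set.finite_range _))
    (((hb _).prod Set.finite_univ).image _)) (((hb _).prod Set.finite_univ).image _))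
    ((hb _).image _)
  exact Set.finite_iUnion fun r => (hb _).image _

/-- The list `v` avoids all the resonances. -/
def AvoidsResonances {n m : ℕ} (v : Fin m → Fin n → ℤ) : Prop :=
  ∀ k ≤ 2 * n + 2, ∀ P ∈ candidates n k, P ≠ 0 → ∀ f : Fin k ↪ Fin m,
    MvPolynomial.eval (fun a : Fin k × Fin n => v (f a.1) a.2) P ≠ 0

theorem exists_resonances (n : ℕ) : ∃ R : Finset (Σ k : ℕ, MvPolynomial (Fin k × Fin n) ℤ),
    (∀ r ∈ R, r.1 ≤ 2 * n + 2 ∧ r.2 ≠ 0) ∧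
    ∀ (m : ℕ) (v : Fin m → Fin n → ℤ), IsGeneric R v → AvoidsResonances v := by
  have hfin : {r : Σ k : ℕ, MvPolynomial (Fin k × Fin n) ℤ |
      r.1 ≤ 2 * n + 2 ∧ r.2 ≠ 0 ∧ r.2 ∈ candidates n r.1}.Finite := by
    refine Set.Finite.subset ((Set.finite_Iic (2 * n + 2)).biUnion fun k _ =>
      (candidates_finite n k).image (Sigma.mk k)) ?_
    rintro ⟨k, P⟩ ⟨hk, -, hP⟩
    exact Set.mem_biUnion hk ⟨P, hP, rfl⟩
  refine ⟨hfin.toFinset, fun r hr => ?_, fun m v hv k hk P hP h0 f => ?_⟩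
  · have := hfin.mem_toFinset.1 hr
    exact ⟨this.1, this.2.1⟩
  · exact hv ⟨k, P⟩ (hfin.mem_toFinset.2 ⟨hk, h0, hP⟩) f

variable {n m : ℕ} {v : Fin m → Fin n → ℤ}

/-- The transfer principle: a candidate that vanishes at the actual sites cannot be a nonzero
polynomial, so it vanishes identically. -/
theorem AvoidsResonances.eq_zero (hv : AvoidsResonances v) {k : ℕ} (hk : k ≤ 2 * n + 2)
    {F : RingFun n (Fin k)} (hF : F.IsNatural) (hc : F.toPoly ∈ candidates n k)
    (f : Fin k ↪ Fin m) (h : F ℤ (fun j i => v (f i) j) = 0) {A : Type} [CommRing A]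
    (w : Fin n → Fin k → A) : F A w = 0 := by
  refine hF.eq_zero_of_toPoly ?_ w
  by_contra hne
  refine hv k hk _ hc hne f ?_
  rw [hF.eval_toPoly]
  exact h

theorem exists_embedding (I : Finset (Fin m)) :
    ∃ f : Fin I.card ↪ Fin m, ∀ i, i ∈ I ↔ i ∈ Set.range f :=
  ⟨(I.orderEmbOfFin rfl).toEmbedding, fun i =>
    (Set.ext_iff.1 (I.range_orderEmbOfFin rfl) i).symm⟩

/-- The `j`-th coordinates of the sites. -/
def coords (v : Fin m → Fin n → ℤ) (j : Fin n) : Fin m → ℤ := fun i => v i j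

/-- Coefficients bounded by `2n + 2` and support in `I`. -/
def Small (n : ℕ) (I : Finset (Fin m)) (g : Fin m → ℤ) : Prop :=
  ∀ i, |g i| ≤ 2 * n + 2 ∧ (g i ≠ 0 → i ∈ I)

theorem Small.mem_bounded {I : Finset (Fin m)} {σ κ : Type} {g : σ → Fin m → ℤ}
    (h : ∀ s, Small n I (g s)) (f : κ → Fin m) : (fun s i => g s (f i)) ∈ bounded n σ κ :=
  ⟨fun s i => (abs_le.1 (h s (f i)).1).1, fun s i => (abs_le.1 (h s (f i)).1).2⟩

/-- Identical vanishing would give `n * g_l² = 0` when all the coordinate columns equal a unit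
vector; this is where `n ≠ 0` matters. -/
theorem AvoidsResonances.norm_ne_zero (hn : n ≠ 0) (hv : AvoidsResonances v)
    {I : Finset (Fin m)} (hI : I.card ≤ 2 * n + 2) {g : Fin m → ℤ} (hg : Small n I g)
    (h0 : g ≠ 0) : ∑ j, linForm g (coords v j) ^ 2 ≠ 0 := by
  intro h
  obtain ⟨f, hf⟩ := exists_embedding I
  have hr : ∀ i, g i ≠ 0 → i ∈ Set.range f := fun i hi => (hf i).1 ((hg i).2 hi)
  have key := hv.eq_zero hI (F := normFun fun i => g (f i)) (normFun_natural _)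
    (by
      refine Or.inl (Or.inl (Or.inl (Or.inl (Or.inl (Or.inl ⟨fun _ i => g (f i), ?_, rfl⟩)))))
      exact Small.mem_bounded (fun _ => hg) f) f
    (by
      rw [normFun, ← h]
      exact Finset.sum_congr rfl fun j _ => by
        rw [← linForm_comp f g hr (coords v j)]; rfl) (A := ℚ)
  obtain ⟨i, hi⟩ : ∃ i, g i ≠ 0 := by
    by_contra hcon
    push Not at hcon
    exact h0 (funext hcon)
  obtain ⟨l, rfl⟩ := hr i hi
  have := key fun _ => Pi.single l 1
  simp [normFun, linForm_single, hn, hi] at this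

theorem AvoidsResonances.angle_ne_zero (hn : n ≠ 0) (hv : AvoidsResonances v) {x y z : Fin m}
    (hxy : x ≠ y) (hxz : x ≠ z) : (v y - v x) ⬝ᵥ (v z - v x) ≠ 0 := by
  intro h
  obtain ⟨f, hf⟩ := exists_embedding {x, y, z}
  obtain ⟨x', hx'⟩ := (hf x).1 (by simp)
  obtain ⟨y', hy'⟩ := (hf y).1 (by simp)
  obtain ⟨z', hz'⟩ := (hf z).1 (by simp)
  have hcard : ({x, y, z} : Finset (Fin m)).card ≤ 2 * n + 2 :=
    Finset.card_le_three.trans (by omega)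
  have key := hv.eq_zero hcard (F := angleFun x' y' z') (angleFun_natural _ _ _)
    (by
      refine Or.inl (Or.inl (Or.inl (Or.inr ⟨(x', y', z'), rfl⟩)))) f
    (by
      rw [angleFun, ← h, hx', hy', hz']
      rfl) (A := ℚ) fun _ => Pi.single x' 1
  have h1 : x' ≠ y' := by rintro rfl; exact hxy (hx'.symm.trans hy')
  have h2 : x' ≠ z' := by rintro rfl; exact hxz (hx'.symm.trans hz')
  simp [angleFun, h1.symm, h2.symm, hn] at key

/-- As an identity, tested on unit vectors, the equation reads `aᵢ² = 2aᵢ`. All entries are then `0`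
or `2`, and their sum leaves room for a single `2`. -/
theorem AvoidsResonances.exists_double (hn : n ≠ 0) (hv : AvoidsResonances v)
    {I : Finset (Fin m)} (hI : I.card ≤ 2 * n + 2) {a : Fin m → ℤ} (ha : Small n I a)
    (hsum : ∑ i, a i = 2)
    (h : ∑ j, (linForm a (coords v j) ^ 2 - 2 * ∑ i, a i * v i j ^ 2) = 0) :
    ∃ x, a = Pi.single x 2 := by
  classical
  obtain ⟨f, hf⟩ := exists_embedding I
  have hr : ∀ i, a i ≠ 0 → i ∈ Set.range f := fun i hi => (hf i).1 ((ha i).2 hi)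
  have key := hv.eq_zero hI (F := doubleFun fun i => a (f i)) (doubleFun_natural _)
    (by
      refine Or.inl (Or.inl (Or.inl (Or.inl (Or.inl (Or.inr ⟨fun _ i => a (f i), ?_, rfl⟩)))))
      exact Small.mem_bounded (fun _ => ha) f) f
    (by
      rw [doubleFun, ← h]
      exact Finset.sum_congr rfl fun j _ => by
        rw [← linForm_comp f a hr (coords v j)]
        have := sum_sq_comp f a hr (coords v j)
        simp only [Int.cast_id, coords] at this ⊢
        rw [this]) (A := ℚ)
  have h1 : ∀ l, a (f l) = 0 ∨ a (f l) = 2 := fun l => by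
    have := key fun _ => Pi.single l 1
    simp only [doubleFun, linForm_single, Finset.sum_const, Finset.card_univ, Fintype.card_fin,
      nsmul_eq_mul, mul_one, Pi.single_apply, ite_pow, one_pow, ne_eq, OfNat.ofNat_ne_zero,
      not_false_eq_true, zero_pow, mul_ite, mul_zero, Finset.sum_ite_eq', Finset.mem_univ,
      if_true] at this
    have h2 := (mul_eq_zero.1 this).resolve_left (Nat.cast_ne_zero.2 hn)
    have h3 : (a (f l) : ℚ) * (a (f l) - 2) = 0 := by linear_combination h2
    rcases mul_eq_zero.1 h3 with h | h
    · left; exact_mod_cast h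
    · right; exact_mod_cast sub_eq_zero.1 h
  have h2 : ∀ i, a i = 0 ∨ a i = 2 := fun i => by
    by_cases hi : a i = 0
    · exact Or.inl hi
    · obtain ⟨l, rfl⟩ := hr i hi
      exact h1 l
  obtain ⟨x, hx⟩ : ∃ i, a i ≠ 0 := by
    by_contra hcon
    push Not at hcon
    simp [hcon] at hsum
  have hx2 := (h2 x).resolve_left hx
  refine ⟨x, funext fun i => ?_⟩
  by_cases hix : i = x
  · rw [hix, hx2, Pi.single_eq_same]
  rw [Pi.single_eq_of_ne hix]
  rw [← Finset.add_sum_erase _ _ (Finset.mem_univ x), hx2] at hsum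
  have hnn : ∀ j ∈ Finset.univ.erase x, 0 ≤ a j := fun j _ => by
    rcases h2 j with h | h <;> omega
  exact (Finset.sum_eq_zero_iff_of_nonneg hnn).1 (by omega) i
    (Finset.mem_erase.2 ⟨hix, Finset.mem_univ _⟩)

/-- As an identity, the quadratic relation says that `c₀ z² + ∑ c_s y_s² = 0` whenever `c₀ z + ∑ c_s
y_s = 0`, with `y` arbitrary by independence. Testing on `e_s` and `e_s + e_t` gives `c_s (c_s + c₀)
= 0` and `c_s c_t = 0`: at most one `c_s` is nonzero, and it equals `-c₀`. -/
theorem AvoidsResonances.eq_of_relation (hn : n ≠ 0) (hv : AvoidsResonances v)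
    {I : Finset (Fin m)} (hI : I.card ≤ 2 * n + 2) {r : ℕ} (hrn : r ≤ n)
    {g : Fin (r + 1) → Fin m → ℤ} (hg : ∀ s, Small n I (g s))
    (hind : LinearIndependent ℚ fun (s : Fin r) i => (g s.succ i : ℚ))
    (hdep : ∃ c : Fin (r + 1) → ℤ, c 0 ≠ 0 ∧ ∑ s, c s • g s = 0)
    (h : ∀ c : Fin (r + 1) → ℤ, ∑ s, c s • g s = 0 →
      ∑ s, c s * ∑ j, linForm (g s) (coords v j) ^ 2 = 0) :
    g 0 = 0 ∨ ∃ s : Fin r, g 0 = g s.succ := by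
  classical
  obtain ⟨f, hf⟩ := exists_embedding I
  have hr : ∀ s i, g s i ≠ 0 → i ∈ Set.range f := fun s i hi => (hf i).1 ((hg s i).2 hi)
  have hext : ∀ c : Fin (r + 1) → ℤ, ∑ s, c s • (fun i => g s (f i)) = 0 → ∑ s, c s • g s = 0 := by
    intro c hc
    ext i
    by_cases hi : i ∈ Set.range f
    · obtain ⟨l, rfl⟩ := hi
      simpa using congrFun hc l
    · simp only [Finset.sum_apply, Pi.smul_apply, smul_eq_mul, Pi.zero_apply]
      refine Finset.sum_eq_zero fun s _ => ?_
      have : g s i = 0 := by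
        by_contra h0
        exact hi (hr s i h0)
      simp [this]
  set g' : Fin (r + 1) → Fin I.card → ℤ := fun s i => g s (f i) with hg'
  have hdep' : ∃ c : Fin (r + 1) → ℤ, c 0 ≠ 0 ∧ ∑ s, c s • g' s = 0 := by
    obtain ⟨c, hc0, hc⟩ := hdep
    refine ⟨c, hc0, funext fun l => ?_⟩
    simpa [hg'] using congrFun hc (f l)
  -- The resonance is attached to one relation selected from `g'` alone, which keeps the list
  -- finite; the hypothesis `h` covers every relation and so this one too.
  have hspec : relCoeff g' 0 ≠ 0 ∧ ∑ s, relCoeff g' s • g' s = 0 := by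
    rw [relCoeff, dif_pos hdep']
    exact hdep'.choose_spec
  set c := relCoeff g' with hc
  have key := hv.eq_zero hI (F := relFun c g') (relFun_natural _ _)
    (by
      refine Or.inl (Or.inl (Or.inl (Or.inl (Or.inr (Set.mem_iUnion.2
        ⟨⟨r, by omega⟩, g', ?_, rfl⟩)))))
      exact Small.mem_bounded hg f) f
    (by
      rw [relFun, ← h c (hext c hspec.2)]
      refine Finset.sum_congr rfl fun s _ => ?_
      congr 1
      refine Finset.sum_congr rfl fun j _ => ?_
      rw [← linForm_comp f (g s) (hr s) (coords v j)]
      rfl) (A := ℚ)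
  have hlin : ∀ u : Fin I.card → ℚ, ∑ s, (c s : ℚ) * linForm (g' s) u = 0 := by
    intro u
    have h1 : ∀ l, ∑ s, (c s : ℚ) * g' s l = 0 := fun l => by
      have := congrFun hspec.2 l
      simp only [Finset.sum_apply, Pi.smul_apply, smul_eq_mul, Pi.zero_apply] at this
      exact_mod_cast this
    simp only [linForm, Finset.mul_sum]
    rw [Finset.sum_comm]
    refine Finset.sum_eq_zero fun l _ => ?_
    rw [← zero_mul (u l), ← h1 l, Finset.sum_mul]
    exact Finset.sum_congr rfl fun s _ => by ring
  have hquad : ∀ u : Fin I.card → ℚ, ∑ s, (c s : ℚ) * linForm (g' s) u ^ 2 = 0 := by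
    intro u
    have := key fun _ => u
    simp only [relFun, Finset.sum_const, Finset.card_univ, Fintype.card_fin, nsmul_eq_mul] at this
    have h1 : (n : ℚ) * ∑ s, (c s : ℚ) * linForm (g' s) u ^ 2 = 0 := by
      rw [← this, Finset.mul_sum]
      exact Finset.sum_congr rfl fun s _ => by ring
    exact (mul_eq_zero.1 h1).resolve_left (Nat.cast_ne_zero.2 hn)
  have hd := linearIndependent_linDual_comp f (fun s : Fin r => g s.succ) (fun s => hr s.succ) hind
  have hdual : ∀ y : Fin r → ℚ, ∃ z : ℚ, c 0 * z + ∑ s : Fin r, (c s.succ : ℚ) * y s = 0 ∧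
      c 0 * z ^ 2 + ∑ s : Fin r, (c s.succ : ℚ) * y s ^ 2 = 0 := by
    intro y
    obtain ⟨u, hu⟩ := exists_forall_dual_apply_eq hd y
    simp only [linDual_apply] at hu
    have e1 := hlin u
    have e2 := hquad u
    rw [Fin.sum_univ_succ] at e1 e2
    refine ⟨linForm (g' 0) u, ?_, ?_⟩
    · rw [← e1]
      congr 1
      exact Finset.sum_congr rfl fun s _ => by rw [← hu s]
    · rw [← e2]
      congr 1
      exact Finset.sum_congr rfl fun s _ => by rw [← hu s]
  have hc0 : (c 0 : ℚ) ≠ 0 := Int.cast_ne_zero.2 hspec.1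
  have hone : ∀ s : Fin r, (c s.succ : ℚ) * (c s.succ + c 0) = 0 := fun s => by
    obtain ⟨z, e1, e2⟩ := hdual (Pi.single s 1)
    simp only [Pi.single_apply, mul_ite, mul_one, mul_zero, Finset.sum_ite_eq', Finset.mem_univ,
      if_true, ite_pow, one_pow, ne_eq, OfNat.ofNat_ne_zero, not_false_eq_true, zero_pow] at e1 e2
    linear_combination (c 0 : ℚ) * e2 - (c 0 * z - c s.succ) * e1
  have htwo : ∀ s t : Fin r, s ≠ t → (c s.succ : ℚ) * c t.succ = 0 := fun s t hst => by
    obtain ⟨z, e1, e2⟩ := hdual (Pi.single s 1 + Pi.single t 1)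
    have e3 : ∀ p : Fin r, ((Pi.single s 1 + Pi.single t 1 : Fin r → ℚ) p) ^ 2 =
        (Pi.single s 1 + Pi.single t 1 : Fin r → ℚ) p := fun p => by
      by_cases hp : p = s
      · subst hp; simp [hst]
      · by_cases hp' : p = t
        · subst hp'; simp [hst.symm]
        · simp [hp, hp']
    simp only [e3] at e2
    simp only [Pi.add_apply, Pi.single_apply, mul_add, Finset.sum_add_distrib, mul_ite, mul_one,
      mul_zero, Finset.sum_ite_eq', Finset.mem_univ, if_true] at e1 e2
    linear_combination (1 / 2) * ((c 0 : ℚ) * e2 - (c 0 * z - c s.succ - c t.succ) * e1) -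
      (1 / 2) * hone s - (1 / 2) * hone t
  have hrel : ∀ i, (c 0 : ℚ) * g 0 i + ∑ s : Fin r, (c s.succ : ℚ) * g s.succ i = 0 := by
    intro i
    have := congrFun (hext c hspec.2) i
    simp only [Finset.sum_apply, Pi.smul_apply, smul_eq_mul, Pi.zero_apply,
      Fin.sum_univ_succ] at this
    exact_mod_cast this
  by_cases hall : ∀ s : Fin r, c s.succ = 0
  · left
    ext i
    have := hrel i
    simp only [hall, Int.cast_zero, zero_mul, Finset.sum_const_zero, add_zero] at this
    exact_mod_cast (mul_eq_zero.1 this).resolve_left hc0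
  · right
    push Not at hall
    obtain ⟨s, hs⟩ := hall
    have hs' : (c s.succ : ℚ) ≠ 0 := Int.cast_ne_zero.2 hs
    refine ⟨s, funext fun i => ?_⟩
    have := hrel i
    rw [Finset.sum_eq_single s (fun t _ hts => by
      rw [(mul_eq_zero.1 (htwo s t hts.symm)).resolve_left hs', zero_mul]) (by simp)] at this
    have h1 := (mul_eq_zero.1 (hone s)).resolve_left hs'
    have h2 : (c 0 : ℚ) * (g 0 i - g s.succ i) = 0 := by linear_combination this - g s.succ i * h1
    exact_mod_cast sub_eq_zero.1 ((mul_eq_zero.1 h2).resolve_left hc0)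

end Generic

/-! ### Overdetermined systems are solved only by tangential sites -/

section Rank

variable {n m : ℕ} {v : Fin m → Fin n → ℤ}

theorem eq_of_linear_equations {κ : Type} [Fintype κ] {d : Fin n → κ → ℤ} {w : Fin n → κ → ℤ}
    {k : Fin n → ℤ} {x : κ}
    (hr : ∀ s, 2 * ∑ j, k j * linForm (d s) (w j) = ∑ j, 2 * linForm (d s) (w j) * w j x)
    (hdet : (formMatrix d w).det ≠ 0) (j : Fin n) : k j = w j x := by
  have h0 : formMatrix d w *ᵥ (fun j => k j - w j x) = 0 := by
    ext s
    have := hr s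
    simp only [Matrix.mulVec, dotProduct, formMatrix, Matrix.of_apply, Pi.zero_apply, mul_sub,
      Finset.sum_sub_distrib]
    simp only [mul_assoc, ← Finset.mul_sum] at this
    have h1 := mul_left_cancel₀ two_ne_zero this
    rw [← h1, sub_eq_zero]
    exact Finset.sum_congr rfl fun j _ => mul_comm _ _
  exact sub_eq_zero.1 (congrFun (Matrix.eq_zero_of_mulVec_eq_zero hdet h0) j)

/-- On columns dual to the independent forms the matrix is the identity, so the determinant is a
nonzero polynomial. -/
theorem AvoidsResonances.det_ne_zero (hv : AvoidsResonances v) {I : Finset (Fin m)}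
    (hI : I.card ≤ 2 * n + 2) {a : Fin m → ℤ} {g : Fin n → Fin m → ℤ} (red : Fin n → Bool)
    (ha : Small n I a) (hg : ∀ s, Small n I (g s)) (f : Fin I.card ↪ Fin m)
    (hd : LinearIndependent ℚ fun s =>
      linDual (reduced (fun i => a (f i)) (fun s i => g s (f i)) red s)) :
    (formMatrix (reduced (fun i => a (f i)) (fun s i => g s (f i)) red)
      fun j i => v (f i) j).det ≠ 0 := by
  intro h
  choose w hw using fun j : Fin n => exists_forall_dual_apply_eq hd (Pi.single j 1)
  have key := hv.eq_zero hI (F := detFun (fun i => a (f i)) (fun s i => g s (f i)) red)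
    (detFun_natural _ _ _)
    (by
      refine Or.inl (Or.inl (Or.inr
        ⟨(fun s i => (Fin.cons a g : Fin (n + 1) → Fin m → ℤ) s (f i), red), ⟨?_, trivial⟩, rfl⟩))
      exact Small.mem_bounded (Fin.cases ha hg) f) f h (A := ℚ) w
  have h1 : formMatrix (reduced (fun i => a (f i)) (fun s i => g s (f i)) red) w = 1 := by
    ext s j
    have := hw j s
    rw [linDual_apply] at this
    rw [formMatrix, Matrix.of_apply, this, Matrix.one_apply, Pi.single_apply]
  rw [detFun, h1, Matrix.det_one] at key
  exact one_ne_zero key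

/-- The sphere equation of `a`, subtracted from the other sphere equations, leaves `n` linear
equations that determine `k`. Compatibility with the sphere holds at the sites, hence identically.
The identity factors the right-hand sides through a form `κ` which evaluates at one index `x`, so `v
x` solves the same nonsingular system as `k`. -/
theorem AvoidsResonances.exists_site_of_red (hn : n ≠ 0) (hv : AvoidsResonances v)
    {I : Finset (Fin m)} (hI : I.card ≤ 2 * n + 2) {a : Fin m → ℤ} {g : Fin n → Fin m → ℤ}
    (red : Fin n → Bool) (ha : Small n I a) (hg : ∀ s, Small n I (g s))
    (hind : LinearIndependent ℚ fun s i => ((Fin.cons a g : Fin (n + 1) → Fin m → ℤ) s i : ℚ))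
    (hsum : ∑ i, a i = 2) {k : Fin n → ℤ}
    (hka : 2 * ∑ j, k j * k j - 2 * ∑ j, k j * linForm a (coords v j) =
      ∑ j, quadForm a (coords v j))
    (hkg : ∀ s, if red s then 2 * ∑ j, k j * k j - 2 * ∑ j, k j * linForm (g s) (coords v j) =
        ∑ j, quadForm (g s) (coords v j)
      else 2 * ∑ j, k j * linForm (g s) (coords v j) = ∑ j, quadForm (g s) (coords v j)) :
    ∃ x, k = v x := by
  classical
  obtain ⟨f, hf⟩ := exists_embedding I
  have hra : ∀ i, a i ≠ 0 → i ∈ Set.range f := fun i hi => (hf i).1 ((ha i).2 hi)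
  have hrg : ∀ s i, g s i ≠ 0 → i ∈ Set.range f := fun s i hi => (hf i).1 ((hg s i).2 hi)
  set a' : Fin I.card → ℤ := fun i => a (f i) with ha'
  set g' : Fin n → Fin I.card → ℤ := fun s i => g s (f i) with hg'
  set w : Fin n → Fin I.card → ℤ := fun j i => v (f i) j with hw
  have la : ∀ j, linForm a (coords v j) = linForm a' (w j) := fun j =>
    (linForm_comp f a hra (coords v j)).symm
  have qa : ∀ j, quadForm a (coords v j) = quadForm a' (w j) := fun j =>
    (quadForm_comp f a hra (coords v j)).symm
  have lg : ∀ s j, linForm (g s) (coords v j) = linForm (g' s) (w j) := fun s j =>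
    (linForm_comp f (g s) (hrg s) (coords v j)).symm
  have qg : ∀ s j, quadForm (g s) (coords v j) = quadForm (g' s) (w j) := fun s j =>
    (quadForm_comp f (g s) (hrg s) (coords v j)).symm
  simp only [la, qa, lg, qg] at hka hkg
  have hd : LinearIndependent ℚ fun s => linDual (reduced a' g' red s) := by
    have h1 := linearIndependent_linDual_comp f (reduced a g red) (fun s i hi => by
      by_contra hcon
      have e1 : a i = 0 := by by_contra h; exact hcon (hra i h)
      have e2 : g s i = 0 := by by_contra h; exact hcon (hrg s i h)
      apply hi
      unfold reduced
      split_ifs <;> simp [e1, e2]) (linearIndependent_reduced red hind)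
    convert h1 using 3 with s
    unfold reduced
    split_ifs <;> rfl
  have hdet := hv.det_ne_zero hI red ha hg f hd
  -- For `red s` this is the difference of two sphere equations, in which the terms `2|k|²` cancel.
  have hlin : ∀ s, 2 * ∑ j, k j * linForm (reduced a' g' red s) (w j) =
      reducedRhs a' g' red w s := by
    intro s
    have := hkg s
    unfold reduced reducedRhs
    split_ifs with h
    · rw [if_pos h] at this
      simp only [linForm_sub, mul_sub, Finset.sum_sub_distrib]
      linarith
    · rw [if_neg h] at this
      exact this
  set M := formMatrix (reduced a' g' red) w with hM
  have hK : M.adjugate *ᵥ reducedRhs a' g' red w = (2 * M.det) • k := by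
    have : reducedRhs a' g' red w = M *ᵥ ((2 : ℤ) • k) := by
      ext s
      rw [← hlin s, Matrix.mulVec_smul, Pi.smul_apply, smul_eq_mul]
      congr 1
      exact Finset.sum_congr rfl fun j _ => mul_comm _ _
    rw [this, Matrix.mulVec_mulVec, Matrix.adjugate_mul, Matrix.smul_mulVec, Matrix.one_mulVec,
      smul_smul, mul_comm]
  have key := hv.eq_zero hI (F := sphereFun a' g' red) (sphereFun_natural _ _ _)
    (by
      refine Or.inl (Or.inr
        ⟨(fun s i => (Fin.cons a g : Fin (n + 1) → Fin m → ℤ) s (f i), red), ⟨?_, trivial⟩, rfl⟩)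
      exact Small.mem_bounded (Fin.cases ha hg) f) f
    (by
      have : sphereFun a' g' red ℤ w = 2 * M.det ^ 2 * (2 * ∑ j, k j * k j -
          2 * ∑ j, k j * linForm a' (w j) - ∑ j, quadForm a' (w j)) := by
        simp only [sphereFun]
        rw [← hM, hK]
        simp only [smul_dotProduct, dotProduct_smul, smul_eq_mul]
        simp only [dotProduct]
        ring
      rw [this, hka, sub_self, mul_zero]) (A := ℚ)
  have : Nonempty (Fin n) := ⟨⟨0, Nat.pos_of_ne_zero hn⟩⟩
  let r : Fin n → QuadraticForm ℚ (Fin I.card → ℚ) := fun s =>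
    if red s then quadDual a' - quadDual (g' s) else quadDual (g' s)
  have hr : ∀ s u, r s u = if red s then quadForm a' u - quadForm (g' s) u
      else quadForm (g' s) u := by
    intro s u
    simp only [r]
    split_ifs <;> simp [quadDual_apply]
  obtain ⟨κ, hκ, hκa⟩ := exists_common_dual_of_cramer hd r (linDual a') (quadDual a')
    (by
      intro w M hM K hK
      have := key w
      have e1 : formMatrix (reduced a' g' red) w = M := by
        ext s j; rw [hM, linDual_apply]; rfl
      have e2 : reducedRhs a' g' red w = fun s => ∑ j, r s (w j) := by
        ext s; simp only [reducedRhs, hr]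
      simp only [sphereFun] at this
      rw [e1, e2, ← Matrix.cramer_eq_adjugate_mulVec, ← hK] at this
      simpa only [linDual_apply, quadDual_apply] using this)
  obtain ⟨x, hx⟩ := exists_eq_apply_of_red (by
    rw [← hsum, ← Finset.sum_map Finset.univ f a]
    refine Finset.sum_subset (Finset.subset_univ _) fun i _ hi => ?_
    by_contra h
    obtain ⟨l, hl⟩ := hra i h
    exact hi (Finset.mem_map.2 ⟨l, Finset.mem_univ _, hl⟩)) hκa
  refine ⟨f x, funext fun j => eq_of_linear_equations (fun s => ?_) hdet j⟩
  rw [hlin s]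
  have e := fun j => hκ s fun i => ((w j i : ℤ) : ℚ)
  simp only [hr, hx, linDual_apply] at e
  have h1 : ∀ (g : Fin I.card → ℤ) (j), quadForm g (fun i => ((w j i : ℤ) : ℚ)) =
      (quadForm g (w j) : ℤ) := fun g j => map_quadForm (Int.castRingHom ℚ) g (w j)
  have h2 : ∀ (g : Fin I.card → ℤ) (j), linForm g (fun i => ((w j i : ℤ) : ℚ)) =
      (linForm g (w j) : ℤ) := fun g j => map_linForm (Int.castRingHom ℚ) g (w j)
  simp only [h1, h2] at e
  unfold reducedRhs
  exact Finset.sum_congr rfl fun j _ => by exact_mod_cast e j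

/-- The case in which no sphere equation is available: `n + 1` linear equations. Their compatibility
becomes an identity, `κ` is identified from two of the equations, and `n` of them determine `k`. -/
theorem AvoidsResonances.exists_site_of_black (hn : n ≠ 0) (hv : AvoidsResonances v)
    {I : Finset (Fin m)} (hI : I.card ≤ 2 * n + 2) {g : Fin (n + 1) → Fin m → ℤ}
    (hg : ∀ s, Small n I (g s)) (hind : LinearIndependent ℚ fun s i => (g s i : ℚ))
    (hsum : ∀ s, ∑ i, g s i = 0) {k : Fin n → ℤ}
    (hk : ∀ s, 2 * ∑ j, k j * linForm (g s) (coords v j) = ∑ j, quadForm (g s) (coords v j)) :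
    ∃ x, k = v x := by
  classical
  obtain ⟨f, hf⟩ := exists_embedding I
  have hrg : ∀ s i, g s i ≠ 0 → i ∈ Set.range f := fun s i hi => (hf i).1 ((hg s i).2 hi)
  set g' : Fin (n + 1) → Fin I.card → ℤ := fun s i => g s (f i) with hg'
  set w : Fin n → Fin I.card → ℤ := fun j i => v (f i) j with hw
  have lg : ∀ s j, linForm (g s) (coords v j) = linForm (g' s) (w j) := fun s j =>
    (linForm_comp f (g s) (hrg s) (coords v j)).symm
  have qg : ∀ s j, quadForm (g s) (coords v j) = quadForm (g' s) (w j) := fun s j =>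
    (quadForm_comp f (g s) (hrg s) (coords v j)).symm
  simp only [lg, qg] at hk
  have hd : LinearIndependent ℚ fun s => linDual (g' s) :=
    linearIndependent_linDual_comp f g hrg hind
  have hdet := hv.det_ne_zero hI (fun _ => false) (hg 0) (fun s => hg s.succ) f
    (hd.comp _ (Fin.succ_injective n))
  have key := hv.eq_zero hI (F := extendedFun g') (extendedFun_natural _)
    (Or.inr ⟨g', Small.mem_bounded hg f, rfl⟩) f
    (by
      rw [extendedFun, ← Matrix.exists_mulVec_eq_zero_iff]
      -- The equations say that `(2k, -1)` lies in the kernel of the extended matrix.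
      refine ⟨Fin.snoc (fun j => 2 * k j) (-1), fun h => ?_, ?_⟩
      · have := congrFun h (Fin.last n)
        simp at this
      · ext s
        simp only [Matrix.mulVec, dotProduct, Matrix.of_apply, Fin.sum_univ_castSucc,
          Fin.snoc_castSucc, Fin.snoc_last, Pi.zero_apply]
        have := hk s
        rw [Finset.mul_sum] at this
        change _ + (∑ j, quadForm (g' s) (w j)) * -1 = 0
        rw [← this, mul_neg_one, ← sub_eq_add_neg, sub_eq_zero]
        exact Finset.sum_congr rfl fun j _ => by ring) (A := ℚ)
  obtain ⟨κ, hκ⟩ := exists_common_dual_of_det hn hd (fun s => quadDual (g' s)) (fun w => by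
    have := key w
    rw [extendedFun] at this
    simpa only [linDual_apply, quadDual_apply] using this)
  have hsum' : ∀ s, ∑ i, g' s i = 0 := fun s => by
    rw [← hsum s, ← Finset.sum_map Finset.univ f (g s)]
    refine Finset.sum_subset (Finset.subset_univ _) fun i _ hi => ?_
    by_contra h
    obtain ⟨l, hl⟩ := hrg s i h
    exact hi (Finset.mem_map.2 ⟨l, Finset.mem_univ _, hl⟩)
  have h0l : (0 : Fin (n + 1)) ≠ Fin.last n := by
    intro h
    exact hn (by simpa using (congrArg Fin.val h).symm)
  have hpair : ∀ c c' : ℚ, (∀ i, c * g' 0 i + c' * g' (Fin.last n) i = 0) → c = 0 ∧ c' = 0 := by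
    intro c c' h
    have := Fintype.linearIndependent_iff.1 hd (Pi.single 0 c + Pi.single (Fin.last n) c') (by
      simp only [Pi.add_apply, add_smul, Finset.sum_add_distrib, Pi.single_apply, ite_smul,
        zero_smul, Finset.sum_ite_eq', Finset.mem_univ, if_true]
      ext i
      simpa [linDual_apply, linForm_single] using h i)
    have e1 := this 0
    have e2 := this (Fin.last n)
    simp [h0l, h0l.symm] at e1 e2
    exact ⟨e1, e2⟩
  obtain ⟨x, hx⟩ := exists_eq_apply_of_black (hsum' 0) (hsum' (Fin.last n))
    (fun c c' h => (hpair c c' h).1) (fun c c' h => (hpair c c' h).2) (hκ 0) (hκ (Fin.last n))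
  refine ⟨f x, funext fun j => eq_of_linear_equations (fun s => ?_) hdet j⟩
  change 2 * ∑ j, k j * linForm (g' s.succ) (w j) = ∑ j, 2 * linForm (g' s.succ) (w j) * w j x
  rw [hk]
  have e := fun j => hκ s.succ fun i => ((w j i : ℤ) : ℚ)
  simp only [quadDual_apply, hx, linDual_apply] at e
  have h1 : ∀ (g : Fin I.card → ℤ) (j), quadForm g (fun i => ((w j i : ℤ) : ℚ)) =
      (quadForm g (w j) : ℤ) := fun g j => map_quadForm (Int.castRingHom ℚ) g (w j)
  have h2 : ∀ (g : Fin I.card → ℤ) (j), linForm g (fun i => ((w j i : ℤ) : ℚ)) =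
      (linForm g (w j) : ℤ) := fun g j => map_linForm (Int.castRingHom ℚ) g (w j)
  simp only [h1, h2] at e
  exact Finset.sum_congr rfl fun j _ => by exact_mod_cast e j

end Rank

/-! ### Conservation laws along the combinatorial graph -/

section Relative

variable {n m : ℕ} {v : Fin m → Fin n → ℤ}

theorem CombBlack.symm {i j : Fin m} {p q : Frequency m} (h : CombBlack v i j p q) :
    CombBlack v j i q p := by
  refine ⟨h.1.symm, ?_, by have := h.2.2; linarith⟩
  rw [h.2.1]; abel

theorem CombRed.symm {i j : Fin m} {p q : Frequency m} (h : CombRed v i j p q) :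
    CombRed v i j q p := by
  refine ⟨by rw [h.1, neg_neg], ?_, by have := h.2.2; linarith⟩
  rw [add_comm q.1]; exact h.2.1

theorem CombRed.swap {i j : Fin m} {p q : Frequency m} (h : CombRed v i j p q) :
    CombRed v j i p q := by
  refine ⟨h.1, ?_, by have := h.2.2; linarith⟩
  rw [← h.2.1]; abel

theorem unit_ne_neg (σ : ℤˣ) : σ ≠ -σ := by
  rcases Int.units_eq_one_or σ with rfl | rfl <;> decide

theorem unitVec_injective : Function.Injective (unitVec : Fin m → Fin m → ℤ) := by
  intro i j h
  by_contra hij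
  have := congrFun h i
  simp [unitVec, hij] at this

theorem combinatorialGraph_adj {p q : Frequency m} : (combinatorialGraph v).Adj p q ↔
    ∃ i j : Fin m, i ≠ j ∧ (CombBlack v i j p q ∨ CombRed v i j p q) := by
  rw [combinatorialGraph, SimpleGraph.fromRel_adj]
  constructor
  · rintro ⟨-, h | ⟨i, j, hij, h | h⟩⟩
    · exact h
    · exact ⟨j, i, hij.symm, Or.inl h.symm⟩
    · exact ⟨i, j, hij, Or.inr h.symm⟩
  · rintro ⟨i, j, hij, h⟩
    refine ⟨?_, Or.inl ⟨i, j, hij, h⟩⟩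
    rintro rfl
    rcases h with h | h
    · have h1 : unitVec i = unitVec j := by
        have h0 := h.2.1
        rw [add_sub_assoc, left_eq_add, sub_eq_zero] at h0
        exact h0
      exact hij (unitVec_injective h1)
    · exact unit_ne_neg _ h.1

/-- The position of `q` relative to `p`: `site q = ± site p + momentum (relative p q)`. -/
def relative (p q : Frequency m) : Fin m → ℤ := if q.2 = p.2 then p.1 - q.1 else -p.1 - q.1

theorem relative_of_eq {p q : Frequency m} (h : q.2 = p.2) : relative p q = p.1 - q.1 := if_pos h

theorem relative_of_ne {p q : Frequency m} (h : q.2 ≠ p.2) : relative p q = -p.1 - q.1 := if_neg h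

theorem relative_self (p : Frequency m) : relative p p = 0 := by simp [relative]

theorem eq_of_relative {p q q' : Frequency m} (h : q.2 = p.2 ↔ q'.2 = p.2)
    (h' : relative p q = relative p q') : q = q' := by
  by_cases hq : q.2 = p.2
  · have hq' := h.1 hq
    rw [relative_of_eq hq, relative_of_eq hq', sub_right_inj] at h'
    exact Prod.ext h' (hq.trans hq'.symm)
  · have hq' := fun h0 => hq (h.2 h0)
    rw [relative_of_ne hq, relative_of_ne hq', sub_right_inj] at h'
    exact Prod.ext h' ((Int.units_ne_iff_eq_neg.1 hq).trans (Int.units_ne_iff_eq_neg.1 hq').symm)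

theorem CombBlack.relative {i j : Fin m} {p q q' : Frequency m} (h : CombBlack v i j q q') :
    relative p q' = relative p q - unitVec i + unitVec j := by
  by_cases hq : q.2 = p.2
  · rw [relative_of_eq hq, relative_of_eq (h.1.symm.trans hq), h.2.1]; abel
  · rw [relative_of_ne hq, relative_of_ne (h.1 ▸ hq), h.2.1]; abel

theorem CombRed.color {i j : Fin m} {p q q' : Frequency m} (h : CombRed v i j q q') :
    q'.2 = p.2 ↔ ¬ q.2 = p.2 := by
  rw [h.1, ← ne_eq, Int.units_ne_iff_eq_neg, neg_inj]

theorem CombRed.relative {i j : Fin m} {p q q' : Frequency m} (h : CombRed v i j q q') :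
    relative p q' = -relative p q + unitVec i + unitVec j := by
  have h1 : q'.1 = -q.1 - unitVec i - unitVec j := by
    rw [eq_comm, ← sub_eq_zero, ← neg_eq_zero, ← h.2.1]; abel
  by_cases hq : q.2 = p.2
  · rw [relative_of_eq hq, relative_of_ne (fun h0 => h.color.1 h0 hq), h1]; abel
  · rw [relative_of_ne hq, relative_of_eq (h.color.2 hq), h1]; abel

/-- The energy `∑ aᵢ |vᵢ|²`. -/
def energy (v : Fin m → Fin n → ℤ) (a : Fin m → ℤ) : ℤ := ∑ i, a i * (v i ⬝ᵥ v i)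

theorem energy_add (a b : Fin m → ℤ) : energy v (a + b) = energy v a + energy v b := by
  simp [energy, add_mul, Finset.sum_add_distrib]

theorem energy_neg (a : Fin m → ℤ) : energy v (-a) = -energy v a := by
  simp [energy]

theorem energy_sub (a b : Fin m → ℤ) : energy v (a - b) = energy v a - energy v b := by
  rw [sub_eq_add_neg, energy_add, energy_neg, sub_eq_add_neg]

theorem energy_unitVec (i : Fin m) : energy v (unitVec i) = v i ⬝ᵥ v i := by
  simp [energy, unitVec, Pi.single_apply]

theorem momentum_apply (a : Fin m → ℤ) (j : Fin n) :
    momentum v a j = linForm a (coords v j) := by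
  simp [momentum, linForm, coords]

theorem momentum_add (a b : Fin m → ℤ) : momentum v (a + b) = momentum v a + momentum v b := by
  simp [momentum, add_smul, Finset.sum_add_distrib]

theorem momentum_neg (a : Fin m → ℤ) : momentum v (-a) = -momentum v a := by
  simp [momentum]

theorem momentum_sub (a b : Fin m → ℤ) : momentum v (a - b) = momentum v a - momentum v b := by
  rw [sub_eq_add_neg, momentum_add, momentum_neg, sub_eq_add_neg]

theorem momentum_unitVec (i : Fin m) : momentum v (unitVec i) = v i := by
  ext j
  simp [momentum_apply, linForm, unitVec, Pi.single_apply, coords]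

theorem sum_unitVec (i : Fin m) : ∑ l, unitVec i l = 1 := by simp [unitVec]

/-- The conservation laws for frequencies in the same component. -/
structure Conserved (v : Fin m → Fin n → ℤ) (p q : Frequency m) : Prop where
  sum_black : q.2 = p.2 → ∑ i, relative p q i = 0
  sum_red : q.2 ≠ p.2 → ∑ i, relative p q i = 2
  energy_black : q.2 = p.2 → site v q ⬝ᵥ site v q - site v p ⬝ᵥ site v p = energy v (relative p q)
  energy_red : q.2 ≠ p.2 → site v q ⬝ᵥ site v q + site v p ⬝ᵥ site v p = energy v (relative p q)

theorem Conserved.refl (p : Frequency m) : Conserved v p p := by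
  constructor <;> simp [relative_self, energy]

theorem Conserved.step {p q q' : Frequency m} (h : Conserved v p q)
    (hadj : (combinatorialGraph v).Adj q q') : Conserved v p q' := by
  obtain ⟨i, j, -, hb | hr⟩ := combinatorialGraph_adj.1 hadj
  · have hc : q'.2 = p.2 ↔ q.2 = p.2 := by rw [hb.1]
    have he := hb.2.2
    constructor <;> intro hq' <;> rw [hb.relative]
    · have := h.sum_black (hc.1 hq')
      simp [Finset.sum_add_distrib, this, sum_unitVec]
    · have := h.sum_red (fun h0 => hq' (hc.2 h0))
      simp [Finset.sum_add_distrib, this, sum_unitVec]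
    · have := h.energy_black (hc.1 hq')
      rw [energy_add, energy_sub, energy_unitVec, energy_unitVec]
      linarith
    · have := h.energy_red (fun h0 => hq' (hc.2 h0))
      rw [energy_add, energy_sub, energy_unitVec, energy_unitVec]
      linarith
  · have hc : q'.2 = p.2 ↔ ¬ q.2 = p.2 := hr.color
    have he := hr.2.2
    constructor <;> intro hq' <;> rw [hr.relative]
    · have := h.sum_red (hc.1 hq')
      simp [Finset.sum_add_distrib, this, sum_unitVec]
    · have := h.sum_black (by tauto)
      simp [Finset.sum_add_distrib, this, sum_unitVec]
    · have := h.energy_red (hc.1 hq')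
      rw [energy_add, energy_add, energy_neg, energy_unitVec, energy_unitVec]
      linarith
    · have := h.energy_black (by tauto)
      rw [energy_add, energy_add, energy_neg, energy_unitVec, energy_unitVec]
      linarith

theorem site_of_black {p q : Frequency m} (h : q.2 = p.2) :
    site v q = site v p + momentum v (relative p q) := by
  rw [relative_of_eq h, momentum_sub, site, site]; abel

theorem site_of_red {p q : Frequency m} (h : q.2 ≠ p.2) :
    site v q = -site v p + momentum v (relative p q) := by
  rw [relative_of_ne h, momentum_sub, momentum_neg, site, site]; abel

theorem sum_quadForm (a : Fin m → ℤ) : ∑ j, quadForm a (coords v j) =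
    energy v a - momentum v a ⬝ᵥ momentum v a := by
  simp only [quadForm, Finset.sum_sub_distrib, energy, dotProduct, momentum_apply, Int.cast_id,
    Finset.mul_sum, coords]
  rw [Finset.sum_comm]
  simp only [sq]

/-- Substituting `site q = site p + π(a)` in the energy law cancels `|site p|²`, so the equation for
`site p` is linear. -/
theorem Conserved.black {p q : Frequency m} (h : Conserved v p q) (hq : q.2 = p.2) :
    2 * ∑ j, site v p j * linForm (relative p q) (coords v j) =
      ∑ j, quadForm (relative p q) (coords v j) := by
  have he := h.energy_black hq
  rw [site_of_black hq] at he
  simp only [add_dotProduct, dotProduct_add] at he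
  rw [sum_quadForm]
  have h1 : ∑ j, site v p j * linForm (relative p q) (coords v j) =
      site v p ⬝ᵥ momentum v (relative p q) := by
    simp only [dotProduct, momentum_apply]
  rw [h1]
  rw [dotProduct_comm (momentum v _) (site v p)] at he
  linarith

/-- With `site q = -site p + π(a)` the squares add up instead of cancelling: a sphere equation. -/
theorem Conserved.red {p q : Frequency m} (h : Conserved v p q) (hq : q.2 ≠ p.2) :
    2 * ∑ j, site v p j * site v p j -
        2 * ∑ j, site v p j * linForm (relative p q) (coords v j) =
      ∑ j, quadForm (relative p q) (coords v j) := by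
  have he := h.energy_red hq
  rw [site_of_red hq] at he
  simp only [add_dotProduct, dotProduct_add, neg_dotProduct, dotProduct_neg] at he
  rw [sum_quadForm]
  have h1 : ∑ j, site v p j * linForm (relative p q) (coords v j) =
      site v p ⬝ᵥ momentum v (relative p q) := by
    simp only [dotProduct, momentum_apply]
  have h2 : ∑ j, site v p j * site v p j = site v p ⬝ᵥ site v p := rfl
  rw [h1, h2]
  rw [dotProduct_comm (momentum v _) (site v p)] at he
  linarith

/-- Since the two indices of an edge differ, each entry changes by at most one, up to a global sign.
This bounds the coefficients of the resonances. -/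
theorem abs_relative_step {p q q' : Frequency m} (hadj : (combinatorialGraph v).Adj q q')
    (l : Fin m) : |relative p q' l| ≤ |relative p q l| + 1 := by
  obtain ⟨i, j, hij, hb | hr⟩ := combinatorialGraph_adj.1 hadj
  · rw [hb.relative]
    have : |unitVec j l - unitVec i l| ≤ 1 := by
      simp only [unitVec, Pi.single_apply]
      split_ifs with h1 h2 <;> simp_all
    have e : (relative p q - unitVec i + unitVec j) l =
      relative p q l + (unitVec j l - unitVec i l) := by simp; ring
    rw [e]
    exact (abs_add_le _ _).trans (by linarith)
  · rw [hr.relative]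
    have : |unitVec i l + unitVec j l| ≤ 1 := by
      simp only [unitVec, Pi.single_apply]
      split_ifs with h1 h2 <;> simp_all
    have e : (-relative p q + unitVec i + unitVec j) l =
      -relative p q l + (unitVec i l + unitVec j l) := by simp; ring
    rw [e]
    exact (abs_add_le _ _).trans (by rw [abs_neg]; linarith)

/-- Each edge brings in at most two new tangential sites, whence twice the rank bounds the number of
variables. -/
theorem support_relative_step {p q q' : Frequency m} (hadj : (combinatorialGraph v).Adj q q') :
    ∃ i j : Fin m, ∀ l, relative p q' l ≠ 0 → relative p q l ≠ 0 ∨ l = i ∨ l = j := by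
  obtain ⟨i, j, hij, hb | hr⟩ := combinatorialGraph_adj.1 hadj
  · refine ⟨i, j, fun l hl => ?_⟩
    by_contra hcon
    push Not at hcon
    apply hl
    rw [hb.relative]
    simp [unitVec, hcon]
  · refine ⟨i, j, fun l hl => ?_⟩
    by_contra hcon
    push Not at hcon
    apply hl
    rw [hr.relative]
    simp [unitVec, hcon]

end Relative

/-! ### Independence and rank of the displacements along a path -/

section Injectivity

variable {n m : ℕ} {v : Fin m → Fin n → ℤ}

/-- An integer vector as a rational vector. -/
def toRat (a : Fin m → ℤ) : Fin m → ℚ := fun i => a i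

/-- The denominators of a rational combination are cleared by their product `D`; the coefficient of
`a` is `-D`. -/
theorem exists_int_relation {r : ℕ} {a : Fin m → ℤ} {g : Fin r → Fin m → ℤ}
    (h : toRat a ∈ Submodule.span ℚ (Set.range fun s => toRat (g s))) :
    ∃ c : Fin (r + 1) → ℤ, c 0 ≠ 0 ∧
      ∑ s, c s • (Fin.cons a g : Fin (r + 1) → Fin m → ℤ) s = 0 := by
  obtain ⟨q, hq⟩ := (Submodule.mem_span_range_iff_exists_fun ℚ).1 h
  let D : ℤ := ∏ s, ((q s).den : ℤ)
  have hD : D ≠ 0 := Finset.prod_ne_zero_iff.2 fun s _ => by exact_mod_cast (q s).den_nz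
  have hz : ∀ s, ∃ z : ℤ, (z : ℚ) = D * q s := fun s => by
    refine ⟨(q s).num * ∏ t ∈ Finset.univ.erase s, ((q t).den : ℤ), ?_⟩
    have : D = (q s).den * ∏ t ∈ Finset.univ.erase s, ((q t).den : ℤ) :=
      (Finset.mul_prod_erase _ _ (Finset.mem_univ s)).symm
    rw [this]
    push_cast
    have h1 : ((q s).den : ℚ) * q s = (q s).num := by
      rw [mul_comm]; exact Rat.mul_den_eq_num (q s)
    rw [mul_right_comm, h1]
  choose z hz using hz
  refine ⟨Fin.cons (-D) z, by simpa using hD, ?_⟩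
  ext i
  have h1 := congrFun hq i
  simp only [Finset.sum_apply, Pi.smul_apply, smul_eq_mul, toRat] at h1
  have h2 : ((∑ s, z s * g s i : ℤ) : ℚ) = D * a i := by
    push_cast
    rw [← h1, Finset.mul_sum]
    exact Finset.sum_congr rfl fun s _ => by rw [hz]; ring
  have h3 : ∑ s, z s * g s i = D * a i := by exact_mod_cast h2
  simp [Fin.sum_univ_succ, h3]

/-- Data extracted from the first `t` steps of a path without repeated vertices. -/
structure IsTrail (v : Fin m → Fin n → ℤ) (p : Frequency m) (q : ℕ → Frequency m) (t : ℕ) :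
    Prop where
  zero : q 0 = p
  conserved : ∀ s ≤ t, Conserved v p (q s)
  bound : ∀ s ≤ t, ∀ l, |relative p (q s) l| ≤ s
  inj : Set.InjOn q {s | s ≤ t}

theorem IsTrail.small {p : Frequency m} {q : ℕ → Frequency m} {t : ℕ} (h : IsTrail v p q t)
    (ht : t ≤ 2 * n + 1) {I : Finset (Fin m)} (hI : ∀ s ≤ t, ∀ l, relative p (q s) l ≠ 0 → l ∈ I)
    {s : ℕ} (hs : s ≤ t) : Small n I (relative p (q s)) := by
  intro l
  refine ⟨(h.bound s hs l).trans ?_, hI s hs l⟩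
  have : s ≤ 2 * n + 2 := by omega
  exact_mod_cast this

theorem IsTrail.eq_of_relative {p : Frequency m} {q : ℕ → Frequency m} {t : ℕ}
    (h : IsTrail v p q t) {s s' : ℕ} (hs : s ≤ t) (hs' : s' ≤ t)
    (hc : (q s).2 = p.2 ↔ (q s').2 = p.2) (hr : relative p (q s) = relative p (q s')) : s = s' :=
  h.inj hs hs' (NLSGraph.eq_of_relative hc hr)

/-- Different vertices of a trail, of the same colour, are linearly independent. -/
theorem IsTrail.linearIndepOn (hn : n ≠ 0) (hv : AvoidsResonances v) {p : Frequency m}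
    {q : ℕ → Frequency m} {t : ℕ} (h : IsTrail v p q t) (ht : t ≤ 2 * n + 1)
    {I : Finset (Fin m)} (hcard : I.card ≤ 2 * n + 2)
    (hI : ∀ s ≤ t, ∀ l, relative p (q s) l ≠ 0 → l ∈ I)
    (hrank : Module.finrank ℚ
      (Submodule.span ℚ ((fun s => toRat (relative p (q s))) '' {s | s ≤ t})) ≤ n)
    (C : Prop) (T : Finset ℕ) (hT : ∀ s ∈ T, s ≤ t ∧ s ≠ 0 ∧ ((q s).2 = p.2 ↔ C)) :
    LinearIndepOn ℚ (fun s => toRat (relative p (q s))) (T : Set ℕ) := by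
  classical
  induction T using Finset.induction_on with
  | empty => simp
  | insert s₀ T hs₀ ih =>
    have ih' := ih fun s hs => hT s (Finset.mem_insert_of_mem hs)
    rw [Finset.coe_insert]
    refine ih'.insert fun hmem => ?_
    obtain ⟨h0t, h00, h0C⟩ := hT s₀ (Finset.mem_insert_self _ _)
    let e := T.equivFin.symm
    have hind : LinearIndependent ℚ fun s : Fin T.card => toRat (relative p (q (e s))) :=
      LinearIndependent.comp ih' e e.injective
    have hr : T.card ≤ n := by
      refine le_trans ?_ hrank
      have h1 : LinearIndependent ℚ fun s : Fin T.card =>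
          (⟨toRat (relative p (q (e s))), Submodule.subset_span
            ⟨e s, (hT _ (Finset.mem_insert_of_mem (e s).2)).1, rfl⟩⟩ :
            Submodule.span ℚ ((fun s => toRat (relative p (q s))) '' {s | s ≤ t})) :=
        LinearIndependent.of_comp (Submodule.subtype _) hind
      simpa using h1.fintype_card_le_finrank
    have hmem' : toRat (relative p (q s₀)) ∈
        Submodule.span ℚ (Set.range fun s : Fin T.card => toRat (relative p (q (e s)))) := by
      have himage : Set.range (fun s : Fin T.card => toRat (relative p (q (e s)))) =
          (fun s => toRat (relative p (q s))) '' (T : Set ℕ) := by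
        ext x
        constructor
        · rintro ⟨s, rfl⟩; exact ⟨e s, (e s).2, rfl⟩
        · rintro ⟨s, hs, rfl⟩
          exact ⟨e.symm ⟨s, hs⟩, by simp⟩
      rw [himage]
      exact hmem
    have hT' : ∀ s : Fin (T.card + 1), (Fin.cons s₀ (fun s => (e s : ℕ)) : Fin (T.card + 1) → ℕ) s
        ∈ insert s₀ T := by
      intro s
      refine Fin.cases ?_ (fun s => ?_) s
      · simp
      · simp
    set idx : Fin (T.card + 1) → ℕ := Fin.cons s₀ (fun s => (e s : ℕ)) with hidx
    have hcons : (Fin.cons (relative p (q s₀)) (fun s => relative p (q (e s))) :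
        Fin (T.card + 1) → Fin m → ℤ) = fun s => relative p (q (idx s)) := by
      ext s
      refine Fin.cases ?_ (fun s => ?_) s <;> simp [hidx]
    have hdep := exists_int_relation hmem'
    rw [hcons] at hdep
    -- Since `|π(a)|²` is the energy minus the sum of the quadratic forms, and the conservation laws
    -- make the latter affine in `a` on each colour, a linear relation between displacements is
    -- inherited by the squared lengths.
    have key := hv.eq_of_relation hn hcard hr (g := fun s => relative p (q (idx s)))
      (fun s => h.small ht hI (hT _ (hT' s)).1) hind hdep
      (by
        intro c hc
        have hlin : ∀ j, ∑ s, c s * linForm (relative p (q (idx s))) (coords v j) = 0 := by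
          intro j
          have h1 : ∀ l, ∑ s, c s * relative p (q (idx s)) l = 0 := fun l => by
            simpa using congrFun hc l
          simp only [linForm, Finset.mul_sum, Int.cast_id]
          rw [Finset.sum_comm]
          refine Finset.sum_eq_zero fun l _ => ?_
          rw [← zero_mul (coords v j l), ← h1 l, Finset.sum_mul]
          exact Finset.sum_congr rfl fun s _ => by ring
        have hlin' : ∑ s, c s * ∑ j, site v p j *
            linForm (relative p (q (idx s))) (coords v j) = 0 := by
          simp only [Finset.mul_sum]
          rw [Finset.sum_comm]
          refine Finset.sum_eq_zero fun j _ => ?_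
          rw [← mul_zero (site v p j), ← hlin j, Finset.mul_sum]
          exact Finset.sum_congr rfl fun s _ => by ring
        have hen : ∑ s, c s * energy v (relative p (q (idx s))) = 0 := by
          have h1 : ∀ l, ∑ s, c s * relative p (q (idx s)) l = 0 := fun l => by
            simpa using congrFun hc l
          simp only [energy, Finset.mul_sum]
          rw [Finset.sum_comm]
          refine Finset.sum_eq_zero fun l _ => ?_
          rw [← zero_mul (v l ⬝ᵥ v l), ← h1 l, Finset.sum_mul]
          exact Finset.sum_congr rfl fun s _ => by ring
        have hnorm : ∀ a : Fin m → ℤ, ∑ j, linForm a (coords v j) ^ 2 =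
            energy v a - ∑ j, quadForm a (coords v j) := by
          intro a
          rw [sum_quadForm]
          simp only [dotProduct, momentum_apply, sq]
          ring
        by_cases hC : C
        · have hb : ∀ s, c s * ∑ j, linForm (relative p (q (idx s))) (coords v j) ^ 2 =
              c s * energy v (relative p (q (idx s))) - 2 * (c s * ∑ j, site v p j *
                linForm (relative p (q (idx s))) (coords v j)) := by
            intro s
            obtain ⟨h1, -, h2⟩ := hT _ (hT' s)
            rw [hnorm, ← (h.conserved _ h1).black (h2.2 hC)]
            ring
          simp only [hb, Finset.sum_sub_distrib, ← Finset.mul_sum, hen, hlin']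
          ring
        -- The red equations contain the constant `2|k|²`; it drops out because every red
        -- displacement has mass `2`, so a relation has `∑ c s = 0`.
        · have hsum : ∑ s, c s = 0 := by
            have h1 : ∑ l, ∑ s, c s * relative p (q (idx s)) l = 0 :=
              Finset.sum_eq_zero fun l _ => by simpa using congrFun hc l
            rw [Finset.sum_comm] at h1
            have h2 : ∀ s, ∑ l, c s * relative p (q (idx s)) l = 2 * c s := by
              intro s
              obtain ⟨h3, -, h4⟩ := hT _ (hT' s)
              rw [← Finset.mul_sum, (h.conserved _ h3).sum_red fun h0 => hC (h4.1 h0), mul_comm]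
            simp only [h2, ← Finset.mul_sum] at h1
            omega
          have hb : ∀ s, c s * ∑ j, linForm (relative p (q (idx s))) (coords v j) ^ 2 =
              c s * energy v (relative p (q (idx s))) - c s * (2 * ∑ j, site v p j * site v p j) +
              2 * (c s * ∑ j, site v p j *
                linForm (relative p (q (idx s))) (coords v j)) := by
            intro s
            obtain ⟨h1, -, h2⟩ := hT _ (hT' s)
            rw [hnorm, ← (h.conserved _ h1).red fun h0 => hC (h2.1 h0)]
            ring
          simp only [hb, Finset.sum_add_distrib, Finset.sum_sub_distrib]
          rw [hen, ← Finset.sum_mul, hsum, ← Finset.mul_sum, hlin']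
          ring)
    -- Either alternative repeats a vertex of the trail, except a zero displacement of red colour,
    -- which contradicts the mass `2`.
    rcases key with h0 | ⟨s, hs⟩
    · simp only [hidx, Fin.cons_zero] at h0
      by_cases hC : C
      · refine h00 (h.eq_of_relative h0t (Nat.zero_le t) ?_ ?_)
        · rw [h.zero]; simpa using h0C.2 hC
        · rw [h.zero, relative_self, h0]
      · have := (h.conserved _ h0t).sum_red fun h' => hC (h0C.1 h')
        rw [h0] at this
        simp at this
    · simp only [hidx, Fin.cons_zero, Fin.cons_succ] at hs
      obtain ⟨h1, -, h2⟩ := hT _ (Finset.mem_insert_of_mem (e s).2)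
      have := h.eq_of_relative h0t h1 (h0C.trans h2.symm) hs
      exact hs₀ (this ▸ (e s).2)

/-- The rank of a trail which starts at a normal site is at most `n`. -/
theorem IsTrail.finrank_le (hn : n ≠ 0) (hv : AvoidsResonances v) {p : Frequency m}
    (hp : site v p ∉ Set.range v)
    {q : ℕ → Frequency m} {t : ℕ} (h : IsTrail v p q t) (ht : t ≤ 2 * n + 1)
    {I : Finset (Fin m)} (hcard : I.card ≤ 2 * n + 2)
    (hI : ∀ s ≤ t, ∀ l, relative p (q s) l ≠ 0 → l ∈ I) :
    Module.finrank ℚ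
      (Submodule.span ℚ ((fun s => toRat (relative p (q s))) '' {s | s ≤ t})) ≠ n + 1 := by
  classical
  intro hrank
  obtain ⟨b, hbS, hspan, hbind⟩ := exists_linearIndependent ℚ
    ((fun s => toRat (relative p (q s))) '' {s | s ≤ t})
  have hbfin : b.Finite := hbind.setFinite
  have : Fintype b := hbfin.fintype
  have hbcard : Fintype.card b = n + 1 := by
    rw [← hrank, ← hspan, finrank_span_set_eq_card hbind, Set.toFinset_card]
  let e : Fin (n + 1) ≃ b := (Fintype.equivFinOfCardEq hbcard).symm
  choose idx hidx hidx' using fun s : Fin (n + 1) => hbS (e s).2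
  have hind : LinearIndependent ℚ fun s => toRat (relative p (q (idx s))) := by
    have hcomp : (fun s => toRat (relative p (q (idx s)))) = Subtype.val ∘ e := funext hidx'
    rw [hcomp]
    exact hbind.comp e e.injective
  apply hp
  by_cases hred : ∃ s, (q (idx s)).2 ≠ p.2
  · obtain ⟨s₀, hs₀⟩ := hred
    -- A red vertex is moved to position `0`: its sphere equation is the one subtracted from the
    -- others.
    let idx' : Fin (n + 1) → ℕ := fun s => idx (Equiv.swap 0 s₀ s)
    have hi' : ∀ s, idx' s ≤ t := fun s => hidx _
    have h0 : (q (idx' 0)).2 ≠ p.2 := by simpa [idx'] using hs₀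
    have hind' : LinearIndependent ℚ fun s => toRat (relative p (q (idx' s))) :=
      hind.comp (Equiv.swap 0 s₀) (Equiv.injective _)
    have hcons : (Fin.cons (relative p (q (idx' 0))) (fun s : Fin n => relative p (q (idx' s.succ)))
        : Fin (n + 1) → Fin m → ℤ) = fun s => relative p (q (idx' s)) := by
      ext s
      refine Fin.cases ?_ (fun s => ?_) s <;> simp
    obtain ⟨x, hx⟩ := hv.exists_site_of_red hn hcard (a := relative p (q (idx' 0)))
      (g := fun s => relative p (q (idx' s.succ)))
      (fun s => decide ((q (idx' s.succ)).2 ≠ p.2)) (h.small ht hI (hi' _))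
      (fun s => h.small ht hI (hi' _)) (by rw [hcons]; exact hind')
      ((h.conserved _ (hi' 0)).sum_red h0) ((h.conserved _ (hi' 0)).red h0)
      (fun s => by
        by_cases hs : (q (idx' s.succ)).2 ≠ p.2
        · rw [if_pos (by simpa using hs)]
          exact (h.conserved _ (hi' _)).red hs
        · rw [if_neg (by simpa using hs)]
          exact (h.conserved _ (hi' _)).black (not_not.1 hs))
    exact ⟨x, hx.symm⟩
  · push Not at hred
    obtain ⟨x, hx⟩ := hv.exists_site_of_black hn hcard (g := fun s => relative p (q (idx s)))
      (fun s => h.small ht hI (hidx _)) hind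
      (fun s => (h.conserved _ (hidx s)).sum_black (hred s))
      (fun s => (h.conserved _ (hidx s)).black (hred s))
    exact ⟨x, hx.symm⟩

end Injectivity

/-! ### Bounded length of paths and injectivity of the site map -/

section Injectivity

variable {n m : ℕ} {v : Fin m → Fin n → ℤ}

/-- Length, support and rank must be bounded together. The resonances apply to the next step only
while at most `2n + 2` sites and coefficients up to `2n + 2` occur; they then keep the rank at most
`n`, and this in turn bounds the support by `2n` and the length by `2n`. -/
theorem exists_support_of_path (hn : n ≠ 0) (hv : AvoidsResonances v) {p : Frequency m}
    (hp : site v p ∉ Set.range v) {q : ℕ → Frequency m} (h0 : q 0 = p) {L : ℕ}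
    (hadj : ∀ t < L, (combinatorialGraph v).Adj (q t) (q (t + 1)))
    (hinj : Set.InjOn q {s | s ≤ L}) (t : ℕ) (ht : t ≤ L) :
    t ≤ 2 * n ∧ IsTrail v p q t ∧ ∃ I : Finset (Fin m),
      (∀ s ≤ t, ∀ l, relative p (q s) l ≠ 0 → l ∈ I) ∧
      I.card ≤ 2 * Module.finrank ℚ
        (Submodule.span ℚ ((fun s => toRat (relative p (q s))) '' {s | s ≤ t})) ∧
      Module.finrank ℚ
        (Submodule.span ℚ ((fun s => toRat (relative p (q s))) '' {s | s ≤ t})) ≤ n := by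
  classical
  induction t with
  | zero =>
    have hset : {s : ℕ | s ≤ 0} = {0} := by ext; simp
    have hz : Submodule.span ℚ ((fun s => toRat (relative p (q s))) '' {s : ℕ | s ≤ 0}) = ⊥ := by
      rw [hset, Set.image_singleton, h0, relative_self]
      simp only [Submodule.span_singleton_eq_bot]
      ext i; simp [toRat]
    have hs0 : ∀ s ≤ 0, relative p (q s) = 0 := fun s hs => by
      rw [Nat.le_zero.1 hs, h0, relative_self]
    refine ⟨Nat.zero_le _, ⟨h0, fun s hs => ?_, fun s hs l => ?_, ?_⟩, ∅, fun s hs l hl => ?_,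
      Nat.zero_le _, ?_⟩
    · rw [Nat.le_zero.1 hs, h0]; exact Conserved.refl p
    · rw [hs0 s hs]; simp
    · rw [hset]; exact Set.injOn_singleton _ _
    · rw [hs0 s hs] at hl; exact absurd rfl hl
    · rw [hz, finrank_bot]; exact Nat.zero_le _
  | succ t ih =>
    obtain ⟨htn, htr, I, hI, hcard, hrank⟩ := ih (by omega)
    have hstep := hadj t (by omega)
    have hle : ∀ {s}, s ≤ t + 1 → s ≤ t ∨ s = t + 1 := fun {s} hs => by omega
    have htr' : IsTrail v p q (t + 1) := by
      refine ⟨h0, fun s hs => ?_, fun s hs l => ?_, hinj.mono fun s hs => hs.trans ht⟩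
      · rcases hle hs with hs | rfl
        · exact htr.conserved s hs
        · exact (htr.conserved t le_rfl).step hstep
      · rcases hle hs with hs | rfl
        · exact htr.bound s hs l
        · refine (abs_relative_step hstep l).trans ?_
          have := htr.bound t le_rfl l
          push_cast
          linarith
    set a : ℕ → Fin m → ℚ := fun s => toRat (relative p (q s)) with ha
    have hset : {s : ℕ | s ≤ t + 1} = insert (t + 1) {s | s ≤ t} := by
      ext s; simp only [Set.mem_ofPred_eq, Set.mem_insert_iff]; omega
    set V := Submodule.span ℚ (a '' {s | s ≤ t}) with hV
    have hV' : Submodule.span ℚ (a '' {s | s ≤ t + 1}) = Submodule.span ℚ {a (t + 1)} ⊔ V := by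
      rw [hset, Set.image_insert_eq, Submodule.span_insert]
    obtain ⟨I', hI', hcard'⟩ : ∃ I' : Finset (Fin m),
        (∀ s ≤ t + 1, ∀ l, relative p (q s) l ≠ 0 → l ∈ I') ∧
        I'.card ≤ 2 * Module.finrank ℚ (Submodule.span ℚ (a '' {s | s ≤ t + 1})) := by
      -- A displacement in the span of the previous ones uses no new index; otherwise the rank grows
      -- and pays for the two possible new indices.
      by_cases hmem : a (t + 1) ∈ V
      · refine ⟨I, fun s hs l hl => ?_, ?_⟩
        · rcases hle hs with hs | rfl
          · exact hI s hs l hl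
          · by_contra hlI
            have hker : V ≤ LinearMap.ker (LinearMap.proj l : (Fin m → ℚ) →ₗ[ℚ] ℚ) := by
              rw [hV, Submodule.span_le]
              rintro _ ⟨s, hs, rfl⟩
              by_contra hne
              exact hlI (hI s hs l fun h => hne (by simp [ha, toRat, h]))
            have := hker hmem
            simp only [ha, toRat, LinearMap.mem_ker, LinearMap.proj_apply, Int.cast_eq_zero] at this
            exact hl this
        · rw [hV', sup_eq_right.2 ((Submodule.span_singleton_le_iff_mem _ _).2 hmem)]
          exact hcard
      · obtain ⟨i, j, hij⟩ := support_relative_step (p := p) hstep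
        refine ⟨insert i (insert j I), fun s hs l hl => ?_, ?_⟩
        · rcases hle hs with hs | rfl
          · exact Finset.mem_insert_of_mem (Finset.mem_insert_of_mem (hI s hs l hl))
          · rcases hij l hl with h | rfl | rfl
            · exact Finset.mem_insert_of_mem (Finset.mem_insert_of_mem (hI t le_rfl l h))
            · simp
            · simp
        · have hlt : V < Submodule.span ℚ {a (t + 1)} ⊔ V := by
            refine lt_of_le_of_ne le_sup_right fun h => hmem ?_
            rw [h]
            exact Submodule.mem_sup_left (Submodule.mem_span_singleton_self _)
          have h1 := Submodule.finrank_lt_finrank_of_lt hlt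
          rw [hV']
          have h2 := Finset.card_insert_le i (insert j I)
          have h3 := Finset.card_insert_le j I
          omega
    have hfr : Module.finrank ℚ (Submodule.span ℚ (a '' {s | s ≤ t + 1})) ≤ n + 1 := by
      rw [hV']
      have h1 := Submodule.finrank_add_le_finrank_add_finrank (Submodule.span ℚ {a (t + 1)}) V
      have h2 := finrank_span_le_card (R := ℚ) ({a (t + 1)} : Set (Fin m → ℚ))
      simp only [Set.toFinset_singleton, Finset.card_singleton] at h2
      omega
    -- The rank has grown by at most one, so excluding the value `n + 1` keeps it at most `n`.
    have hne := htr'.finrank_le hn hv hp (by omega) (I := I') (by omega) hI'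
    have hfr' : Module.finrank ℚ (Submodule.span ℚ (a '' {s | s ≤ t + 1})) ≤ n := by
      have : Module.finrank ℚ (Submodule.span ℚ (a '' {s | s ≤ t + 1})) ≠ n + 1 := hne
      omega
    refine ⟨?_, htr', I', hI', hcard', hfr'⟩
    -- The vertices after the first are independent within each colour, so each colour contributes
    -- at most `n` of them.
    by_contra hlong
    have hcount : ∀ (C : Prop) (T : Finset ℕ),
        (∀ s ∈ T, s ≤ t + 1 ∧ s ≠ 0 ∧ ((q s).2 = p.2 ↔ C)) → T.card ≤ n := by
      intro C T hT
      have hind := htr'.linearIndepOn hn hv (by omega) (I := I') (by omega) hI' hfr' C T hT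
      refine le_trans ?_ hfr'
      have h1 : LinearIndependent ℚ fun s : T =>
          (⟨a s, Submodule.subset_span ⟨s, (hT _ s.2).1, rfl⟩⟩ :
            Submodule.span ℚ (a '' {s | s ≤ t + 1})) :=
        LinearIndependent.of_comp (Submodule.subtype _) hind
      simpa using h1.fintype_card_le_finrank
    let J := Finset.Icc 1 (t + 1)
    have hJ : J.card = t + 1 := by simp [J]
    have h1 := hcount True (J.filter fun s => (q s).2 = p.2) fun s hs => by
      simp only [J, Finset.mem_filter, Finset.mem_Icc] at hs
      exact ⟨hs.1.2, by omega, by simp [hs.2]⟩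
    have h2 := hcount False (J.filter fun s => ¬ (q s).2 = p.2) fun s hs => by
      simp only [J, Finset.mem_filter, Finset.mem_Icc] at hs
      exact ⟨hs.1.2, by omega, by simp [hs.2]⟩
    have h3 := Finset.card_filter_add_card_filter_not (s := J) (fun s => (q s).2 = p.2)
    omega

/-- The sites of the frequencies of a component, different from a normal frequency of the component,
are different from its site. -/
theorem AvoidsResonances.eq_of_site_eq (hn : n ≠ 0) (hv : AvoidsResonances v) {p : Frequency m}
    (hp : site v p ∉ Set.range v) {q : Frequency m} (hq : (combinatorialGraph v).Reachable p q)
    (hsite : site v q = site v p) : q = p := by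
  obtain ⟨w, hw⟩ := hq.exists_isPath
  obtain ⟨hlen, htr, I, hI, hcard, hrank⟩ := exists_support_of_path hn hv hp (q := w.getVert)
    w.getVert_zero (fun t ht => w.adj_getVert_succ ht) hw.getVert_injOn w.length le_rfl
  have hsmall := htr.small (by omega) hI le_rfl
  have hcons := htr.conserved _ le_rfl
  rw [w.getVert_length] at hsmall hcons
  have hI2 : I.card ≤ 2 * n + 2 := by omega
  -- With equal signs the displacement has momentum zero. With opposite signs it has momentum `2k`
  -- and energy `2|k|²`, hence `|π(a)|²` is twice the energy; then `a = 2e_x` and `k = v x` is not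
  -- normal.
  by_cases hc : q.2 = p.2
  · have hmom : momentum v (relative p q) = 0 := by
      have := site_of_black (v := v) hc
      rw [hsite] at this
      exact left_eq_add.1 this
    by_contra hne
    refine hv.norm_ne_zero hn hI2 hsmall (fun h => hne ?_) ?_
    · exact eq_of_relative (p := p) (by simp [hc]) (by rw [h, relative_self])
    · simp [← momentum_apply, hmom]
  · exfalso
    have hmom : momentum v (relative p q) = 2 • site v p := by
      have := site_of_red (v := v) hc
      rw [hsite] at this
      rw [two_smul]
      exact (neg_add_eq_iff_eq_add.1 this.symm)
    have hen := hcons.energy_red hc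
    rw [hsite] at hen
    obtain ⟨x, hx⟩ := hv.exists_double hn hI2 hsmall (hcons.sum_red hc) (by
      rw [Finset.sum_sub_distrib, ← Finset.mul_sum]
      have h1 : ∑ j, linForm (relative p q) (coords v j) ^ 2 =
          4 * (site v p ⬝ᵥ site v p) := by
        simp only [← momentum_apply, hmom, dotProduct, Finset.mul_sum, Pi.smul_apply]
        exact Finset.sum_congr rfl fun j _ => by rw [two_smul]; ring
      have h2 : ∑ j, ∑ i, relative p q i * v i j ^ 2 = energy v (relative p q) := by
        rw [Finset.sum_comm]
        simp only [energy, dotProduct, Finset.mul_sum, sq]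
      rw [h1, h2, ← hen]
      ring)
    apply hp
    refine ⟨x, funext fun j => ?_⟩
    have h3 := congrFun hmom j
    have h4 : linForm (Pi.single x 2) (coords v j) = 2 * v x j := by
      simp [linForm, Pi.single_apply, coords]
    rw [momentum_apply, hx, h4, Pi.smul_apply, nsmul_eq_mul] at h3
    push_cast at h3
    omega

end Injectivity

/-! ### The site map as an isomorphism of components -/

section Geometric

variable {n m : ℕ} {v : Fin m → Fin n → ℤ}

theorem toEuclid_injective : Function.Injective (toEuclid : (Fin n → ℤ) → _) := by
  intro a b h
  ext l
  have := congrArg (fun x : EuclideanSpace ℝ (Fin n) => x l) h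
  simpa [toEuclid] using this

theorem toEuclid_add (a b : Fin n → ℤ) : toEuclid (a + b) = toEuclid a + toEuclid b := by
  ext l; simp [toEuclid]

theorem toEuclid_sub (a b : Fin n → ℤ) : toEuclid (a - b) = toEuclid a - toEuclid b := by
  ext l; simp [toEuclid]

theorem norm_toEuclid_sq (a : Fin n → ℤ) : ‖toEuclid a‖ ^ 2 = ((a ⬝ᵥ a : ℤ) : ℝ) := by
  rw [EuclideanSpace.norm_sq_eq]
  simp [toEuclid, dotProduct, sq]

theorem geoBlack_iff {i j : Fin m} {a b : Fin n → ℤ} :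
    GeoBlack v i j (toEuclid a) (toEuclid b) ↔
      b - a = v j - v i ∧ b ⬝ᵥ b - a ⬝ᵥ a = v j ⬝ᵥ v j - v i ⬝ᵥ v i := by
  simp only [GeoBlack, ← toEuclid_sub, toEuclid_injective.eq_iff, norm_toEuclid_sq]
  norm_cast

theorem geoRed_iff {i j : Fin m} {a b : Fin n → ℤ} :
    GeoRed v i j (toEuclid a) (toEuclid b) ↔
      a + b = v i + v j ∧ a ⬝ᵥ a + b ⬝ᵥ b = v i ⬝ᵥ v i + v j ⬝ᵥ v j := by
  simp only [GeoRed, ← toEuclid_add, toEuclid_injective.eq_iff, norm_toEuclid_sq]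
  norm_cast

theorem GeoBlack.exists_int {i j : Fin m} {a : Fin n → ℤ} {b : EuclideanSpace ℝ (Fin n)}
    (h : GeoBlack v i j (toEuclid a) b) : b = toEuclid (a + v j - v i) := by
  rw [toEuclid_sub, toEuclid_add, add_sub_assoc, ← h.1]; abel

theorem GeoRed.exists_int {i j : Fin m} {a : Fin n → ℤ} {b : EuclideanSpace ℝ (Fin n)}
    (h : GeoRed v i j (toEuclid a) b) : b = toEuclid (v i + v j - a) := by
  rw [toEuclid_sub, toEuclid_add, ← h.1]; abel

theorem GeoBlack.symm {i j : Fin m} {a b : EuclideanSpace ℝ (Fin n)} (h : GeoBlack v i j a b) :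
    GeoBlack v j i b a := by
  refine ⟨by rw [← neg_sub, h.1, neg_sub], by have := h.2; linarith⟩

theorem GeoRed.symm {i j : Fin m} {a b : EuclideanSpace ℝ (Fin n)} (h : GeoRed v i j a b) :
    GeoRed v i j b a := ⟨by rw [add_comm, h.1], by have := h.2; linarith⟩

theorem site_add_sub (q : Frequency m) (i j : Fin m) (σ : ℤˣ) :
    site v (q.1 + unitVec i - unitVec j, σ) = site v q + v j - v i := by
  rw [site, site, momentum_sub, momentum_add, momentum_unitVec, momentum_unitVec]; abel

theorem site_neg_sub (q : Frequency m) (i j : Fin m) (σ : ℤˣ) :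
    site v (-q.1 - unitVec i - unitVec j, σ) = v i + v j - site v q := by
  rw [site, site, momentum_sub, momentum_sub, momentum_neg, momentum_unitVec, momentum_unitVec]
  abel

/-- The end of the black edge of `Λ_S` marked `(i, j)` which starts at `q`. -/
def blackEnd (q : Frequency m) (i j : Fin m) : Frequency m :=
  (q.1 + unitVec i - unitVec j, q.2)

/-- The end of the red edge of `Λ_S` marked `(i, j)` which starts at `q`. -/
def redEnd (q : Frequency m) (i j : Fin m) : Frequency m :=
  (-q.1 - unitVec i - unitVec j, -q.2)

theorem site_blackEnd (q : Frequency m) (i j : Fin m) :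
    site v (blackEnd q i j) = site v q + v j - v i := site_add_sub q i j _

theorem site_redEnd (q : Frequency m) (i j : Fin m) :
    site v (redEnd q i j) = v i + v j - site v q := site_neg_sub q i j _

theorem CombBlack.eq_end {i j : Fin m} {q q' : Frequency m} (h : CombBlack v i j q q') :
    q' = blackEnd q i j := Prod.ext h.2.1 h.1.symm

theorem CombRed.eq_end {i j : Fin m} {q q' : Frequency m} (h : CombRed v i j q q') :
    q' = redEnd q i j := by
  refine Prod.ext ?_ ?_
  · ext l
    have := congrFun h.2.1 l
    simp only [Pi.add_apply, Pi.zero_apply] at this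
    simp only [redEnd, Pi.sub_apply, Pi.neg_apply]
    linarith
  · rw [redEnd, h.1, neg_neg]

theorem combBlack_blackEnd {i j : Fin m} {q : Frequency m} :
    CombBlack v i j q (blackEnd q i j) ↔
      GeoBlack v i j (toEuclid (site v q)) (toEuclid (site v (blackEnd q i j))) := by
  rw [geoBlack_iff, CombBlack]
  constructor
  · rintro ⟨-, -, h⟩
    exact ⟨by rw [site_blackEnd]; abel, h⟩
  · rintro ⟨-, h⟩
    exact ⟨rfl, rfl, h⟩

theorem combRed_redEnd {i j : Fin m} {q : Frequency m} :
    CombRed v i j q (redEnd q i j) ↔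
      GeoRed v i j (toEuclid (site v q)) (toEuclid (site v (redEnd q i j))) := by
  rw [geoRed_iff, CombRed]
  constructor
  · rintro ⟨-, -, h⟩
    exact ⟨by rw [site_redEnd]; abel, h⟩
  · rintro ⟨-, h⟩
    refine ⟨(neg_neg _).symm, ?_, h⟩
    ext l
    simp only [redEnd, Pi.add_apply, Pi.sub_apply, Pi.neg_apply, Pi.zero_apply]
    ring

theorem CombBlack.geo {i j : Fin m} {q q' : Frequency m} (h : CombBlack v i j q q') :
    GeoBlack v i j (toEuclid (site v q)) (toEuclid (site v q')) := by
  have := h.eq_end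
  subst this
  exact combBlack_blackEnd.1 h

theorem CombRed.geo {i j : Fin m} {q q' : Frequency m} (h : CombRed v i j q q') :
    GeoRed v i j (toEuclid (site v q)) (toEuclid (site v q')) := by
  have := h.eq_end
  subst this
  exact combRed_redEnd.1 h

/-- The other end of a geometric edge is determined by its type and its first end, so edges lift;
together with the red case this makes the site map surjective on components. -/
theorem GeoBlack.lift {i j : Fin m} {q : Frequency m} {b : EuclideanSpace ℝ (Fin n)}
    (h : GeoBlack v i j (toEuclid (site v q)) b) :
    CombBlack v i j q (blackEnd q i j) ∧ toEuclid (site v (blackEnd q i j)) = b := by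
  have hb := h.exists_int
  rw [← site_blackEnd] at hb
  subst hb
  exact ⟨combBlack_blackEnd.2 h, rfl⟩

theorem GeoRed.lift {i j : Fin m} {q : Frequency m} {b : EuclideanSpace ℝ (Fin n)}
    (h : GeoRed v i j (toEuclid (site v q)) b) :
    CombRed v i j q (redEnd q i j) ∧ toEuclid (site v (redEnd q i j)) = b := by
  have hb := h.exists_int
  rw [← site_redEnd] at hb
  subst hb
  exact ⟨combRed_redEnd.2 h, rfl⟩

/-- The consequences of genericity which are used for the graphs. -/
structure GoodSites (v : Fin m → Fin n → ℤ) : Prop where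
  angle : ∀ x y z, x ≠ y → x ≠ z → (v y - v x) ⬝ᵥ (v z - v x) ≠ 0
  eq_of_site_eq : ∀ p q : Frequency m, site v p ∉ Set.range v →
    (combinatorialGraph v).Reachable p q → site v q = site v p → q = p

theorem GoodSites.injective (h : GoodSites v) : Function.Injective v := by
  intro x y hxy
  by_contra hne
  exact h.angle x y y hne hne (by simp [hxy])

theorem GoodSites.geometricGraph_adj (hv : GoodSites v) {a b : EuclideanSpace ℝ (Fin n)} :
    (geometricGraph v).Adj a b ↔
      ∃ i j : Fin m, i ≠ j ∧ (GeoBlack v i j a b ∨ GeoRed v i j a b) := by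
  rw [geometricGraph, SimpleGraph.fromRel_adj]
  constructor
  · rintro ⟨-, h | ⟨i, j, hij, h | h⟩⟩
    · exact h
    · exact ⟨j, i, hij.symm, Or.inl h.symm⟩
    · exact ⟨i, j, hij, Or.inr h.symm⟩
  · rintro ⟨i, j, hij, h⟩
    refine ⟨?_, Or.inl ⟨i, j, hij, h⟩⟩
    rintro rfl
    rcases h with h | h
    · have := h.1
      rw [sub_self, eq_comm, sub_eq_zero] at this
      exact hij (hv.injective (toEuclid_injective this)).symm
    -- A red loop at `a` would put `a` at the midpoint of `v i`, `v j` with `2|a|² = |v i|² + |v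
    -- j|²`; the parallelogram law then gives `v i = v j`.
    · have h1 := parallelogram_law_with_norm ℝ (toEuclid (v i)) (toEuclid (v j))
      rw [← h.1] at h1
      have h2 := h.2
      rw [← two_smul ℝ a, norm_smul, mul_pow] at h1
      have h3 : ‖toEuclid (v i) - toEuclid (v j)‖ ^ 2 = 0 := by
        norm_num at h1
        linarith
      have h4 := norm_eq_zero.1 (pow_eq_zero_iff two_ne_zero |>.1 h3)
      exact hij (hv.injective (toEuclid_injective (sub_eq_zero.1 h4)))

/-- An edge at `v x` of type `(i, j)` encodes a right angle: at `v i` for a black edge, at `v x` for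
a red one. Genericity excludes right angles between tangential sites, so only the obvious edges
remain. -/
theorem GoodSites.special_step (hv : GoodSites v) {x : Fin m} {b : EuclideanSpace ℝ (Fin n)}
    (h : (geometricGraph v).Adj (toEuclid (v x)) b) : ∃ y, toEuclid (v y) = b := by
  obtain ⟨i, j, hij, h | h⟩ := hv.geometricGraph_adj.1 h
  · have hb := h.exists_int
    subst hb
    rw [geoBlack_iff] at h
    by_cases hxi : x = i
    · subst hxi
      exact ⟨j, by congr 1; abel⟩
    · exfalso
      apply hv.angle i j x hij (Ne.symm hxi)
      have := h.2
      simp only [add_dotProduct, dotProduct_add, sub_dotProduct, dotProduct_sub] at this ⊢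
      rw [dotProduct_comm (v j) (v x), dotProduct_comm (v i) (v x),
        dotProduct_comm (v i) (v j)] at *
      linarith
  · have hb := h.exists_int
    subst hb
    rw [geoRed_iff] at h
    by_cases hxi : x = i
    · subst hxi
      exact ⟨j, by congr 1; abel⟩
    by_cases hxj : x = j
    · subst hxj
      exact ⟨i, by congr 1; abel⟩
    exfalso
    apply hv.angle x i j hxi hxj
    have := h.2
    simp only [add_dotProduct, dotProduct_add, sub_dotProduct, dotProduct_sub] at this ⊢
    rw [dotProduct_comm (v j) (v x), dotProduct_comm (v i) (v x),
      dotProduct_comm (v j) (v i)] at *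
    linarith

theorem GoodSites.special_component (hv : GoodSites v) (i : Fin m) :
    ((geometricGraph v).connectedComponentMk (toEuclid (v i))).supp =
      Set.range fun j => toEuclid (v j) := by
  ext b
  rw [SimpleGraph.ConnectedComponent.mem_supp_iff, SimpleGraph.ConnectedComponent.eq,
    SimpleGraph.reachable_comm]
  constructor
  · intro h
    obtain ⟨w⟩ := h
    have : ∀ (a b : EuclideanSpace ℝ (Fin n)), (geometricGraph v).Walk a b →
        (∃ y, toEuclid (v y) = a) → ∃ y, toEuclid (v y) = b := by
      intro a b w
      induction w with
      | nil => exact id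
      | cons h w ih =>
        rintro ⟨y, rfl⟩
        exact ih (hv.special_step h)
    exact this _ _ w ⟨i, rfl⟩
  · rintro ⟨j, rfl⟩
    by_cases hij : i = j
    · rw [hij]
    · exact (hv.geometricGraph_adj.2 ⟨i, j, hij, Or.inl ⟨rfl, rfl⟩⟩).reachable

theorem GoodSites.adj_geo (hv : GoodSites v) {p q : Frequency m}
    (h : (combinatorialGraph v).Adj p q) :
    (geometricGraph v).Adj (toEuclid (site v p)) (toEuclid (site v q)) := by
  obtain ⟨i, j, hij, h | h⟩ := combinatorialGraph_adj.1 h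
  · exact hv.geometricGraph_adj.2 ⟨i, j, hij, Or.inl h.geo⟩
  · exact hv.geometricGraph_adj.2 ⟨i, j, hij, Or.inr h.geo⟩

theorem GoodSites.lift_adj (hv : GoodSites v) {p : Frequency m} {b : EuclideanSpace ℝ (Fin n)}
    (h : (geometricGraph v).Adj (toEuclid (site v p)) b) :
    ∃ q, (combinatorialGraph v).Adj p q ∧ toEuclid (site v q) = b := by
  obtain ⟨i, j, hij, h | h⟩ := hv.geometricGraph_adj.1 h
  · exact ⟨_, combinatorialGraph_adj.2 ⟨i, j, hij, Or.inl h.lift.1⟩, h.lift.2⟩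
  · exact ⟨_, combinatorialGraph_adj.2 ⟨i, j, hij, Or.inr h.lift.1⟩, h.lift.2⟩

/-- The special component is closed under adjacency, so it cannot be entered from outside. -/
theorem GoodSites.normal_of_adj (hv : GoodSites v) {p q : Frequency m}
    (h : (combinatorialGraph v).Adj p q) (hp : site v p ∉ Set.range v) :
    site v q ∉ Set.range v := by
  rintro ⟨x, hx⟩
  have h1 := hv.adj_geo h.symm
  rw [← hx] at h1
  obtain ⟨y, hy⟩ := hv.special_step h1
  exact hp ⟨y, toEuclid_injective hy⟩

theorem GoodSites.normal_of_reachable (hv : GoodSites v) {p q : Frequency m}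
    (h : (combinatorialGraph v).Reachable p q) (hp : site v p ∉ Set.range v) :
    site v q ∉ Set.range v := by
  obtain ⟨w⟩ := h
  induction w with
  | nil => exact hp
  | cons h w ih => exact ih (hv.normal_of_adj h hp)

theorem GoodSites.reachable_geo (hv : GoodSites v) {p q : Frequency m}
    (h : (combinatorialGraph v).Reachable p q) :
    (geometricGraph v).Reachable (toEuclid (site v p)) (toEuclid (site v q)) := by
  obtain ⟨w⟩ := h
  induction w with
  | nil => rfl
  | cons h w ih => exact (hv.adj_geo h).reachable.trans ih

theorem GoodSites.lift_reachable (hv : GoodSites v) {p : Frequency m}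
    {b : EuclideanSpace ℝ (Fin n)} (h : (geometricGraph v).Reachable (toEuclid (site v p)) b) :
    ∃ q, (combinatorialGraph v).Reachable p q ∧ toEuclid (site v q) = b := by
  obtain ⟨w⟩ := h
  have : ∀ (a b : EuclideanSpace ℝ (Fin n)), (geometricGraph v).Walk a b →
      ∀ p, toEuclid (site v p) = a →
        ∃ q, (combinatorialGraph v).Reachable p q ∧ toEuclid (site v q) = b := by
    intro a b w
    induction w with
    | nil => exact fun p hp => ⟨p, SimpleGraph.Reachable.refl _, hp⟩
    | cons h w ih =>
      rintro p rfl
      obtain ⟨q, hq, hqb⟩ := hv.lift_adj h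
      obtain ⟨q', hq', hqb'⟩ := ih q hqb
      exact ⟨q', hq.reachable.trans hq', hqb'⟩
  exact this _ _ w p rfl

theorem GoodSites.unique (hv : GoodSites v) {p q q' : Frequency m} (hp : site v p ∉ Set.range v)
    (hq : (combinatorialGraph v).Reachable p q) (hq' : (combinatorialGraph v).Reachable p q')
    (h : site v q = site v q') : q = q' :=
  hv.eq_of_site_eq q' q (hv.normal_of_reachable hq' hp) (hq'.symm.trans hq) h

/-- Lifting gives surjectivity and uniqueness of lifts gives injectivity. A marked geometric edge
between two sites lifts to an edge of the same marking, whose end must be the given vertex because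
it lies over the same site. -/
theorem GoodSites.exists_iso (hv : GoodSites v) {p₀ : Frequency m}
    (hp₀ : site v p₀ ∉ Set.range v) :
    ∃ φ : (combinatorialGraph v).induce ((combinatorialGraph v).connectedComponentMk p₀).supp ≃g
        (geometricGraph v).induce
          ((geometricGraph v).connectedComponentMk (toEuclid (site v p₀))).supp,
      (∀ p, (φ p : EuclideanSpace ℝ (Fin n)) = toEuclid (site v p.1)) ∧
      ∀ p q, ∀ i j : Fin m, i ≠ j →
        (CombBlack v i j p.1 q.1 ↔ GeoBlack v i j (φ p).1 (φ q).1) ∧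
        (CombRed v i j p.1 q.1 ↔ GeoRed v i j (φ p).1 (φ q).1) := by
  have hmem : ∀ q : ((combinatorialGraph v).connectedComponentMk p₀).supp,
      (combinatorialGraph v).Reachable p₀ q := fun q =>
    (SimpleGraph.ConnectedComponent.eq.1 q.2).symm
  have hblack : ∀ (q q' : ((combinatorialGraph v).connectedComponentMk p₀).supp) (i j : Fin m),
      i ≠ j → (CombBlack v i j q.1 q'.1 ↔
        GeoBlack v i j (toEuclid (site v q.1)) (toEuclid (site v q'.1))) := by
    refine fun q q' i j hij => ⟨CombBlack.geo, fun h => ?_⟩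
    obtain ⟨h1, h2⟩ := h.lift
    have h3 := hv.unique hp₀ ((hmem q).trans
      (combinatorialGraph_adj.2 ⟨i, j, hij, Or.inl h1⟩).reachable) (hmem q') (toEuclid_injective h2)
    rwa [h3] at h1
  have hred : ∀ (q q' : ((combinatorialGraph v).connectedComponentMk p₀).supp) (i j : Fin m),
      i ≠ j → (CombRed v i j q.1 q'.1 ↔
        GeoRed v i j (toEuclid (site v q.1)) (toEuclid (site v q'.1))) := by
    refine fun q q' i j hij => ⟨CombRed.geo, fun h => ?_⟩
    obtain ⟨h1, h2⟩ := h.lift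
    have h3 := hv.unique hp₀ ((hmem q).trans
      (combinatorialGraph_adj.2 ⟨i, j, hij, Or.inr h1⟩).reachable) (hmem q') (toEuclid_injective h2)
    rwa [h3] at h1
  let f : ((combinatorialGraph v).connectedComponentMk p₀).supp →
      ((geometricGraph v).connectedComponentMk (toEuclid (site v p₀))).supp := fun q =>
    ⟨toEuclid (site v q.1), SimpleGraph.ConnectedComponent.eq.2 (hv.reachable_geo (hmem q)).symm⟩
  have hf : Function.Bijective f := by
    constructor
    · intro q q' h
      exact Subtype.ext (hv.unique hp₀ (hmem q) (hmem q')
        (toEuclid_injective (congrArg Subtype.val h)))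
    · rintro ⟨b, hb⟩
      obtain ⟨q, hq, hqb⟩ := hv.lift_reachable (SimpleGraph.ConnectedComponent.eq.1 hb).symm
      exact ⟨⟨q, SimpleGraph.ConnectedComponent.eq.2 hq.symm⟩, Subtype.ext hqb⟩
  refine ⟨⟨Equiv.ofBijective f hf, fun {q q'} => ?_⟩, fun q => rfl, fun q q' i j hij =>
    ⟨hblack q q' i j hij, hred q q' i j hij⟩⟩
  change (geometricGraph v).Adj (toEuclid (site v q.1)) (toEuclid (site v q'.1)) ↔
    (combinatorialGraph v).Adj q.1 q'.1
  rw [hv.geometricGraph_adj, combinatorialGraph_adj]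
  refine exists_congr fun i => exists_congr fun j => and_congr_right fun hij => ?_
  rw [hblack q q' i j hij, hred q q' i j hij]

end Geometric

/-! ### The Poisson bracket on monomials -/

section Poisson

variable {n m : ℕ} {v : Fin m → Fin n → ℤ}

theorem derivX_single (j : Fin m) (a : Exponent v) (c : ℂ) :
    derivX j (AddMonoidAlgebra.single a c : PoissonAlg v) =
      AddMonoidAlgebra.single a (Complex.I * (a.1 j : ℂ) * c) := by
  simp [derivX]

theorem derivY_single (j : Fin m) (a : Exponent v) (c : ℂ) :
    derivY j (AddMonoidAlgebra.single a c : PoissonAlg v) =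
      AddMonoidAlgebra.single (a.1, a.2.1 - Finsupp.single j 1, a.2.2) ((a.2.1 j : ℂ) * c) := by
  simp [derivY]

theorem derivW_single (k : NormalSite v) (σ : ℤˣ) (a : Exponent v) (c : ℂ) :
    derivW k σ (AddMonoidAlgebra.single a c : PoissonAlg v) =
      AddMonoidAlgebra.single (a.1, a.2.1, a.2.2 - Finsupp.single (k, σ) 1)
        ((a.2.2 (k, σ) : ℂ) * c) := by
  simp [derivW]

theorem derivX_add (j : Fin m) (F G : PoissonAlg v) :
    derivX j (F + G) = derivX j F + derivX j G := by
  rw [derivX, AddMonoidAlgebra.coeff_add, Finsupp.sum_add_index'] <;> simp [derivX, mul_add]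

theorem derivX_smul (j : Fin m) (c : ℂ) (F : PoissonAlg v) :
    derivX j (c • F) = c • derivX j F := by
  rw [derivX, AddMonoidAlgebra.coeff_smul, Finsupp.sum_smul_index'] <;>
    simp [derivX, Finsupp.smul_sum, mul_left_comm]

theorem derivY_add (j : Fin m) (F G : PoissonAlg v) :
    derivY j (F + G) = derivY j F + derivY j G := by
  rw [derivY, AddMonoidAlgebra.coeff_add, Finsupp.sum_add_index'] <;> simp [derivY, mul_add]

theorem derivY_smul (j : Fin m) (c : ℂ) (F : PoissonAlg v) :
    derivY j (c • F) = c • derivY j F := by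
  rw [derivY, AddMonoidAlgebra.coeff_smul, Finsupp.sum_smul_index'] <;>
    simp [derivY, Finsupp.smul_sum, mul_left_comm]

theorem derivW_add (k : NormalSite v) (σ : ℤˣ) (F G : PoissonAlg v) :
    derivW k σ (F + G) = derivW k σ F + derivW k σ G := by
  rw [derivW, AddMonoidAlgebra.coeff_add, Finsupp.sum_add_index'] <;> simp [derivW, mul_add]

theorem derivW_smul (k : NormalSite v) (σ : ℤˣ) (c : ℂ) (F : PoissonAlg v) :
    derivW k σ (c • F) = c • derivW k σ F := by
  rw [derivW, AddMonoidAlgebra.coeff_smul, Finsupp.sum_smul_index'] <;>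
    simp [derivW, Finsupp.smul_sum, mul_left_comm]

theorem finite_derivW_ne_zero (σ : ℤˣ) (F : PoissonAlg v) :
    {k : NormalSite v | derivW k σ F ≠ 0}.Finite := by
  refine Set.Finite.subset (F.coeff.support.finite_toSet.biUnion fun a _ =>
    (a.2.2.support.finite_toSet.image Prod.fst)) fun k hk => ?_
  by_contra hcon
  apply hk
  rw [derivW, Finsupp.sum]
  refine Finset.sum_eq_zero fun a ha => ?_
  have : a.2.2 (k, σ) = 0 := by
    by_contra h
    exact hcon (Set.mem_biUnion ha ⟨(k, σ), by simpa using h, rfl⟩)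
  simp [this]

theorem hasFiniteSupport_poisson (F G : PoissonAlg v) :
    (fun k : NormalSite v =>
      derivW k (-1) F * derivW k 1 G - derivW k 1 F * derivW k (-1) G).HasFiniteSupport := by
  refine Set.Finite.subset ((finite_derivW_ne_zero (-1) F).union (finite_derivW_ne_zero 1 F))
    fun k hk => ?_
  by_contra hcon
  simp only [Set.mem_union, Set.mem_ofPred_eq, not_or, not_not] at hcon
  apply hk
  simp [hcon.1, hcon.2]

theorem poisson_add (F G G' : PoissonAlg v) :
    poisson F (G + G') = poisson F G + poisson F G' := by
  simp only [poisson, derivX_add, derivY_add, derivW_add, mul_add, add_mul]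
  have h : ∀ k : NormalSite v, derivW k (-1) F * derivW k 1 G + derivW k (-1) F * derivW k 1 G' -
      (derivW k 1 F * derivW k (-1) G + derivW k 1 F * derivW k (-1) G') =
      (derivW k (-1) F * derivW k 1 G - derivW k 1 F * derivW k (-1) G) +
      (derivW k (-1) F * derivW k 1 G' - derivW k 1 F * derivW k (-1) G') := fun k => by abel
  simp only [h]
  rw [finsum_add_distrib (hasFiniteSupport_poisson F G) (hasFiniteSupport_poisson F G'), smul_add]
  simp only [Finset.sum_sub_distrib, Finset.sum_add_distrib]
  abel

theorem poisson_smul (F : PoissonAlg v) (c : ℂ) (G : PoissonAlg v) :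
    poisson F (c • G) = c • poisson F G := by
  simp only [poisson, derivX_smul, derivY_smul, derivW_smul, mul_smul_comm, smul_mul_assoc,
    ← smul_sub]
  rw [← smul_finsum' c (hasFiniteSupport_poisson F G), ← Finset.smul_sum, smul_add, smul_comm]

/-- The bracket of a `y`-independent monomial with an element of the frequency basis. -/
theorem poisson_single_freqElem (ν : Fin m → ℤ) (γ : NormalSite v × ℤˣ →₀ ℕ) (c : ℂ)
    (p : NormalFrequency v) :
    poisson (AddMonoidAlgebra.single (ν, 0, γ) c) (freqElem p) =
      AddMonoidAlgebra.single (ν + (p.1.2 : ℤ) • p.1.1, 0,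
        γ - Finsupp.single (⟨site v p.1, p.2⟩, -p.1.2) 1)
        (((p.1.2 : ℤ) : ℂ) * Complex.I * (γ (⟨site v p.1, p.2⟩, -p.1.2) : ℂ) * c) := by
  obtain ⟨⟨μ, σ⟩, hp⟩ := p
  set k₀ : NormalSite v := ⟨site v (μ, σ), hp⟩ with hk₀
  have hY : ∀ j, derivY j (AddMonoidAlgebra.single (ν, 0, γ) c : PoissonAlg v) = 0 := fun j => by
    simp [derivY_single]
  have hY' : ∀ j, derivY j (freqElem ⟨(μ, σ), hp⟩ : PoissonAlg v) = 0 := fun j => by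
    simp [freqElem, freqExponent, derivY_single]
  have hW : ∀ (k : NormalSite v) (s : ℤˣ), (k, s) ≠ (k₀, σ) →
      derivW k s (freqElem ⟨(μ, σ), hp⟩ : PoissonAlg v) = 0 := fun k s h => by
    rw [freqElem, derivW_single]
    have : (freqExponent ⟨(μ, σ), hp⟩ : Exponent v).2.2 (k, s) = 0 := by
      rw [freqExponent]
      exact Finsupp.single_eq_of_ne h
    simp [this]
  have hW' : derivW k₀ σ (freqElem ⟨(μ, σ), hp⟩ : PoissonAlg v) =
      AddMonoidAlgebra.single ((σ : ℤ) • μ, 0, 0) 1 := by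
    rw [freqElem, derivW_single]
    simp [freqExponent, hk₀]
  rw [poisson]
  simp only [hY, hY', zero_mul, sub_self, Finset.sum_const_zero, zero_add]
  rw [finsum_eq_single _ k₀ (fun k hk => by
    rw [hW k 1 (by simp [hk]), hW k (-1) (by simp [hk]), mul_zero, mul_zero, sub_zero])]
  rcases Int.units_eq_one_or σ with rfl | rfl
  · rw [hW', hW k₀ (-1) (by simp), mul_zero, sub_zero, derivW_single,
      AddMonoidAlgebra.single_mul_single, AddMonoidAlgebra.smul_single]
    congr 1
    · simp
    · simp [mul_assoc]
  · rw [hW', hW k₀ 1 (by simp), mul_zero, zero_sub, derivW_single,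
      AddMonoidAlgebra.single_mul_single, ← AddMonoidAlgebra.single_neg,
      AddMonoidAlgebra.smul_single]
    congr 1
    · simp
    · simp [mul_assoc]

/-- A quadratic monomial in the variables `z`, `z̄`. -/
theorem expX_mul_varW_mul_varW (c : ℂ) (ν : Fin m → ℤ) (h k : NormalSite v) (s s' : ℤˣ) :
    expX v c ν * varW h s * varW k s' =
      AddMonoidAlgebra.single (ν, 0, Finsupp.single (h, s) 1 + Finsupp.single (k, s') 1) c := by
  simp [expX, varW, AddMonoidAlgebra.single_mul_single]

theorem poisson_quadratic_eq_zero (c : ℂ) (ν : Fin m → ℤ) (h k : NormalSite v) (s s' : ℤˣ)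
    (p : NormalFrequency v) (h₁ : (h, s) ≠ (⟨site v p.1, p.2⟩, -p.1.2))
    (h₂ : (k, s') ≠ (⟨site v p.1, p.2⟩, -p.1.2)) :
    poisson (expX v c ν * varW h s * varW k s') (freqElem p) = 0 := by
  rw [expX_mul_varW_mul_varW, poisson_single_freqElem]
  simp [Finsupp.single_eq_of_ne h₁.symm, Finsupp.single_eq_of_ne h₂.symm]

theorem poisson_quadratic_left (c : ℂ) (ν : Fin m → ℤ) (h k : NormalSite v) (s s' : ℤˣ)
    (p q : NormalFrequency v) (h₁ : (h, s) = (⟨site v q.1, q.2⟩, q.1.2))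
    (h₂ : (k, s') = (⟨site v p.1, p.2⟩, -p.1.2)) (hne : (h, s) ≠ (k, s'))
    (hν : ν + (p.1.2 : ℤ) • p.1.1 = (q.1.2 : ℤ) • q.1.1) :
    poisson (expX v c ν * varW h s * varW k s') (freqElem p) =
      (((p.1.2 : ℤ) : ℂ) * Complex.I * c) • freqElem q := by
  rw [expX_mul_varW_mul_varW, poisson_single_freqElem, hν, ← h₂, freqElem,
    AddMonoidAlgebra.smul_single, freqExponent, ← h₁]
  congr 1
  · simp
  · simp [Finsupp.single_eq_of_ne hne.symm]

theorem poisson_quadratic_right (c : ℂ) (ν : Fin m → ℤ) (h k : NormalSite v) (s s' : ℤˣ)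
    (p q : NormalFrequency v) (h₁ : (k, s') = (⟨site v q.1, q.2⟩, q.1.2))
    (h₂ : (h, s) = (⟨site v p.1, p.2⟩, -p.1.2)) (hne : (h, s) ≠ (k, s'))
    (hν : ν + (p.1.2 : ℤ) • p.1.1 = (q.1.2 : ℤ) • q.1.1) :
    poisson (expX v c ν * varW h s * varW k s') (freqElem p) =
      (((p.1.2 : ℤ) : ℂ) * Complex.I * c) • freqElem q := by
  rw [← poisson_quadratic_left c ν k h s' s p q h₁ h₂ hne.symm hν, mul_right_comm]

theorem finsum_eq_sum_of_injective {T X M : Type*} [AddCommMonoid M] [Fintype X] {e : X → T}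
    (he : Function.Injective e) {f : T → M} (hf : ∀ t, f t ≠ 0 → t ∈ Set.range e) :
    ∑ᶠ t, f t = ∑ x, f (e x) := by
  rw [← finsum_eq_sum_of_fintype, ← finsum_mem_range he, ← finsum_mem_univ f]
  exact finsum_mem_inter_support_eq' f _ _ fun t ht => by simpa using hf t ht

theorem hasFiniteSupport_of_range {T X M : Type*} [Zero M] [Finite X] {e : X → T}
    {f : T → M} (hf : ∀ t, f t ≠ 0 → t ∈ Set.range e) : f.HasFiniteSupport :=
  (Set.finite_range e).subset hf

end Poisson

/-! ### The action of `ad(Q)` and `ad(N)` on the frequency basis -/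

section Operators

variable {n m : ℕ} {v : Fin m → Fin n → ℤ}

/-- The markings of the black edges which start at `p`. -/
abbrev BlackMark (v : Fin m → Fin n → ℤ) (p : Frequency m) : Type :=
  {x : Fin m × Fin m // x.1 ≠ x.2 ∧ CombBlack v x.1 x.2 p (blackEnd p x.1 x.2)}

/-- The markings of the red edges which start at `p`, each taken once. -/
abbrev RedMark (v : Fin m → Fin n → ℤ) (p : Frequency m) : Type :=
  {x : Fin m × Fin m // x.1 < x.2 ∧ CombRed v x.1 x.2 p (redEnd p x.1 x.2)}

noncomputable instance (p : Frequency m) : Fintype (BlackMark v p) := Fintype.ofFinite _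

noncomputable instance (p : Frequency m) : Fintype (RedMark v p) := Fintype.ofFinite _

/-- The neighbour of `p` along a black edge. -/
def GoodSites.blackNbr (hv : GoodSites v) (p : NormalFrequency v) (x : BlackMark v p.1) :
    NormalFrequency v :=
  ⟨blackEnd p.1 x.1.1 x.1.2, hv.normal_of_adj
    (combinatorialGraph_adj.2 ⟨_, _, x.2.1, Or.inl x.2.2⟩) p.2⟩

/-- The neighbour of `p` along a red edge. -/
def GoodSites.redNbr (hv : GoodSites v) (p : NormalFrequency v) (x : RedMark v p.1) :
    NormalFrequency v :=
  ⟨redEnd p.1 x.1.1 x.1.2, hv.normal_of_adj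
    (combinatorialGraph_adj.2 ⟨_, _, x.2.1.ne, Or.inr x.2.2⟩) p.2⟩

/-- The site of a normal frequency. -/
abbrev nsite (p : NormalFrequency v) : NormalSite v := ⟨site v p.1, p.2⟩

theorem GoodSites.site_blackNbr (hv : GoodSites v) (p : NormalFrequency v) (x : BlackMark v p.1) :
    (nsite (hv.blackNbr p x)).1 = site v p.1 + v x.1.2 - v x.1.1 := site_blackEnd _ _ _

theorem GoodSites.site_redNbr (hv : GoodSites v) (p : NormalFrequency v) (x : RedMark v p.1) :
    (nsite (hv.redNbr p x)).1 = v x.1.1 + v x.1.2 - site v p.1 := site_redEnd _ _ _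

/-- The terms `z_h z̄_k` of `Q`. -/
noncomputable def blackSummand (v : Fin m → Fin n → ℤ) (ξ : Fin m → ℝ) (t : BlackTerm v) :
    PoissonAlg v :=
  expX v ((4 * √(ξ t.1.1 * ξ t.1.2.1) : ℝ) : ℂ) (unitVec t.1.1 - unitVec t.1.2.1) *
      varW t.1.2.2.1 1 * varW t.1.2.2.2 (-1)

/-- The terms `z_h z_k` (for `s = 1`) and `z̄_h z̄_k` (for `s = -1`) of `Q`. -/
noncomputable def redSummand (v : Fin m → Fin n → ℤ) (ξ : Fin m → ℝ) (s : ℤˣ) (t : RedTerm v) :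
    PoissonAlg v :=
  expX v ((2 * √(ξ t.1.1 * ξ t.1.2.1) : ℝ) : ℂ) (-(s : ℤ) • (unitVec t.1.1 + unitVec t.1.2.1)) *
      varW t.1.2.2.1 s * varW t.1.2.2.2 s

theorem adQ_eq (ξ : Fin m → ℝ) (f : PoissonAlg v) :
    adQ v ξ f = (∑ᶠ t : BlackTerm v, poisson (blackSummand v ξ t) f) +
      (∑ᶠ t : RedTerm v, poisson (redSummand v ξ 1 t) f) +
      ∑ᶠ t : RedTerm v, poisson (redSummand v ξ (-1) t) f := by
  simp only [adQ, blackSummand, redSummand, Units.val_one, Units.val_neg, neg_neg, one_smul,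
    neg_smul]

/-- A term of `Q` acts on a frequency only through the variable conjugate to the frequency's own.
For sign `+` this is the factor `z̄_k` with `k` the site of `p`; for sign `-` it is `z_h`, and the
indices `i`, `j` exchange roles. -/
theorem exists_black_terms (hv : GoodSites v) (p : NormalFrequency v) :
    ∃ e : BlackMark v p.1 → BlackTerm v, Function.Injective e ∧
      (∀ (ξ : Fin m → ℝ) t, poisson (blackSummand v ξ t) (freqElem p) ≠ 0 → t ∈ Set.range e) ∧
      ∀ (ξ : Fin m → ℝ) x, poisson (blackSummand v ξ (e x)) (freqElem p) =
        (((p.1.2 : ℤ) : ℂ) * Complex.I * ((4 * √(ξ x.1.1 * ξ x.1.2) : ℝ) : ℂ)) •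
          freqElem (hv.blackNbr p x) := by
  rcases Int.units_eq_one_or p.1.2 with hσ | hσ
  · refine ⟨fun x => ⟨(x.1.1, x.1.2, nsite (hv.blackNbr p x), nsite p), x.2.1, ?_, ?_⟩, ?_, ?_, ?_⟩
    · rw [hv.site_blackNbr]; simp only; abel
    · have := x.2.2.2.2
      change site v (blackEnd _ _ _) ⬝ᵥ site v (blackEnd _ _ _) + _ = site v _ ⬝ᵥ site v _ + _
      simp only
      linarith
    · intro x y h
      have h1 := congrArg Subtype.val h
      simp only [Prod.mk.injEq] at h1
      exact Subtype.ext (Prod.ext h1.1 h1.2.1)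
    · intro ξ t ht
      obtain ⟨⟨i, j, h, k⟩, hij, h1, h2⟩ := t
      simp only at hij h1 h2
      by_cases hk : k = nsite p
      · subst hk
        have hh : h.1 = site v (blackEnd p.1 i j) := by
          rw [site_blackEnd, eq_sub_iff_add_eq]; exact h1
        refine ⟨⟨(i, j), hij, rfl, rfl, ?_⟩, ?_⟩
        · simp only
          rw [← hh]
          simp only at h2
          linarith
        · apply Subtype.ext
          simp only [Prod.mk.injEq, true_and, and_true]
          exact Subtype.ext hh.symm
      · exfalso
        apply ht
        apply poisson_quadratic_eq_zero
        · simp [hσ]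
        · simp [hσ, hk]
    · intro ξ x
      apply poisson_quadratic_left
      · simp [GoodSites.blackNbr, blackEnd, hσ]
      · simp [hσ]
      · simp
      · simp only [hσ, GoodSites.blackNbr, blackEnd]; simp; abel
  · refine ⟨fun x => ⟨(x.1.2, x.1.1, nsite p, nsite (hv.blackNbr p x)), x.2.1.symm, ?_, ?_⟩,
      ?_, ?_, ?_⟩
    · rw [hv.site_blackNbr]; simp only; abel
    · have := x.2.2.2.2
      change site v _ ⬝ᵥ site v _ + _ = site v (blackEnd _ _ _) ⬝ᵥ site v (blackEnd _ _ _) + _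
      simp only
      linarith
    · intro x y h
      have h1 := congrArg Subtype.val h
      simp only [Prod.mk.injEq] at h1
      exact Subtype.ext (Prod.ext h1.2.1 h1.1)
    · intro ξ t ht
      obtain ⟨⟨j, i, h, k⟩, hij, h1, h2⟩ := t
      simp only at hij h1 h2
      by_cases hk : h = nsite p
      · subst hk
        have hh : k.1 = site v (blackEnd p.1 i j) := by
          rw [site_blackEnd, eq_sub_iff_add_eq]; exact h1.symm
        refine ⟨⟨(i, j), hij.symm, rfl, rfl, ?_⟩, ?_⟩
        · simp only
          rw [← hh]
          simp only at h2
          linarith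
        · apply Subtype.ext
          simp only [Prod.mk.injEq, true_and]
          exact Subtype.ext hh.symm
      · exfalso
        apply ht
        apply poisson_quadratic_eq_zero
        · simp [hσ, hk]
        · simp [hσ]
    · intro ξ x
      rw [mul_comm (ξ x.1.1)]
      apply poisson_quadratic_right
      · simp [GoodSites.blackNbr, blackEnd, hσ]
      · simp [hσ]
      · simp
      · simp only [hσ, GoodSites.blackNbr, blackEnd]; simp; abel

theorem poisson_redSummand_self (ξ : Fin m → ℝ) (p : NormalFrequency v) (t : RedTerm v) :
    poisson (redSummand v ξ p.1.2 t) (freqElem p) = 0 := by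
  apply poisson_quadratic_eq_zero <;>
  · intro h
    exact unit_ne_neg _ (Prod.ext_iff.1 h).2

/-- In the sum over `i < j` each pair of sites occurs in both orders, recorded by the `Bool`. The
orders differ because a red edge at a normal site is not a loop. -/
theorem exists_red_terms (hv : GoodSites v) (p : NormalFrequency v) :
    ∃ e : RedMark v p.1 × Bool → RedTerm v, Function.Injective e ∧
      (∀ (ξ : Fin m → ℝ) t, poisson (redSummand v ξ (-p.1.2) t) (freqElem p) ≠ 0 →
        t ∈ Set.range e) ∧
      ∀ (ξ : Fin m → ℝ) x, poisson (redSummand v ξ (-p.1.2) (e x)) (freqElem p) =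
        (((p.1.2 : ℤ) : ℂ) * Complex.I * ((2 * √(ξ x.1.1.1 * ξ x.1.1.2) : ℝ) : ℂ)) •
          freqElem (hv.redNbr p x.1) := by
  have hne : ∀ x : RedMark v p.1, nsite p ≠ nsite (hv.redNbr p x) := by
    intro x h
    have h1 := hv.adj_geo (combinatorialGraph_adj.2 ⟨_, _, x.2.1.ne, Or.inr x.2.2⟩)
    exact h1.ne (congrArg toEuclid (congrArg Subtype.val h))
  have h1 : ∀ x : RedMark v p.1, (nsite p).1 + (nsite (hv.redNbr p x)).1 = v x.1.1 + v x.1.2 :=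
    fun x => by rw [hv.site_redNbr]; simp only; abel
  have h2 : ∀ x : RedMark v p.1, (nsite p).1 ⬝ᵥ (nsite p).1 +
      (nsite (hv.redNbr p x)).1 ⬝ᵥ (nsite (hv.redNbr p x)).1 =
        v x.1.1 ⬝ᵥ v x.1.1 + v x.1.2 ⬝ᵥ v x.1.2 := fun x => x.2.2.2.2
  let e₁ : RedMark v p.1 → RedTerm v := fun x =>
    ⟨(x.1.1, x.1.2, nsite (hv.redNbr p x), nsite p), x.2.1,
      by rw [add_comm]; exact h1 x, by rw [add_comm]; exact h2 x⟩
  let e₀ : RedMark v p.1 → RedTerm v := fun x =>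
    ⟨(x.1.1, x.1.2, nsite p, nsite (hv.redNbr p x)), x.2.1, h1 x, h2 x⟩
  refine ⟨fun x => bif x.2 then e₁ x.1 else e₀ x.1, ?_, ?_, ?_⟩
  · rintro ⟨x, b⟩ ⟨y, b'⟩ h
    have h3 : x.1.1 = y.1.1 ∧ x.1.2 = y.1.2 := by
      cases b <;> cases b' <;>
      · have h4 := Prod.ext_iff.1 (congrArg Subtype.val h)
        exact ⟨h4.1, (Prod.ext_iff.1 h4.2).1⟩
    have hx : x = y := Subtype.ext (Prod.ext h3.1 h3.2)
    subst hx
    cases b <;> cases b'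
    · rfl
    · exact absurd (congrArg (fun t : RedTerm v => t.1.2.2.1) h) (hne x)
    · exact absurd (congrArg (fun t : RedTerm v => t.1.2.2.1) h).symm (hne x)
    · rfl
  · intro ξ t ht
    obtain ⟨⟨i, j, h, k⟩, hij, e1, e2⟩ := t
    simp only at hij e1 e2
    by_cases hk : k = nsite p
    · subst hk
      have hh : h.1 = site v (redEnd p.1 i j) := by
        rw [site_redEnd, eq_sub_iff_add_eq]; exact e1
      refine ⟨(⟨(i, j), hij, combRed_redEnd.2 (geoRed_iff.2 ⟨?_, ?_⟩)⟩, true), ?_⟩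
      · rw [← hh, add_comm]; exact e1
      · rw [← hh, add_comm]; exact e2
      · exact Subtype.ext (Prod.ext rfl (Prod.ext rfl (Prod.ext (Subtype.ext hh.symm) rfl)))
    by_cases hk' : h = nsite p
    · subst hk'
      have hh : k.1 = site v (redEnd p.1 i j) := by
        rw [site_redEnd, eq_sub_iff_add_eq, add_comm]; exact e1
      refine ⟨(⟨(i, j), hij, combRed_redEnd.2 (geoRed_iff.2 ⟨?_, ?_⟩)⟩, false), ?_⟩
      · rw [← hh]; exact e1
      · rw [← hh]; exact e2
      · exact Subtype.ext (Prod.ext rfl (Prod.ext rfl (Prod.ext rfl (Subtype.ext hh.symm))))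
    exfalso
    apply ht
    apply poisson_quadratic_eq_zero
    · simp [hk']
    · simp [hk]
  · rintro ξ ⟨x, b⟩
    have hν : (-((-p.1.2 : ℤˣ) : ℤ)) • (unitVec x.1.1 + unitVec x.1.2) + (p.1.2 : ℤ) • p.1.1 =
        (((hv.redNbr p x).1.2 : ℤˣ) : ℤ) • (hv.redNbr p x).1.1 := by
      ext l
      simp [GoodSites.redNbr, redEnd]
      ring
    cases b
    · apply poisson_quadratic_right
      · rfl
      · rfl
      · intro h; exact hne x (Prod.ext_iff.1 h).1
      · exact hν
    · apply poisson_quadratic_left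
      · rfl
      · rfl
      · intro h; exact hne x (Prod.ext_iff.1 h).1.symm
      · exact hν

/-- The action of `ad(Q)` on the frequency basis. -/
theorem GoodSites.adQ_freqElem (hv : GoodSites v) (ξ : Fin m → ℝ) (p : NormalFrequency v) :
    adQ v ξ (freqElem p) =
      ∑ x : BlackMark v p.1, (((p.1.2 : ℤ) : ℂ) * Complex.I *
        ((4 * √(ξ x.1.1 * ξ x.1.2) : ℝ) : ℂ)) • freqElem (hv.blackNbr p x) +
      ∑ x : RedMark v p.1, (((p.1.2 : ℤ) : ℂ) * Complex.I *
        ((4 * √(ξ x.1.1 * ξ x.1.2) : ℝ) : ℂ)) • freqElem (hv.redNbr p x) := by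
  obtain ⟨e, he, hs, hval⟩ := exists_black_terms hv p
  obtain ⟨e', he', hs', hval'⟩ := exists_red_terms hv p
  rw [adQ_eq, finsum_eq_sum_of_injective he (hs ξ)]
  have hred : (∑ᶠ t : RedTerm v, poisson (redSummand v ξ 1 t) (freqElem p)) +
      ∑ᶠ t : RedTerm v, poisson (redSummand v ξ (-1) t) (freqElem p) =
      ∑ᶠ t : RedTerm v, poisson (redSummand v ξ (-p.1.2) t) (freqElem p) := by
    have h0 := poisson_redSummand_self ξ p
    rcases Int.units_eq_one_or p.1.2 with hσ | hσ
    · rw [hσ] at h0 ⊢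
      simp [h0]
    · rw [hσ] at h0 ⊢
      simp [h0]
  rw [add_assoc, hred, finsum_eq_sum_of_injective he' (hs' ξ), Fintype.sum_prod_type]
  congr 1
  · exact Finset.sum_congr rfl fun x _ => hval ξ x
  · refine Finset.sum_congr rfl fun x _ => ?_
    -- The two orders of the sites turn the coefficient `2` of the red terms into `4`, the same as
    -- for the black ones.
    rw [Fintype.sum_bool, hval', hval', ← add_smul]
    congr 1
    push_cast
    ring

theorem Omega_smul_eq (ξ : Fin m → ℝ) (k : NormalSite v) :
    (Omega ξ k : ℂ) • (varW k 1 * varW k (-1) : PoissonAlg v) =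
      AddMonoidAlgebra.single (0, 0, Finsupp.single (k, 1) 1 + Finsupp.single (k, -1) 1)
        (Omega ξ k : ℂ) := by
  simp [varW, AddMonoidAlgebra.single_mul_single, AddMonoidAlgebra.smul_single]

theorem poisson_Omega_smul_eq_zero (ξ : Fin m → ℝ) (p : NormalFrequency v) {k : NormalSite v}
    (hk : k ≠ nsite p) :
    poisson ((Omega ξ k : ℂ) • (varW k 1 * varW k (-1))) (freqElem p) = 0 := by
  rw [Omega_smul_eq, poisson_single_freqElem]
  have : (k, (1 : ℤˣ)) ≠ (nsite p, -p.1.2) ∧ (k, (-1 : ℤˣ)) ≠ (nsite p, -p.1.2) := by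
    simp [hk]
  simp [Finsupp.single_eq_of_ne this.1.symm, Finsupp.single_eq_of_ne this.2.symm]

/-- The diagonal part of `ad(N)` multiplies the elements of the frequency basis by scalars. -/
theorem exists_adN_freqElem (ξ : Fin m → ℝ) (p : NormalFrequency v) :
    ∃ d : ℂ, adN v ξ (freqElem p) = d • freqElem p + adQ v ξ (freqElem p) := by
  have h1 : ∀ i, ∃ d : ℂ, poisson ((omega v ξ i : ℂ) • varY v i) (freqElem p) =
      d • freqElem p := by
    intro i
    refine ⟨omega v ξ i * (Complex.I * (((p.1.2 : ℤ) • p.1.1) i : ℤ)), ?_⟩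
    have hY : ∀ j, derivY j (freqElem p : PoissonAlg v) = 0 := fun j => by
      simp [freqElem, freqExponent, derivY_single]
    have hW : ∀ (k : NormalSite v) (s : ℤˣ), derivW k s (varY v i) = 0 := fun k s => by
      simp [varY, derivW_single]
    simp only [poisson, derivY_smul, derivW_smul, hY, hW, smul_zero, zero_mul, sub_zero,
      finsum_zero, add_zero]
    rw [Finset.sum_eq_single i]
    · rw [varY, derivY_single, freqElem, derivX_single, smul_mul_assoc,
        AddMonoidAlgebra.single_mul_single, AddMonoidAlgebra.smul_single,
        AddMonoidAlgebra.smul_single]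
      congr 1
      · simp
      · simp [freqExponent]
    · intro j _ hj
      rw [varY, derivY_single]
      simp [hj]
    · intro h; exact absurd (Finset.mem_univ _) h
  have h2 : ∃ d : ℂ, ∑ᶠ k : NormalSite v,
      poisson ((Omega ξ k : ℂ) • (varW k 1 * varW k (-1))) (freqElem p) = d • freqElem p := by
    rw [finsum_eq_single _ (nsite p)]
    · refine ⟨((p.1.2 : ℤ) : ℂ) * Complex.I * (Omega ξ (nsite p) : ℂ), ?_⟩
      rw [Omega_smul_eq, poisson_single_freqElem, freqElem, AddMonoidAlgebra.smul_single]
      rcases Int.units_eq_one_or p.1.2 with hσ | hσ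
      · congr 1
        · simp [freqExponent, hσ]
        · simp [hσ]
      · congr 1
        · simp [freqExponent, hσ]
        · simp [hσ]
    · exact fun k hk => poisson_Omega_smul_eq_zero ξ p hk
  choose d hd using h1
  obtain ⟨d', hd'⟩ := h2
  refine ⟨∑ i, d i + d', ?_⟩
  rw [adN, hd', add_smul, Finset.sum_smul]
  simp only [hd]

end Operators

/-! ### Linearity of the operators on the frequency space -/

section Linearity

variable {n m : ℕ} {v : Fin m → Fin n → ℤ}

/-- The space spanned by the frequency basis. -/
noncomputable def freqSpan (v : Fin m → Fin n → ℤ) : Submodule ℂ (PoissonAlg v) :=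
  Submodule.span ℂ (Set.range freqElem)

theorem poisson_zero (F : PoissonAlg v) : poisson F 0 = 0 := by
  simpa using poisson_smul F 0 0

theorem hasFiniteSupport_poisson_of_mem_freqSpan {T : Type*} {F : T → PoissonAlg v}
    (hF : ∀ p : NormalFrequency v, (fun t => poisson (F t) (freqElem p)).HasFiniteSupport)
    {f : PoissonAlg v} (hf : f ∈ freqSpan v) :
    (fun t => poisson (F t) f).HasFiniteSupport := by
  induction hf using Submodule.span_induction with
  | mem x hx =>
    obtain ⟨p, rfl⟩ := hx
    exact hF p
  | zero => simp [poisson_zero, Function.HasFiniteSupport]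
  | add x y _ _ hx hy =>
    refine Set.Finite.subset (hx.union hy) fun t ht => ?_
    by_contra hcon
    simp only [Set.mem_union, Function.mem_support, not_or, not_not] at hcon
    exact ht (by simp [poisson_add, hcon.1, hcon.2])
  | smul c x _ hx =>
    refine Set.Finite.subset hx fun t ht h => ht ?_
    simp only at h
    simp [poisson_smul, h]

/-- A `finsum` of infinite support is `0` by convention, so additivity needs finite supports; these
hold on the span of the frequency basis. -/
theorem finsum_poisson_add {T : Type*} {F : T → PoissonAlg v}
    (hF : ∀ p : NormalFrequency v, (fun t => poisson (F t) (freqElem p)).HasFiniteSupport)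
    {f g : PoissonAlg v} (hf : f ∈ freqSpan v) (hg : g ∈ freqSpan v) :
    ∑ᶠ t, poisson (F t) (f + g) = ∑ᶠ t, poisson (F t) f + ∑ᶠ t, poisson (F t) g := by
  simp only [poisson_add]
  exact finsum_add_distrib (hasFiniteSupport_poisson_of_mem_freqSpan hF hf)
    (hasFiniteSupport_poisson_of_mem_freqSpan hF hg)

theorem finsum_poisson_smul {T : Type*} {F : T → PoissonAlg v}
    (hF : ∀ p : NormalFrequency v, (fun t => poisson (F t) (freqElem p)).HasFiniteSupport)
    (c : ℂ) {f : PoissonAlg v} (hf : f ∈ freqSpan v) :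
    ∑ᶠ t, poisson (F t) (c • f) = c • ∑ᶠ t, poisson (F t) f := by
  simp only [poisson_smul]
  exact (smul_finsum' c (hasFiniteSupport_poisson_of_mem_freqSpan hF hf)).symm

theorem GoodSites.hasFiniteSupport_black (hv : GoodSites v) (ξ : Fin m → ℝ)
    (p : NormalFrequency v) :
    (fun t => poisson (blackSummand v ξ t) (freqElem p)).HasFiniteSupport :=
  have ⟨_, _, hs, _⟩ := exists_black_terms hv p
  hasFiniteSupport_of_range (hs ξ)

theorem GoodSites.hasFiniteSupport_red (hv : GoodSites v) (ξ : Fin m → ℝ) (s : ℤˣ)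
    (p : NormalFrequency v) :
    (fun t => poisson (redSummand v ξ s t) (freqElem p)).HasFiniteSupport := by
  by_cases h : s = p.1.2
  · subst h
    simp [poisson_redSummand_self, Function.HasFiniteSupport]
  · have hs : s = -p.1.2 := by
      rcases Int.units_eq_one_or s with rfl | rfl <;>
        rcases Int.units_eq_one_or p.1.2 with h' | h' <;> simp_all
    subst hs
    obtain ⟨_, _, hs, _⟩ := exists_red_terms hv p
    exact hasFiniteSupport_of_range (hs ξ)

theorem hasFiniteSupport_Omega (ξ : Fin m → ℝ) (p : NormalFrequency v) :
    (fun k : NormalSite v =>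
      poisson ((Omega ξ k : ℂ) • (varW k 1 * varW k (-1))) (freqElem p)).HasFiniteSupport :=
  (Set.finite_singleton (nsite p)).subset fun k hk => by
    by_contra h
    exact hk (poisson_Omega_smul_eq_zero ξ p h)

theorem GoodSites.adQ_add (hv : GoodSites v) (ξ : Fin m → ℝ) {f g : PoissonAlg v}
    (hf : f ∈ freqSpan v) (hg : g ∈ freqSpan v) :
    adQ v ξ (f + g) = adQ v ξ f + adQ v ξ g := by
  simp only [adQ_eq, finsum_poisson_add (hv.hasFiniteSupport_black ξ) hf hg,
    finsum_poisson_add (hv.hasFiniteSupport_red ξ _) hf hg]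
  abel

theorem GoodSites.adQ_smul (hv : GoodSites v) (ξ : Fin m → ℝ) (c : ℂ) {f : PoissonAlg v}
    (hf : f ∈ freqSpan v) : adQ v ξ (c • f) = c • adQ v ξ f := by
  simp only [adQ_eq, finsum_poisson_smul (hv.hasFiniteSupport_black ξ) c hf,
    finsum_poisson_smul (hv.hasFiniteSupport_red ξ _) c hf, smul_add]

theorem GoodSites.adN_add (hv : GoodSites v) (ξ : Fin m → ℝ) {f g : PoissonAlg v}
    (hf : f ∈ freqSpan v) (hg : g ∈ freqSpan v) :
    adN v ξ (f + g) = adN v ξ f + adN v ξ g := by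
  rw [adN, hv.adQ_add ξ hf hg, finsum_poisson_add (hasFiniteSupport_Omega ξ) hf hg]
  simp only [poisson_add, Finset.sum_add_distrib, adN]
  abel

theorem GoodSites.adN_smul (hv : GoodSites v) (ξ : Fin m → ℝ) (c : ℂ) {f : PoissonAlg v}
    (hf : f ∈ freqSpan v) : adN v ξ (c • f) = c • adN v ξ f := by
  rw [adN, hv.adQ_smul ξ c hf, finsum_poisson_smul (hasFiniteSupport_Omega ξ) c hf]
  simp only [poisson_smul, ← Finset.smul_sum, ← smul_add, adN]

/-- The operators on the frequency space which differ from `ad(Q)` by a diagonal operator. -/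
structure IsHopping (T : (Fin m → ℝ) → PoissonAlg v → PoissonAlg v) : Prop where
  apply_add : ∀ ξ f g, f ∈ freqSpan v → g ∈ freqSpan v → T ξ (f + g) = T ξ f + T ξ g
  apply_smul : ∀ ξ (c : ℂ) f, f ∈ freqSpan v → T ξ (c • f) = c • T ξ f
  apply_freqElem : ∀ ξ p, ∃ d : ℂ, T ξ (freqElem p) = d • freqElem p + adQ v ξ (freqElem p)

theorem GoodSites.isHopping_adQ (hv : GoodSites v) : IsHopping (adQ v) :=
  ⟨fun ξ _ _ hf hg => hv.adQ_add ξ hf hg, fun ξ c _ hf => hv.adQ_smul ξ c hf,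
    fun _ _ => ⟨0, by simp⟩⟩

theorem GoodSites.isHopping_adN (hv : GoodSites v) : IsHopping (adN v) :=
  ⟨fun ξ _ _ hf hg => hv.adN_add ξ hf hg, fun ξ c _ hf => hv.adN_smul ξ c hf,
    fun ξ p => exists_adN_freqElem ξ p⟩

end Linearity

/-! ### At most one neighbour for each pair of indices -/

section Marks

variable {n m : ℕ} {v : Fin m → Fin n → ℤ}

/-- The markings of the edges of the combinatorial graph which start at `p`. -/
abbrev Mark (v : Fin m → Fin n → ℤ) (p : Frequency m) : Type := BlackMark v p ⊕ RedMark v p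

/-- The pair of indices of a marking. -/
def Mark.idx {p : Frequency m} : Mark v p → Fin m × Fin m
  | Sum.inl x => x.1
  | Sum.inr x => x.1

/-- The neighbour of `p` along an edge. -/
def GoodSites.nbr (hv : GoodSites v) (p : NormalFrequency v) : Mark v p.1 → NormalFrequency v
  | Sum.inl x => hv.blackNbr p x
  | Sum.inr x => hv.redNbr p x

theorem Mark.idx_ne {p : Frequency m} (x : Mark v p) : x.idx.1 ≠ x.idx.2 := by
  rcases x with x | x
  · exact x.2.1
  · exact x.2.1.ne

theorem GoodSites.nbr_spec (hv : GoodSites v) (p : NormalFrequency v) (x : Mark v p.1) :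
    CombBlack v x.idx.1 x.idx.2 p.1 (hv.nbr p x).1 ∨
      CombRed v x.idx.1 x.idx.2 p.1 (hv.nbr p x).1 := by
  rcases x with x | x
  · exact Or.inl x.2.2
  · exact Or.inr x.2.2

theorem GoodSites.adj_iff (hv : GoodSites v) {p q : NormalFrequency v} :
    (combinatorialGraph v).Adj p.1 q.1 ↔ ∃ x : Mark v p.1, hv.nbr p x = q := by
  constructor
  · intro h
    obtain ⟨i, j, hij, h | h⟩ := combinatorialGraph_adj.1 h
    · have hq := h.eq_end
      rw [hq] at h
      exact ⟨Sum.inl ⟨(i, j), hij, h⟩, Subtype.ext hq.symm⟩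
    · rcases lt_or_gt_of_ne hij with hlt | hlt
      · have hq := h.eq_end
        rw [hq] at h
        exact ⟨Sum.inr ⟨(i, j), hlt, h⟩, Subtype.ext hq.symm⟩
      · have h' := h.swap
        have hq := h'.eq_end
        rw [hq] at h'
        exact ⟨Sum.inr ⟨(j, i), hlt, h'⟩, Subtype.ext hq.symm⟩
  · rintro ⟨x, rfl⟩
    exact combinatorialGraph_adj.2 ⟨_, _, x.idx_ne, hv.nbr_spec p x⟩

/-- A black edge exists where the site lies on the hyperplane through `v i` orthogonal to `v j - v
i`; for a red edge it lies on the sphere with diameter `v i`, `v j`. -/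
theorem CombBlack.inner_eq_zero {i j : Fin m} {p q : Frequency m} (h : CombBlack v i j p q) :
    (site v p - v i) ⬝ᵥ (v j - v i) = 0 := by
  have h1 := h.2.2
  rw [h.eq_end, site_blackEnd] at h1
  simp only [add_dotProduct, dotProduct_add, sub_dotProduct, dotProduct_sub] at h1 ⊢
  rw [dotProduct_comm (v j) (site v p), dotProduct_comm (v i) (site v p),
    dotProduct_comm (v j) (v i)] at *
  linarith

theorem CombRed.inner_eq_zero {i j : Fin m} {p q : Frequency m} (h : CombRed v i j p q) :
    (site v p - v i) ⬝ᵥ (site v p - v j) = 0 := by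
  have h1 := h.2.2
  rw [h.eq_end, site_redEnd] at h1
  simp only [add_dotProduct, dotProduct_add, sub_dotProduct, dotProduct_sub] at h1 ⊢
  rw [dotProduct_comm (v j) (site v p), dotProduct_comm (v i) (site v p),
    dotProduct_comm (v j) (v i)] at *
  linarith

/-- A vertex with a normal site has at most one edge for each unordered pair of indices. -/
theorem CombBlack.not_combRed {i j : Fin m} {p q q' : Frequency m}
    (h : CombBlack v i j p q)
    (hp : site v p ∉ Set.range v) : ¬CombRed v i j p q' := by
  intro h'
  have h1 := h.inner_eq_zero
  have h2 := h'.inner_eq_zero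
  have h3 : (site v p - v i) ⬝ᵥ (site v p - v i) = 0 := by
    have : site v p - v i = (site v p - v j) + (v j - v i) := by abel
    have h3 := dotProduct_add (site v p - v i) (site v p - v j) (v j - v i)
    rw [← this] at h3
    linarith
  exact hp ⟨i, (sub_eq_zero.1 (dotProduct_self_eq_zero.1 h3)).symm⟩

/-- The hyperplanes orthogonal to `v j - v i` through `v i` and through `v j` are parallel and
distinct. -/
theorem GoodSites.black_not_black (hv : GoodSites v) {i j : Fin m} (hij : i ≠ j)
    {p q q' : Frequency m} (h : CombBlack v i j p q) (h' : CombBlack v j i p q') : False := by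
  have h1 := h.inner_eq_zero
  have h2 := h'.inner_eq_zero
  have h3 : (v j - v i) ⬝ᵥ (v j - v i) = 0 := by
    simp only [sub_dotProduct, dotProduct_sub] at h1 h2 ⊢
    rw [dotProduct_comm (v j) (v i)] at *
    linarith
  exact hij (hv.injective (sub_eq_zero.1 (dotProduct_self_eq_zero.1 h3)).symm)

/-- The hyperplane through `v i` meets the sphere only at `v i`, which is not normal, so both the
colour and the orientation of the edge are determined by the unordered pair. This makes separation
by the weights `√(ξᵢξⱼ)` possible. -/
theorem GoodSites.nbr_eq_nbr (hv : GoodSites v) (p : NormalFrequency v) {x y : Mark v p.1}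
    (h : s(x.idx.1, x.idx.2) = s(y.idx.1, y.idx.2)) : hv.nbr p x = hv.nbr p y := by
  have hxy := x.idx_ne
  rcases Sym2.eq_iff.1 h with ⟨h1, h2⟩ | ⟨h1, h2⟩ <;>
    rcases hv.nbr_spec p x with hx | hx <;> rcases hv.nbr_spec p y with hy | hy <;>
    rw [h1, h2] at hx hxy
  · exact Subtype.ext (hx.eq_end.trans hy.eq_end.symm)
  · exact absurd hy (hx.not_combRed p.2)
  · exact absurd hx (hy.not_combRed p.2)
  · exact Subtype.ext (hx.eq_end.trans hy.eq_end.symm)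
  · exact (hv.black_not_black hxy hx hy).elim
  · exact absurd hy.swap (hx.not_combRed p.2)
  · exact absurd hx.swap (hy.not_combRed p.2)
  · exact Subtype.ext (hx.swap.eq_end.trans hy.eq_end.symm)

theorem GoodSites.adQ_freqElem_eq_sum (hv : GoodSites v) (ξ : Fin m → ℝ)
    (p : NormalFrequency v) :
    adQ v ξ (freqElem p) = (((p.1.2 : ℤ) : ℂ) * Complex.I * 4) •
      ∑ x : Mark v p.1, ((√(ξ x.idx.1 * ξ x.idx.2) : ℝ) : ℂ) • freqElem (hv.nbr p x) := by
  rw [hv.adQ_freqElem, Fintype.sum_sum_type, smul_add, Finset.smul_sum, Finset.smul_sum]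
  congr 1 <;>
  · refine Finset.sum_congr rfl fun x _ => ?_
    rw [smul_smul]
    push_cast
    rw [mul_assoc _ (4 : ℂ)]
    rfl

end Marks

/-! ### Matrix entries and invariant subspaces -/

section Blocks

variable {n m : ℕ} {v : Fin m → Fin n → ℤ}

theorem freqExponent_injective :
    Function.Injective (freqExponent : NormalFrequency v → Exponent v) := by
  intro p q h
  have h1 : (p.1.2 : ℤ) • p.1.1 = (q.1.2 : ℤ) • q.1.1 := congrArg Prod.fst h
  have h2 : (nsite p, p.1.2) = (nsite q, q.1.2) :=
    Finsupp.single_left_injective one_ne_zero (congrArg (fun a : Exponent v => a.2.2) h)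
  have h3 : p.1.2 = q.1.2 := (Prod.ext_iff.1 h2).2
  rw [h3] at h1
  refine Subtype.ext (Prod.ext ?_ h3)
  rcases Int.units_eq_one_or q.1.2 with hσ | hσ
  · simpa [hσ] using h1
  · simpa [hσ] using h1

theorem coeff_freqElem (p q : NormalFrequency v) :
    (freqElem p).coeff (freqExponent q) = if p = q then 1 else 0 := by
  rw [freqElem, AddMonoidAlgebra.coeff_single, Finsupp.single_apply]
  simp only [freqExponent_injective.eq_iff]

/-- The coefficient of an element of the frequency basis. -/
noncomputable def freqCoeff (q : NormalFrequency v) : PoissonAlg v →ₗ[ℂ] ℂ where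
  toFun f := f.coeff (freqExponent q)
  map_add' f g := by simp
  map_smul' c f := by simp

theorem freqCoeff_freqElem (p q : NormalFrequency v) :
    freqCoeff q (freqElem p) = if p = q then 1 else 0 := coeff_freqElem p q

theorem linearIndependent_freqElem :
    LinearIndependent ℂ (freqElem : NormalFrequency v → PoissonAlg v) :=
  LinearIndependent.of_pairwise_dual_eq_zero_one _ freqCoeff
    (fun p q h => (freqCoeff_freqElem q p).trans (if_neg h.symm))
    (fun p => (freqCoeff_freqElem p p).trans (if_pos rfl))

theorem freqCoeff_eq_zero {U : Set (NormalFrequency v)} {q : NormalFrequency v} (hq : q ∉ U)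
    {f : PoissonAlg v} (hf : f ∈ Submodule.span ℂ (freqElem '' U)) : freqCoeff q f = 0 := by
  induction hf using Submodule.span_induction with
  | mem x hx =>
    obtain ⟨p, hp, rfl⟩ := hx
    rw [freqCoeff_freqElem, if_neg]
    rintro rfl
    exact hq hp
  | zero => exact map_zero _
  | add x y _ _ hx hy => rw [map_add, hx, hy, add_zero]
  | smul c x _ hx => rw [map_smul, hx, smul_zero]

/-- The off-diagonal entries of the operators. -/
theorem IsHopping.freqCoeff_ne_zero_iff {T : (Fin m → ℝ) → PoissonAlg v → PoissonAlg v}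
    (hT : IsHopping T) (hv : GoodSites v) {ξ : Fin m → ℝ} (hξ : ∀ i, 0 < ξ i)
    {p q : NormalFrequency v} (hpq : p ≠ q) :
    freqCoeff q (T ξ (freqElem p)) ≠ 0 ↔ (combinatorialGraph v).Adj p.1 q.1 := by
  obtain ⟨d, hd⟩ := hT.apply_freqElem ξ p
  have hσ : ((p.1.2 : ℤ) : ℂ) * Complex.I * 4 ≠ 0 := by
    rcases Int.units_eq_one_or p.1.2 with h | h <;> simp [h]
  have hsum : ∑ x : Mark v p.1, ((√(ξ x.idx.1 * ξ x.idx.2) : ℝ) : ℂ) *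
      (if hv.nbr p x = q then 1 else 0) = ((∑ x : Mark v p.1, √(ξ x.idx.1 * ξ x.idx.2) *
      (if hv.nbr p x = q then 1 else 0) : ℝ) : ℂ) := by
    push_cast
    exact Finset.sum_congr rfl fun x _ => by split_ifs <;> simp
  -- Up to one common nonzero factor the contributions to an entry are nonnegative, so they cannot
  -- cancel.
  have hnn : ∀ x ∈ (Finset.univ : Finset (Mark v p.1)), 0 ≤ √(ξ x.idx.1 * ξ x.idx.2) *
      (if hv.nbr p x = q then 1 else 0) := fun x _ => by positivity
  rw [hd, hv.adQ_freqElem_eq_sum]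
  simp only [map_add, map_smul, map_sum, freqCoeff_freqElem, if_neg hpq, smul_eq_mul, mul_zero,
    zero_add]
  rw [hsum, mul_ne_zero_iff, and_iff_right hσ, Complex.ofReal_ne_zero, Ne,
    Finset.sum_eq_zero_iff_of_nonneg hnn, hv.adj_iff]
  push Not
  refine exists_congr fun x => ?_
  have : √(ξ x.idx.1 * ξ x.idx.2) ≠ 0 := (Real.sqrt_pos.2 (mul_pos (hξ _) (hξ _))).ne'
  simp [this]

/-- A space spanned by elements of the frequency basis is invariant if it is closed under passing
to neighbours in the graph. -/
theorem IsHopping.mem_span {T : (Fin m → ℝ) → PoissonAlg v → PoissonAlg v}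
    (hT : IsHopping T) (hv : GoodSites v) {U : Set (NormalFrequency v)}
    (hU : ∀ p q : NormalFrequency v, p ∈ U → (combinatorialGraph v).Adj p.1 q.1 → q ∈ U)
    (ξ : Fin m → ℝ) {f : PoissonAlg v} (hf : f ∈ Submodule.span ℂ (freqElem '' U)) :
    T ξ f ∈ Submodule.span ℂ (freqElem '' U) := by
  have hle : Submodule.span ℂ (freqElem '' U) ≤ freqSpan v :=
    Submodule.span_mono (Set.image_subset_range _ _)
  induction hf using Submodule.span_induction with
  | mem x hx =>
    obtain ⟨p, hp, rfl⟩ := hx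
    obtain ⟨d, hd⟩ := hT.apply_freqElem ξ p
    rw [hd, hv.adQ_freqElem_eq_sum]
    refine add_mem (Submodule.smul_mem _ _ (Submodule.subset_span ⟨p, hp, rfl⟩))
      (Submodule.smul_mem _ _ (Submodule.sum_mem _ fun x _ => Submodule.smul_mem _ _
        (Submodule.subset_span ⟨_, hU p _ hp (hv.adj_iff.2 ⟨x, rfl⟩), rfl⟩)))
  | zero =>
    have := hT.apply_smul ξ 0 0 (zero_mem _)
    rw [zero_smul, zero_smul] at this
    rw [this]
    exact zero_mem _
  | add x y hx hy hx' hy' =>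
    rw [hT.apply_add ξ x y (hle hx) (hle hy)]
    exact add_mem hx' hy'
  | smul c x hx hx' =>
    rw [hT.apply_smul ξ c x (hle hx)]
    exact Submodule.smul_mem _ _ hx'

/-- The parameters `ξ` used to separate the markings: the square roots of two of them are `a` and
`b`, all the others are `1`. -/
def testParam (i j : Fin m) (a b : ℝ) (l : Fin m) : ℝ :=
  if l = i then a else if l = j then b else 1

theorem testParam_pos (i j : Fin m) {a b : ℝ} (ha : 0 < a) (hb : 0 < b) (l : Fin m) :
    0 < testParam i j a b l := by
  unfold testParam
  split_ifs <;> first | assumption | exact one_pos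

/-- The second difference of the weights isolates the markings with a given pair of indices. -/
theorem testParam_difference {i j l l' : Fin m} (hij : i ≠ j) (hl : l ≠ l') :
    testParam i j 2 2 l * testParam i j 2 2 l' - testParam i j 2 1 l * testParam i j 2 1 l' -
      testParam i j 1 2 l * testParam i j 1 2 l' + testParam i j 1 1 l * testParam i j 1 1 l' =
      if s(l, l') = s(i, j) then 1 else 0 := by
  simp only [testParam, Sym2.eq_iff]
  by_cases h1 : l = i <;> by_cases h2 : l = j <;> by_cases h3 : l' = i <;>
    by_cases h4 : l' = j <;> simp_all <;> norm_num

end Blocks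

/-! ### Generating a block from a single frequency -/

section Generation

variable {n m : ℕ} {v : Fin m → Fin n → ℤ} {T : (Fin m → ℝ) → PoissonAlg v → PoissonAlg v}

theorem IsHopping.exists_apply_sq (hT : IsHopping T) (hv : GoodSites v) {s : Fin m → ℝ}
    (hs : ∀ l, 0 < s l) (p : NormalFrequency v) :
    ∃ d : ℂ, T (fun l => s l ^ 2) (freqElem p) = d • freqElem p +
      (((p.1.2 : ℤ) : ℂ) * Complex.I * 4) •
        ∑ x : Mark v p.1, ((s x.idx.1 * s x.idx.2 : ℝ) : ℂ) • freqElem (hv.nbr p x) := by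
  obtain ⟨d, hd⟩ := hT.apply_freqElem (fun l => s l ^ 2) p
  refine ⟨d, ?_⟩
  rw [hd, hv.adQ_freqElem_eq_sum]
  congr 2
  refine Finset.sum_congr rfl fun x _ => ?_
  rw [← mul_pow, Real.sqrt_sq (mul_pos (hs _) (hs _)).le]

/-- A subspace which contains an element of the frequency basis and all its transforms contains
the neighbours of that element. -/
theorem IsHopping.freqElem_mem_of_adj (hT : IsHopping T) (hv : GoodSites v)
    {W : Submodule ℂ (PoissonAlg v)} {p q : NormalFrequency v} (hp : freqElem p ∈ W)
    (hW : ∀ ξ : Fin m → ℝ, (∀ i, 0 < ξ i) → T ξ (freqElem p) ∈ W)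
    (hpq : (combinatorialGraph v).Adj p.1 q.1) : freqElem q ∈ W := by
  obtain ⟨x₀, rfl⟩ := hv.adj_iff.1 hpq
  set i := x₀.idx.1
  set j := x₀.idx.2
  set c : ℂ := ((p.1.2 : ℤ) : ℂ) * Complex.I * 4 with hc
  have hc0 : c ≠ 0 := by
    rcases Int.units_eq_one_or p.1.2 with h | h <;> simp [hc, h]
  have key : ∀ a b : ℝ, 0 < a → 0 < b →
      ∑ x : Mark v p.1, ((testParam i j a b x.idx.1 * testParam i j a b x.idx.2 : ℝ) : ℂ) •
        freqElem (hv.nbr p x) ∈ W := by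
    intro a b ha hb
    have hs := testParam_pos i j ha hb
    obtain ⟨d, hd⟩ := hT.exists_apply_sq hv hs p
    have h1 := hW (fun l => testParam i j a b l ^ 2) fun l => pow_pos (hs l) 2
    rw [hd] at h1
    exact (Submodule.smul_mem_iff _ hc0).1
      ((Submodule.add_mem_iff_right _ (Submodule.smul_mem _ _ hp)).1 h1)
  -- After removal of the diagonal term, which lies in `W`, the second difference in `√ξᵢ`, `√ξⱼ`
  -- retains only the markings with the pair `{i, j}`, and these all lead to the same neighbour.
  have h1 := add_mem (sub_mem (sub_mem (key 2 2 two_pos two_pos) (key 2 1 two_pos one_pos))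
    (key 1 2 one_pos two_pos)) (key 1 1 one_pos one_pos)
  rw [← Finset.sum_sub_distrib, ← Finset.sum_sub_distrib, ← Finset.sum_add_distrib] at h1
  have h2 : ∀ x ∈ (Finset.univ : Finset (Mark v p.1)),
      ((testParam i j 2 2 x.idx.1 * testParam i j 2 2 x.idx.2 : ℝ) : ℂ) • freqElem (hv.nbr p x) -
      ((testParam i j 2 1 x.idx.1 * testParam i j 2 1 x.idx.2 : ℝ) : ℂ) • freqElem (hv.nbr p x) -
      ((testParam i j 1 2 x.idx.1 * testParam i j 1 2 x.idx.2 : ℝ) : ℂ) • freqElem (hv.nbr p x) +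
      ((testParam i j 1 1 x.idx.1 * testParam i j 1 1 x.idx.2 : ℝ) : ℂ) • freqElem (hv.nbr p x) =
      (if s(x.idx.1, x.idx.2) = s(i, j) then (1 : ℂ) else 0) • freqElem (hv.nbr p x₀) := by
    intro x _
    rw [← sub_smul, ← sub_smul, ← add_smul, ← Complex.ofReal_sub, ← Complex.ofReal_sub,
      ← Complex.ofReal_add, testParam_difference x₀.idx_ne x.idx_ne]
    split_ifs with h
    · rw [hv.nbr_eq_nbr p h, Complex.ofReal_one]
    · simp
  rw [Finset.sum_congr rfl h2, ← Finset.sum_smul, Finset.sum_boole] at h1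
  refine (Submodule.smul_mem_iff _ ?_).1 h1
  -- What remains is a multiple of the neighbour by the number of such markings, which is positive
  -- since `x₀` is one of them.
  rw [Nat.cast_ne_zero, Finset.card_ne_zero]
  exact ⟨x₀, by simp [i, j]⟩

/-- The vertices of the combinatorial graph which are connected to `p`. -/
def reachableSet (p : NormalFrequency v) : Set (NormalFrequency v) :=
  {q | (combinatorialGraph v).Reachable p.1 q.1}

theorem freqElem_mem_of_mem_reachableSet (hv : GoodSites v) {W : Submodule ℂ (PoissonAlg v)}
    (hW : ∀ p q : NormalFrequency v, freqElem p ∈ W → (combinatorialGraph v).Adj p.1 q.1 →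
      freqElem q ∈ W) {p q : NormalFrequency v} (hp : freqElem p ∈ W) (hq : q ∈ reachableSet p) :
    freqElem q ∈ W := by
  obtain ⟨w⟩ := hq
  have : ∀ (a b : Frequency m), (combinatorialGraph v).Walk a b → ∀ (ha : site v a ∉ Set.range v)
      (hb : site v b ∉ Set.range v), freqElem ⟨a, ha⟩ ∈ W → freqElem ⟨b, hb⟩ ∈ W := by
    intro a b w
    induction w with
    | nil => exact fun _ _ h => h
    | cons h w ih =>
      exact fun ha hb h' => ih (hv.normal_of_adj h ha) hb (hW _ _ h' h)
  exact this _ _ w p.2 q.2 hp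

/-- The block of a frequency is spanned by the frequencies of its connected component. -/
theorem IsHopping.block_eq (hT : IsHopping T) (hv : GoodSites v) (p : NormalFrequency v) :
    block T (freqElem p) = Submodule.span ℂ (freqElem '' reachableSet p) := by
  have hle : block T (freqElem p) ≤ Submodule.span ℂ (freqElem '' reachableSet p) := by
    refine Submodule.span_le.2 fun g hg => ?_
    induction hg with
    | base => exact Submodule.subset_span ⟨p, SimpleGraph.Reachable.refl _, rfl⟩
    | step ξ g hξ _ ih =>
      exact hT.mem_span hv (fun q q' hq h => hq.trans h.reachable) ξ ih
  refine le_antisymm hle (Submodule.span_le.2 ?_)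
  rintro _ ⟨q, hq, rfl⟩
  have hspan : block T (freqElem p) ≤ freqSpan v :=
    hle.trans (Submodule.span_mono (Set.image_subset_range _ _))
  -- Transforms are stable under the operators by definition; linearity, available inside the
  -- frequency space, extends this to their span.
  have hinv : ∀ ξ : Fin m → ℝ, (∀ i, 0 < ξ i) → ∀ f ∈ block T (freqElem p),
      T ξ f ∈ block T (freqElem p) := by
    intro ξ hξ f hf
    rw [block] at hf
    induction hf using Submodule.span_induction with
    | mem x hx => exact Submodule.subset_span (IsTransform.step ξ x hξ hx)
    | zero =>
      have := hT.apply_smul ξ 0 0 (zero_mem _)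
      rw [zero_smul, zero_smul] at this
      rw [this]
      exact zero_mem _
    | add x y hx hy hx' hy' =>
      rw [hT.apply_add ξ x y (hspan hx) (hspan hy)]
      exact add_mem hx' hy'
    | smul c x hx hx' =>
      rw [hT.apply_smul ξ c x (hspan hx)]
      exact Submodule.smul_mem _ _ hx'
  exact freqElem_mem_of_mem_reachableSet hv
    (fun q q' hq h => hT.freqElem_mem_of_adj hv hq (fun ξ hξ => hinv ξ hξ _ hq) h)
    (Submodule.subset_span IsTransform.base) hq

/-- The block is the smallest invariant space spanned by elements of the frequency basis. -/
theorem IsHopping.block_le (hT : IsHopping T) (hv : GoodSites v) {p : NormalFrequency v}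
    {ξ : Fin m → ℝ} (hξ : ∀ i, 0 < ξ i) {U : Set (NormalFrequency v)} (hp : p ∈ U)
    (hU : ∀ f ∈ Submodule.span ℂ (freqElem '' U), T ξ f ∈ Submodule.span ℂ (freqElem '' U)) :
    block T (freqElem p) ≤ Submodule.span ℂ (freqElem '' U) := by
  rw [hT.block_eq hv, Submodule.span_le]
  rintro _ ⟨q, hq, rfl⟩
  -- For a span of basis elements, membership of a basis element is membership of its index; hence a
  -- nonzero entry at fixed `ξ` already forces the neighbour into `U`.
  have hmem : ∀ q : NormalFrequency v, freqElem q ∈ Submodule.span ℂ (freqElem '' U) → q ∈ U := by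
    intro q hq
    by_contra h
    have := freqCoeff_eq_zero h hq
    rw [freqCoeff_freqElem, if_pos rfl] at this
    exact one_ne_zero this
  refine freqElem_mem_of_mem_reachableSet hv (fun q q' hq h => ?_)
    (Submodule.subset_span ⟨p, hp, rfl⟩) hq
  refine Submodule.subset_span ⟨q', ?_, rfl⟩
  by_contra hq'
  have hne : q ≠ q' := by
    rintro rfl
    exact h.ne rfl
  exact (hT.freqCoeff_ne_zero_iff hv hξ hne).2 h (freqCoeff_eq_zero hq' (hU _ hq))

/-- The block has a basis indexed by the vertices of the geometric component. -/
theorem IsHopping.exists_basis (hT : IsHopping T) (hv : GoodSites v) (p : NormalFrequency v) :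
    ∃ b : Module.Basis
        ((geometricGraph v).connectedComponentMk (toEuclid (site v p.1))).supp ℂ
        (block T (freqElem p)),
      ∀ x, ∃ q : NormalFrequency v, (combinatorialGraph v).Reachable p.1 q.1 ∧
        toEuclid (site v q.1) = x.1 ∧ (b x : PoissonAlg v) = freqElem q := by
  have hex : ∀ x : ((geometricGraph v).connectedComponentMk (toEuclid (site v p.1))).supp,
      ∃ q : NormalFrequency v, q ∈ reachableSet p ∧ toEuclid (site v q.1) = x.1 := by
    rintro ⟨x, hx⟩
    obtain ⟨q, hq, hqx⟩ := hv.lift_reachable (SimpleGraph.ConnectedComponent.eq.1 hx).symm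
    exact ⟨⟨q, hv.normal_of_reachable hq p.2⟩, hq, hqx⟩
  choose g hg hgx using hex
  have hinj : Function.Injective g := fun x y h => Subtype.ext (by rw [← hgx, ← hgx, h])
  have hrange : Set.range (freqElem ∘ g) = freqElem '' reachableSet p := by
    rw [Set.range_comp]
    congr 1
    refine Set.Subset.antisymm (Set.range_subset_iff.2 hg) fun q hq => ?_
    let x : ((geometricGraph v).connectedComponentMk (toEuclid (site v p.1))).supp :=
      ⟨toEuclid (site v q.1), SimpleGraph.ConnectedComponent.eq.2 (hv.reachable_geo hq).symm⟩
    exact ⟨x, Subtype.ext (hv.unique p.2 (hg x) hq (toEuclid_injective (hgx x)))⟩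
  have hspan : Submodule.span ℂ (Set.range (freqElem ∘ g)) = block T (freqElem p) := by
    rw [hrange, hT.block_eq hv]
  refine ⟨(Module.Basis.span (linearIndependent_freqElem.comp g hinj)).map
    (LinearEquiv.ofEq _ _ hspan), fun x => ⟨g x, hg x, hgx x, ?_⟩⟩
  rw [Module.Basis.map_apply, LinearEquiv.coe_ofEq_apply, Module.Basis.coe_span_apply]
  rfl

end Generation

/-! ### From genericity to the theorem -/

section Main

variable {n m : ℕ} {v : Fin m → Fin n → ℤ}

theorem AvoidsResonances.goodSites (hn : n ≠ 0) (hv : AvoidsResonances v) : GoodSites v :=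
  ⟨fun _ _ _ hxy hxz => hv.angle_ne_zero hn hxy hxz,
    fun _ _ hp hq h => hv.eq_of_site_eq hn hp hq h⟩

/-- Without tangential sites there are no edges. This serves the case `n = m = 0`, to which the
resonance arguments do not apply. -/
theorem goodSites_of_isEmpty [IsEmpty (Fin m)] : GoodSites v where
  angle x := isEmptyElim x
  eq_of_site_eq p q _ hpq _ := by
    obtain ⟨w⟩ := hpq
    cases w with
    | nil => rfl
    | cons h _ => exact isEmptyElim (combinatorialGraph_adj.1 h).choose

end Main

end NLSGraph

open NLSGraph in
theorem mainTheorem5 (n : ℕ) :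
    ∃ R : Finset (Σ k : ℕ, MvPolynomial (Fin k × Fin n) ℤ),
      (∀ r ∈ R, r.1 ≤ 2 * n + 2 ∧ r.2 ≠ 0) ∧
      ∀ (m : ℕ) (v : Fin m → Fin n → ℤ), IsGeneric R v →
        -- the edges of the combinatorial graph are the non-zero off-diagonal entries of `ad(N)`
        (∀ (ξ : Fin m → ℝ), (∀ i, 0 < ξ i) → ∀ p q : NormalFrequency v, p ≠ q →
          ((adN v ξ (freqElem p)).coeff (freqExponent q) ≠ 0 ↔
            (combinatorialGraph v).Adj p.1 q.1)) ∧
        -- the vectors of `S` form a connected component of the geometric graph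
        (∀ i : Fin m, ((geometricGraph v).connectedComponentMk (toEuclid (v i))).supp =
          Set.range fun j => toEuclid (v j)) ∧
        ∀ p₀ : NormalFrequency v,
          -- `-π` is a graph isomorphism of the components, compatible with colours and markings
          (∃ φ : (combinatorialGraph v).induce
                ((combinatorialGraph v).connectedComponentMk p₀.1).supp ≃g
              (geometricGraph v).induce
                ((geometricGraph v).connectedComponentMk (toEuclid (site v p₀.1))).supp,
            (∀ p, (φ p : EuclideanSpace ℝ (Fin n)) = toEuclid (site v p.1)) ∧
            ∀ p q, ∀ i j : Fin m, i ≠ j →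
              (CombBlack v i j p.1 q.1 ↔ GeoBlack v i j (φ p).1 (φ q).1) ∧
              (CombRed v i j p.1 q.1 ↔ GeoRed v i j (φ p).1 (φ q).1)) ∧
          -- the block generated by the frequency `p₀` has a basis extracted from the frequency
          -- basis, indexed through `-π` by the vertices of the geometric component
          (∃ b : Module.Basis
              ((geometricGraph v).connectedComponentMk (toEuclid (site v p₀.1))).supp ℂ
              (block (adN v) (freqElem p₀)),
            ∀ x, ∃ q : NormalFrequency v,
              (combinatorialGraph v).Reachable p₀.1 q.1 ∧
              toEuclid (site v q.1) = x.1 ∧ (b x : PoissonAlg v) = freqElem q) ∧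
          block (adQ v) (freqElem p₀) = block (adN v) (freqElem p₀) ∧
          -- for every fixed parameter, the block is the smallest invariant space containing
          -- the generator among those spanned by elements of the frequency basis
          ∀ (ξ : Fin m → ℝ), (∀ i, 0 < ξ i) →
            (∀ f ∈ block (adN v) (freqElem p₀), adN v ξ f ∈ block (adN v) (freqElem p₀)) ∧
            ∀ U : Set (NormalFrequency v), p₀ ∈ U →
              (∀ f ∈ Submodule.span ℂ (freqElem '' U),
                adN v ξ f ∈ Submodule.span ℂ (freqElem '' U)) →
              block (adN v) (freqElem p₀) ≤ Submodule.span ℂ (freqElem '' U) := by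
  obtain ⟨R, hR, hgen⟩ := exists_resonances n
  refine ⟨R, hR, fun m v hv => ?_⟩
  -- For `n = 0` the single lattice point is tangential as soon as `m > 0`, so there are no normal
  -- frequencies.
  by_cases hcase : n = 0 ∧ 0 < m
  · obtain ⟨rfl, hm⟩ := hcase
    have hempty : IsEmpty (NormalFrequency v) :=
      ⟨fun p => p.2 ⟨⟨0, hm⟩, Subsingleton.elim _ _⟩⟩
    refine ⟨fun _ _ p => hempty.elim p, fun i => ?_, fun p => hempty.elim p⟩
    ext x
    have hx : toEuclid (v i) = x := Subsingleton.elim _ _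
    rw [← hx]
    exact iff_of_true rfl ⟨i, rfl⟩
  have hgood : GoodSites v := by
    rcases eq_or_ne n 0 with h0 | h0
    · have hm : m = 0 := by
        by_contra h
        exact hcase ⟨h0, Nat.pos_of_ne_zero h⟩
      subst hm
      exact goodSites_of_isEmpty
    · exact (hgen m v hv).goodSites h0
  refine ⟨fun ξ hξ p q hpq => hgood.isHopping_adN.freqCoeff_ne_zero_iff hgood hξ hpq,
    hgood.special_component, fun p₀ => ⟨hgood.exists_iso p₀.2,
      hgood.isHopping_adN.exists_basis hgood p₀, ?_, fun ξ hξ => ⟨fun f hf => ?_,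
        fun U hp hU => hgood.isHopping_adN.block_le hgood hξ hp hU⟩⟩⟩
  · rw [hgood.isHopping_adQ.block_eq hgood, hgood.isHopping_adN.block_eq hgood]
  · rw [hgood.isHopping_adN.block_eq hgood] at hf ⊢
    exact hgood.isHopping_adN.mem_span hgood (fun q q' hq h => hq.trans h.reachable) ξ hf
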